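/- **Setting.** A Kokotsakis polyhedron with quadrilateral base is a polyhedral surface in $\mathbb R^3$ with a planar simple base $A_1A_2A_3A_4$, planar side faces $A_1A_2B_2B_1$, $A_2A_3C_3C_2$, $A_3A_4B_4B_3$, $A_4A_1C_1C_4$ and corner triangles $A_iB_iC_i$ (self-intersections between different faces are allowed). Its planar angles at $A_i$ are $\delta_i$ (base), $\alpha_i$ (side face on $A_1A_2$ resp. $A_3A_4$), $\gamma_i$ (side face on $A_4A_1$ resp. $A_2A_3$) and $\beta_i=\angle B_iA_iC_i$. Let $\varphi,\psi_1,\theta,\psi_2$ be the signed exterior dihedral angles at $A_1A_2$, $A_4A_1$, $A_3A_4$, $A_2A_3$. Put (for $\delta_i\neq\frac\pi2$) $$\lambda_i=\frac{\tan\delta_i+\tan\alpha_i}{\tan\delta_i-\tan\alpha_i},\qquad \mu_i=\frac{\tan\delta_i+\tan\gamma_i}{\tan\delta_i-\tan\gamma_i},\qquad \nu_i=\frac{(\lambda_i-1)(\mu_i-1)}{\cos\delta_i}.$$ The polyhedron is of orthodiagonal anti-involutive (OAI) type if $\cos\alpha_i\cos\gamma_i=\cos\beta_i\cos\delta_i$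 for all $i$; the quadrilaterals are elliptic, i.e. $\alpha_i\pm\beta_i\pm\gamma_i\pm\delta_i\not\equiv0\pmod{2\pi}$ for all $i$ and all signs; $\lambda_1=-\lambda_2$, $\mu_1=-\mu_4$, $\mu_2=-\mu_3$, $\lambda_3=-\lambda_4$; and $$\frac{\nu_1^2}{\lambda_1\mu_1}=\frac{\nu_3^2}{\lambda_3\mu_3},\qquad \frac{\nu_2^2}{\lambda_2\mu_2}=\frac{\nu_4^2}{\lambda_4\mu_4},\qquad \frac{\nu_1^2}{\lambda_1\mu_1}+\frac{\nu_2^2}{\lambda_2\mu_2}=16.$$ **Procedure.** 1. Check that $\delta_i>0$, $\delta_i\notin\{\frac\pi2,\frac{3\pi}2\}$ and $\delta_1+\delta_2+\delta_3+\delta_4=2\pi$. 2. Put $s=\frac{\delta_1-\delta_2+\delta_3-\delta_4}4$, $x=\frac{\delta_1-\delta_3}2$, $y=\frac{\delta_2-\delta_4}2$. 3. Choose $\tau\in\mathbb R$ and let $r_1=r_1(\tau,x,y,s)$, $c_1=r_1(\tau+\pi,x,-y,s)$, $r_3=r_1(\tau,-x,-y,s)$, $c_3=r_1(\tau+\pi,-x,y,s)$,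 where $r_1(\tau,x,y,s)=\frac{N+S\sqrt L}{2D}$ with - $S=(\cos2x+\cos2y+2\cos2s)\cos\tau+(\cos2x-\cos2y)\sin\tau$, - $L=\big((\cos2x-\cos2y)^2+8\cos2s(\cos2x+\cos2y)\big)\cos^2\tau+2(\cos2x-\cos2y)(\cos2x+\cos2y+2\cos2s)\sin\tau\cos\tau+(\cos2x+\cos2y-2\cos2s)^2\sin^2\tau$, - $N=\sin(x+y)\big(\sin(x-3y)+\sin(3x-y)+6\sin(x-y+2s)-2\sin(x-y-2s)\big)\cos^2\tau+8\big(\sin^2(x+s)\cos^2(x-s)+\sin^2(y-s)\cos^2(y+s)\big)\sin\tau\cos\tau+(\cos2y-\cos2x)(\cos2x+\cos2y-2\cos2s)\sin^2\tau$, - $D=\cos(x-y)\big(\cos(3x+y)+\cos(x+3y)+2\cos(x+y-2s)+4\cos(x+3s)\cos(y-s)\big)\cos^2\tau+\big(\cos4x-\cos4y-4\sin(x+y)\sin(x-y+2s)\big)\sin\tau\cos\tau+\sin(x-y)\big(\sin(x+3y)-\sin(3x+y)+2\sin(x+y-2s)-4\cos(x+3s)\sin(y-s)\big)\sin^2\tau$.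 Check that these four numbers are defined ($L\ge0$, $D\ne0$) and lie in $[-1,1)$; put $r_2=-r_1$, $r_4=-r_3$, $c_2=-c_3$, $c_4=-c_1$. 4. Choose signs $\sigma_i^\alpha,\sigma_i^\gamma=\pm1$ with $\sigma^\alpha_1\sigma^\alpha_2=\sigma^\alpha_3\sigma^\alpha_4=\sigma^\gamma_1\sigma^\gamma_4=\sigma^\gamma_2\sigma^\gamma_3=1$, check that $r_i,c_i\ne-1$, and find $\alpha_i,\gamma_i\in(0,\pi)\setminus\{\frac\pi2\}$ with $\tan\alpha_i=\sigma_i^\alpha\sqrt{\frac{1-r_i}{1+r_i}}\tan\delta_i$, $\tan\gamma_i=\sigma_i^\gamma\sqrt{\frac{1-c_i}{1+c_i}}\tan\delta_i$ (check that they exist). 5. Check that $\frac{\cos\alpha_i\cos\gamma_i}{\cos\delta_i}\in(-1,1)$ and let $\beta_i\in(0,\pi)$ have this cosine. 6. Check that $\alpha_i\pm\beta_i\pm\gamma_i\pm\delta_i\not\equiv0\pmod{2\pi}$ for all $i$ and all signs. 7. Compute $\lambda_i,\mu_i,\nu_i$. 8. Re-enumerate the vertices cyclically (a shift by one vertex exchanges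 the roles of $\alpha$ and $\gamma$, $\lambda$ and $\mu$, $B$ and $C$) so that $(\lambda_1,\mu_1),\dots,(\lambda_4,\mu_4)$ have signs $(+,+),(-,+),(-,-),(+,-)$. 9. Put $\zeta=\frac{|\nu_1|}{4\sqrt{\lambda_1\mu_1}}$, $F(t)=\sin t\sqrt{\zeta-1}+\sqrt{1+(\zeta-1)\sin^2t}$, $G(t)=\sin t\sqrt{1+(\zeta-1)\sin^2t}$, $V(t)=\sin t\sqrt{1+(\zeta-1)\cos^2t}$, and, for a choice of $\pm$ (the same in $u$ and $w_2$), $$\begin{aligned}z&=\operatorname{sgn}\nu_1\sqrt{\lambda_1}\,F(t)F(t+\tfrac\pi2),&\qquad w_1&=\sqrt{\mu_1}\,F(t)F(t-\tfrac\pi2),\\ u&=\operatorname{sgn}\nu_4\sqrt{-\lambda_3}\,\frac{\sqrt{\zeta+1}\pm(G(t)+G(t+\frac\pi2))}{V(t)-V(t+\frac\pi2)},&\qquad w_2&=\sqrt{-\mu_3}\,\frac{\operatorname{sgn}(\nu_1\nu_2)\sqrt{\zeta+1}\pm\operatorname{sgn}(\nu_3\nu_4)(G(t)+G(t-\frac\pi2))}{V(t)-V(t-\frac\pi2)}\end{aligned}$$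 with values in $\mathbb R\cup\{\infty\}$ ($\tfrac00$ is a removable singularity with value $0$). **Theorem.** Suppose that all checks in steps 1–6 pass. Then the angles $(\alpha_i,\beta_i,\gamma_i,\delta_i)$ are of OAI type, and a re-enumeration as in step 8 exists. There are simple planar quadrilaterals with angles $\delta_1,\dots,\delta_4$, and each of them is the base of a Kokotsakis polyhedron with planar angles $(\alpha_i,\beta_i,\gamma_i,\delta_i)$. Every Kokotsakis polyhedron with these planar angles is flexible. More precisely, for every re-enumeration as in step 8, every global sign $\varepsilon=\pm1$ and every choice of $\pm$ there is a continuous family, with parameter $t\in\mathbb R$, of positions of the polyhedron over the fixed base, with all faces congruent to the original ones, whose dihedral angles are $$(\varphi,\psi_1,\theta,\psi_2)=(2\arctan\varepsilon z,\,2\arctan\varepsilon w_1,\,2\arctan\varepsilon u,\,2\arctan\varepsilon w_2)\pmod{2\pi}\qquad(2\arctan\infty=\pi),$$ and none of the four angles is constant in $t$; and every position of the polyhedron over the same base with all faces congruent to the original ones has the dihedral angles given by these formulas for some $\varepsilon$, some choice of $\pm$ and some $t\in[0,2\pi)$. -/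

import Mathlib

open Real
open scoped EuclideanGeometry

noncomputable section

namespace Kokotsakis

/-! ### Planar angles and the orthodiagonal anti-involutive type

The four base vertices `A₁, A₂, A₃, A₄` are indexed by `0, 1, 2, 3 : Fin 4` (cyclically). -/

/-- The planar angles `αᵢ, βᵢ, γᵢ, δᵢ` at the four base vertices: `δᵢ` is the angle of the base,
`αᵢ` the angle of the side face on the edge `A₁A₂` (for `i = 1, 2`) or `A₃A₄` (for `i = 3, 4`),
`γᵢ` the angle of the side face on the edge `A₄A₁` (for `i = 1, 4`) or `A₂A₃` (for `i = 2, 3`),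
and `βᵢ` the angle of the corner triangle. -/
structure PlanarAngles where
  α : Fin 4 → ℝ
  β : Fin 4 → ℝ
  γ : Fin 4 → ℝ
  δ : Fin 4 → ℝ

namespace PlanarAngles

variable (Θ : PlanarAngles)

/-- The involution factor `λᵢ`. For `α, δ` not both `π / 2` it is
`(tan δ + tan α) / (tan δ - tan α)`, written here as `sin (δ + α) / sin (δ - α)`, which is also
correct when exactly one of the two tangents is infinite. -/
def lam (i : Fin 4) : ℝ :=
  if Θ.α i = π / 2 ∧ Θ.δ i = π / 2 then
    (cos (Θ.β i) + cos (Θ.γ i)) / (cos (Θ.β i) - cos (Θ.γ i))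
  else sin (Θ.δ i + Θ.α i) / sin (Θ.δ i - Θ.α i)

/-- The involution factor `μᵢ`; for `γ, δ` not both `π / 2` it is
`(tan δ + tan γ) / (tan δ - tan γ)`. -/
def mu (i : Fin 4) : ℝ :=
  if Θ.γ i = π / 2 ∧ Θ.δ i = π / 2 then
    (cos (Θ.β i) + cos (Θ.α i)) / (cos (Θ.β i) - cos (Θ.α i))
  else sin (Θ.δ i + Θ.γ i) / sin (Θ.δ i - Θ.γ i)

/-- The coefficient `νᵢ`. -/
def nu (i : Fin 4) : ℝ :=
  if Θ.δ i ≠ π / 2 then (Θ.lam i - 1) * (Θ.mu i - 1) / cos (Θ.δ i)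
  else if Θ.γ i = π / 2 then 2 * (Θ.mu i - 1) * tan (Θ.α i)
  else 2 * (Θ.lam i - 1) * tan (Θ.γ i)

/-- The spherical quadrilateral `Qᵢ` with sides `αᵢ, βᵢ, γᵢ, δᵢ` is elliptic:
`α ± β ± γ ± δ ≠ 0 (mod 2π)` for all choices of signs. -/
def Elliptic (i : Fin 4) : Prop :=
  ∀ e₁ e₂ e₃ : ℝ, (e₁ = 1 ∨ e₁ = -1) → (e₂ = 1 ∨ e₂ = -1) → (e₃ = 1 ∨ e₃ = -1) →
    ∀ n : ℤ, Θ.α i + e₁ * Θ.β i + e₂ * Θ.γ i + e₃ * Θ.δ i ≠ 2 * π * n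

/-- The orthodiagonal anti-involutive (OAI) type. -/
structure IsOAI : Prop where
  orthodiagonal : ∀ i, cos (Θ.α i) * cos (Θ.γ i) = cos (Θ.β i) * cos (Θ.δ i)
  elliptic : ∀ i, Θ.Elliptic i
  lam_zero_one : Θ.lam 0 = -Θ.lam 1
  mu_zero_three : Θ.mu 0 = -Θ.mu 3
  mu_one_two : Θ.mu 1 = -Θ.mu 2
  lam_two_three : Θ.lam 2 = -Θ.lam 3
  nu_zero_two : Θ.nu 0 ^ 2 / (Θ.lam 0 * Θ.mu 0) = Θ.nu 2 ^ 2 / (Θ.lam 2 * Θ.mu 2)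
  nu_one_three : Θ.nu 1 ^ 2 / (Θ.lam 1 * Θ.mu 1) = Θ.nu 3 ^ 2 / (Θ.lam 3 * Θ.mu 3)
  nu_sum : Θ.nu 0 ^ 2 / (Θ.lam 0 * Θ.mu 0) + Θ.nu 1 ^ 2 / (Θ.lam 1 * Θ.mu 1) = 16

/-- The sign pattern `(λ, μ) = (+, +), (-, +), (-, -), (+, -)` at the vertices `1, 2, 3, 4`. -/
def SignPattern : Prop :=
  (0 < Θ.lam 0 ∧ 0 < Θ.mu 0) ∧ (Θ.lam 1 < 0 ∧ 0 < Θ.mu 1) ∧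
  (Θ.lam 2 < 0 ∧ Θ.mu 2 < 0) ∧ (0 < Θ.lam 3 ∧ Θ.mu 3 < 0)

/-- Cyclic re-enumeration of the vertices: the old vertex `i + 1` becomes the vertex `i`. The new
first edge is the old edge `A₂A₃`, so the roles of `α` and `γ` are exchanged. -/
def rot : PlanarAngles where
  α i := Θ.γ (i + 1)
  β i := Θ.β (i + 1)
  γ i := Θ.α (i + 1)
  δ i := Θ.δ (i + 1)

end PlanarAngles

/-! ### The parameters `rᵢ, cᵢ` -/

def polyS (τ x y s : ℝ) : ℝ :=
  (cos (2 * x) + cos (2 * y) + 2 * cos (2 * s)) * cos τ + (cos (2 * x) - cos (2 * y)) * sin τ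

def polyL (τ x y s : ℝ) : ℝ :=
  ((cos (2 * x) - cos (2 * y)) ^ 2 + 8 * cos (2 * s) * (cos (2 * x) + cos (2 * y))) * cos τ ^ 2 +
  2 * (cos (2 * x) - cos (2 * y)) * (cos (2 * x) + cos (2 * y) + 2 * cos (2 * s)) *
    (sin τ * cos τ) +
  (cos (2 * x) + cos (2 * y) - 2 * cos (2 * s)) ^ 2 * sin τ ^ 2

def polyN (τ x y s : ℝ) : ℝ :=
  sin (x + y) * (sin (x - 3 * y) + sin (3 * x - y) + 6 * sin (x - y + 2 * s)
    - 2 * sin (x - y - 2 * s)) * cos τ ^ 2 +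
  8 * (sin (x + s) ^ 2 * cos (x - s) ^ 2 + sin (y - s) ^ 2 * cos (y + s) ^ 2) *
    (sin τ * cos τ) +
  (cos (2 * y) - cos (2 * x)) * (cos (2 * x) + cos (2 * y) - 2 * cos (2 * s)) * sin τ ^ 2

def polyD (τ x y s : ℝ) : ℝ :=
  cos (x - y) * (cos (3 * x + y) + cos (x + 3 * y) + 2 * cos (x + y - 2 * s)
    + 4 * cos (x + 3 * s) * cos (y - s)) * cos τ ^ 2 +
  (cos (4 * x) - cos (4 * y) - 4 * sin (x + y) * sin (x - y + 2 * s)) * (sin τ * cos τ) +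
  sin (x - y) * (sin (x + 3 * y) - sin (3 * x + y) + 2 * sin (x + y - 2 * s)
    - 4 * cos (x + 3 * s) * sin (y - s)) * sin τ ^ 2

/-- The function `r₁(τ, x, y, s) = (N + S √L) / (2 D)`. -/
def r₁ (τ x y s : ℝ) : ℝ :=
  (polyN τ x y s + polyS τ x y s * √(polyL τ x y s)) / (2 * polyD τ x y s)

/-- The expression `r₁(τ, x, y, s)` makes sense as a real number. -/
def Defined (τ x y s : ℝ) : Prop := 0 ≤ polyL τ x y s ∧ polyD τ x y s ≠ 0

def paramX (δ : Fin 4 → ℝ) : ℝ := (δ 0 - δ 2) / 2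
def paramY (δ : Fin 4 → ℝ) : ℝ := (δ 1 - δ 3) / 2
def paramS (δ : Fin 4 → ℝ) : ℝ := (δ 0 - δ 1 + δ 2 - δ 3) / 4

/-- The numbers `r₁, r₂ = -r₁, r₃, r₄ = -r₃`. -/
def r (δ : Fin 4 → ℝ) (τ : ℝ) : Fin 4 → ℝ :=
  ![r₁ τ (paramX δ) (paramY δ) (paramS δ), -r₁ τ (paramX δ) (paramY δ) (paramS δ),
    r₁ τ (-paramX δ) (-paramY δ) (paramS δ), -r₁ τ (-paramX δ) (-paramY δ) (paramS δ)]

/-- The numbers `c₁, c₂ = -c₃, c₃, c₄ = -c₁`. -/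
def c (δ : Fin 4 → ℝ) (τ : ℝ) : Fin 4 → ℝ :=
  ![r₁ (τ + π) (paramX δ) (-paramY δ) (paramS δ), -r₁ (τ + π) (-paramX δ) (paramY δ) (paramS δ),
    r₁ (τ + π) (-paramX δ) (paramY δ) (paramS δ), -r₁ (τ + π) (paramX δ) (-paramY δ) (paramS δ)]

/-- The checks of the construction, for the base angles `Θ.δ`, the parameter `τ` and the signs
`σα, σγ`; the angles `Θ.α, Θ.γ, Θ.β` are the ones that are computed on the way. -/
structure ChecksPass (τ : ℝ) (σα σγ : Fin 4 → ℝ) (Θ : PlanarAngles) : Prop where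
  /- the base angles belong to a quadrilateral without right angles -/
  δ_pos : ∀ i, 0 < Θ.δ i
  δ_not_right : ∀ i, Θ.δ i ≠ π / 2 ∧ Θ.δ i ≠ 3 * π / 2
  δ_sum : Θ.δ 0 + Θ.δ 1 + Θ.δ 2 + Θ.δ 3 = 2 * π
  /- the numbers `r₁, r₃, c₁, c₃` are defined and lie in `[-1, 1)` -/
  r_zero_defined : Defined τ (paramX Θ.δ) (paramY Θ.δ) (paramS Θ.δ)
  r_two_defined : Defined τ (-paramX Θ.δ) (-paramY Θ.δ) (paramS Θ.δ)
  c_zero_defined : Defined (τ + π) (paramX Θ.δ) (-paramY Θ.δ) (paramS Θ.δ)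
  c_two_defined : Defined (τ + π) (-paramX Θ.δ) (paramY Θ.δ) (paramS Θ.δ)
  r_zero_mem : -1 ≤ r Θ.δ τ 0 ∧ r Θ.δ τ 0 < 1
  r_two_mem : -1 ≤ r Θ.δ τ 2 ∧ r Θ.δ τ 2 < 1
  c_zero_mem : -1 ≤ c Θ.δ τ 0 ∧ c Θ.δ τ 0 < 1
  c_two_mem : -1 ≤ c Θ.δ τ 2 ∧ c Θ.δ τ 2 < 1
  /- the signs -/
  σα_sign : ∀ i, σα i = 1 ∨ σα i = -1
  σγ_sign : ∀ i, σγ i = 1 ∨ σγ i = -1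
  σα_zero_one : σα 0 * σα 1 = 1
  σα_two_three : σα 2 * σα 3 = 1
  σγ_zero_three : σγ 0 * σγ 3 = 1
  σγ_one_two : σγ 1 * σγ 2 = 1
  /- the angles `αᵢ, γᵢ` in `(0, π)` are computed from their tangents -/
  r_ne : ∀ i, 1 + r Θ.δ τ i ≠ 0
  c_ne : ∀ i, 1 + c Θ.δ τ i ≠ 0
  α_mem : ∀ i, 0 < Θ.α i ∧ Θ.α i < π ∧ Θ.α i ≠ π / 2
  γ_mem : ∀ i, 0 < Θ.γ i ∧ Θ.γ i < π ∧ Θ.γ i ≠ π / 2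
  tan_α : ∀ i, tan (Θ.α i) = σα i * √((1 - r Θ.δ τ i) / (1 + r Θ.δ τ i)) * tan (Θ.δ i)
  tan_γ : ∀ i, tan (Θ.γ i) = σγ i * √((1 - c Θ.δ τ i) / (1 + c Θ.δ τ i)) * tan (Θ.δ i)
  /- the angles `βᵢ` are defined -/
  β_check : ∀ i, -1 < cos (Θ.α i) * cos (Θ.γ i) / cos (Θ.δ i) ∧
    cos (Θ.α i) * cos (Θ.γ i) / cos (Θ.δ i) < 1
  β_eq : ∀ i, Θ.β i = arccos (cos (Θ.α i) * cos (Θ.γ i) / cos (Θ.δ i))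
  /- the spherical quadrilaterals are elliptic -/
  elliptic : ∀ i, Θ.Elliptic i

/-! ### Kokotsakis polyhedra in space -/

/-- Euclidean space `ℝ³`. -/
abbrev E3 : Type := EuclideanSpace ℝ (Fin 3)

/-- The plane `ℂ = ℝ²` as the coordinate plane of height `0`. -/
def emb (p : ℂ) : E3 := !₂[p.re, p.im, 0]

/-- `P` is a quadrilateral in the plane, traversed counterclockwise, whose interior angle at `P i`
is `δ i`: the ray from `P i` to `P (i - 1)` is obtained from the ray to `P (i + 1)` by the
counterclockwise rotation through `δ i`. For `0 < δ i` with sum `2π` such a quadrilateral is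
automatically simple, and `δ i > π` is a reflex angle. -/
def HasInteriorAngles (P : Fin 4 → ℂ) (δ : Fin 4 → ℝ) : Prop :=
  ∀ i, P (i + 1) ≠ P i ∧
    ∃ ρ : ℝ, 0 < ρ ∧ P (i - 1) - P i = ρ * Complex.exp (δ i * Complex.I) * (P (i + 1) - P i)

/-- The twelve vertices of a polyhedral surface with the combinatorics of a Kokotsakis polyhedron
with quadrilateral base `A₁A₂A₃A₄`. The side faces are the quadrilaterals `A₁A₂B₂B₁`, `A₃A₄B₄B₃`,
`A₂A₃C₃C₂`, `A₄A₁C₁C₄`, and the corner faces are the triangles `AᵢBᵢCᵢ`. -/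
structure Surface where
  A : Fin 4 → E3
  B : Fin 4 → E3
  C : Fin 4 → E3

/-- The neighbour of a base vertex along the edge `A₁A₂` or `A₃A₄`. -/
def nbrα : Fin 4 → Fin 4 := ![1, 0, 3, 2]

/-- The neighbour of a base vertex along the edge `A₄A₁` or `A₂A₃`. -/
def nbrγ : Fin 4 → Fin 4 := ![3, 2, 1, 0]

/-- `K` is a Kokotsakis polyhedron with planar angles `Θ`, placed in space so that its base is the
quadrilateral `P` in the coordinate plane of height `0`. `SSameSide` says that the other two vertices
of a side face lie in one open half-plane bounded by the line of its base edge (so that the face is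
planar), and disjointness says that its two lateral sides do not meet. -/
structure IsKokotsakis (Θ : PlanarAngles) (P : Fin 4 → ℂ) (K : Surface) : Prop where
  interior : HasInteriorAngles P Θ.δ
  base : ∀ i, K.A i = emb (P i)
  angle_α : ∀ i, ∠ (K.A (nbrα i)) (K.A i) (K.B i) = Θ.α i
  angle_γ : ∀ i, ∠ (K.A (nbrγ i)) (K.A i) (K.C i) = Θ.γ i
  angle_β : ∀ i, ∠ (K.B i) (K.A i) (K.C i) = Θ.β i
  sameSide_B : ∀ i, line[ℝ, K.A i, K.A (nbrα i)].SSameSide (K.B i) (K.B (nbrα i))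
  sameSide_C : ∀ i, line[ℝ, K.A i, K.A (nbrγ i)].SSameSide (K.C i) (K.C (nbrγ i))
  disjoint_B : ∀ i, Disjoint (segment ℝ (K.A i) (K.B i))
    (segment ℝ (K.A (nbrα i)) (K.B (nbrα i)))
  disjoint_C : ∀ i, Disjoint (segment ℝ (K.A i) (K.C i))
    (segment ℝ (K.A (nbrγ i)) (K.C (nbrγ i)))

/-- Corresponding faces of `K` and `L` are congruent: distances between vertices of a common face
agree. -/
def FaceIsometric (K L : Surface) : Prop :=
  (∀ i j, dist (L.A i) (L.A j) = dist (K.A i) (K.A j)) ∧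
  ∀ i, dist (L.A i) (L.B i) = dist (K.A i) (K.B i) ∧
    dist (L.A i) (L.B (nbrα i)) = dist (K.A i) (K.B (nbrα i)) ∧
    dist (L.B i) (L.B (nbrα i)) = dist (K.B i) (K.B (nbrα i)) ∧
    dist (L.A i) (L.C i) = dist (K.A i) (K.C i) ∧
    dist (L.A i) (L.C (nbrγ i)) = dist (K.A i) (K.C (nbrγ i)) ∧
    dist (L.C i) (L.C (nbrγ i)) = dist (K.C i) (K.C (nbrγ i)) ∧
    dist (L.B i) (L.C i) = dist (K.B i) (K.C i)

namespace Surface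

/-- All twelve vertices as one family. -/
def vertex (K : Surface) : Fin 3 → Fin 4 → E3 := ![K.A, K.B, K.C]

/-- `K` and `L` differ by an isometry of space: all distances between vertices agree. -/
def Congruent (K L : Surface) : Prop :=
  ∀ m n i j, dist (L.vertex m i) (L.vertex n j) = dist (K.vertex m i) (K.vertex n j)

/-- Continuity of a one-parameter family of surfaces. -/
def ContinuousFamily (L : ℝ → Surface) : Prop :=
  ∀ m i, Continuous fun t => (L t).vertex m i

/-- `K` is flexible: it has a continuous deformation that keeps every face congruent to itself and
is not a family of congruent surfaces. -/
def Flexible (K : Surface) : Prop :=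
  ∃ L : ℝ → Surface, ContinuousFamily L ∧ L 0 = K ∧ (∀ t, FaceIsometric K (L t)) ∧
    ∃ t, ¬ Congruent K (L t)

/-- Cyclic re-enumeration of the vertices of a surface. -/
def rot (K : Surface) : Surface where
  A i := K.A (i + 1)
  B i := K.C (i + 1)
  C i := K.B (i + 1)

end Surface

/-- Cyclic re-enumeration of the vertices of the base. -/
def rotBase (P : Fin 4 → ℂ) : Fin 4 → ℂ := fun i => P (i + 1)

/-- The signed exterior dihedral angle at the edge `P i, P (i + 1)` of the base between the base
plane and the half-plane through `X`: the polar angle of `X - P i` in the plane spanned by the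
outer unit normal of the edge in the base plane and the upward vertical unit vector. It is `0` if
the half-plane continues the base plane flatly. -/
def extDihedral (P : Fin 4 → ℂ) (i : Fin 4) (X : E3) : Real.Angle :=
  ((Complex.arg
    ⟨-(((⟨X 0, X 1⟩ : ℂ) - P i) / (P (i + 1) - P i)).im * ‖P (i + 1) - P i‖, X 2⟩ : ℝ) :
    Real.Angle)

/-- The exterior dihedral angles `(φ, ψ₁, θ, ψ₂)` at the edges `A₁A₂`, `A₄A₁`, `A₃A₄`, `A₂A₃`. -/
def dihedrals (P : Fin 4 → ℂ) (K : Surface) : Fin 4 → Real.Angle :=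
  ![extDihedral P 0 (K.B 0), extDihedral P 3 (K.C 3), extDihedral P 2 (K.B 2),
    extDihedral P 1 (K.C 1)]

/-! ### The flexion -/

/-- `2 arctan` on the real projective line `ℝ ∪ {∞}`. -/
def twoArctan : OnePoint ℝ → Real.Angle
  | none => ((π : ℝ) : Real.Angle)
  | some v => ((2 * arctan v : ℝ) : Real.Angle)

/-- The quotient `a / b` in `ℝ ∪ {∞}`, with value `0` if `a = b = 0`. -/
def ratio (a b : ℝ) : OnePoint ℝ :=
  if b = 0 then (if a = 0 then ((0 : ℝ) : OnePoint ℝ) else OnePoint.infty)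
  else ((a / b : ℝ) : OnePoint ℝ)

def fnF (ζ t : ℝ) : ℝ := sin t * √(ζ - 1) + √(1 + (ζ - 1) * sin t ^ 2)
def fnG (ζ t : ℝ) : ℝ := sin t * √(1 + (ζ - 1) * sin t ^ 2)
def fnV (ζ t : ℝ) : ℝ := sin t * √(1 + (ζ - 1) * cos t ^ 2)

/-- The number `ζ₁ = |ν₁| / (4 √(λ₁ μ₁))`. -/
def zeta (Θ : PlanarAngles) : ℝ := |Θ.nu 0| / (4 * √(Θ.lam 0 * Θ.mu 0))

/-- The branch of `(z, w₁, u, w₂)` with sign `κ = ±1` (the sign `±` in `u` and `w₂`), multiplied by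
the global sign `ε = ±1`. The quotients for `u` and `w₂` are of the form `0 / 0` only where they have
a removable singularity with value `0`. -/
def flexion (Θ : PlanarAngles) (ε κ t : ℝ) : Fin 4 → OnePoint ℝ :=
  let ζ := zeta Θ
  ![((ε * (Real.sign (Θ.nu 0) * √(Θ.lam 0) * fnF ζ t * fnF ζ (t + π / 2)) : ℝ) : OnePoint ℝ),
    ((ε * (√(Θ.mu 0) * fnF ζ t * fnF ζ (t - π / 2)) : ℝ) : OnePoint ℝ),
    ratio (ε * (Real.sign (Θ.nu 3) * √(-Θ.lam 2) *
        (√(ζ + 1) + κ * (fnG ζ t + fnG ζ (t + π / 2)))))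
      (fnV ζ t - fnV ζ (t + π / 2)),
    ratio (ε * (√(-Θ.mu 2) *
        (Real.sign (Θ.nu 0 * Θ.nu 1) * √(ζ + 1) +
          κ * Real.sign (Θ.nu 2 * Θ.nu 3) * (fnG ζ t + fnG ζ (t - π / 2)))))
      (fnV ζ t - fnV ζ (t - π / 2))]

/-- The dihedral angles `(2 arctan z, 2 arctan w₁, 2 arctan u, 2 arctan w₂)` of a branch. -/
def flexionAngles (Θ : PlanarAngles) (ε κ t : ℝ) : Fin 4 → Real.Angle :=
  fun j => twoArctan (flexion Θ ε κ t j)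

end Kokotsakis

end

noncomputable section

namespace Kokotsakis

/-! The positions of a polyhedron over a fixed base are the solutions of four equations, one per
vertex, in the half-tangents `z, w₁, u, w₂` of its dihedral angles. A surface is given by the
lengths of its lateral edges and its dihedral angles; the faces fix the lengths, and only the corner
triangles restrict the dihedral angles (`IsKokotsakis.exists_foldedSurface`,
`FaceIsometric.exists_foldedSurface`). Orthodiagonality brings each corner condition to the form `(z
+ λ/z)(w + μ/w) = ν` (`PlanarAngles.Admissible.cornerCos_iff`).

Why the procedure yields OAI angles: with `ρ = tan α / tan δ` one has `λ = (1 + ρ)/(1 - ρ)`, and for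
`r = (1 - ρ²)/(1 + ρ²)` also `(λ - 1)²/λ = 2(1 - r)/r`; the same holds for `γ, μ, c`. So `r₂ = -r₁`
and the like give the sign relations between the factors, and the conditions on `ν` follow from `(1
- r)(1 - c) cos τ = 2 (cos τ ± sin τ) cos² δ · r c` at the four vertices. The closed formulas for
`rᵢ, cᵢ` are roots of quadratics with a common discriminant, and taking opposite roots for adjacent
unknowns gives these relations (`r₁_relations`). Ellipticity excludes `r = 0` and `c = 0`. The bound
on `cos β` gives `ν²/(λμ) > 16` wherever `λμ > 0` (`ChecksPass.lt_nu_sq_div`); as the two values of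
`ν²/(λμ)` add up to `16`, the signs of `λμ` alternate and the sign pattern follows.

The flexion: after scaling and fixing signs, the equation at the first vertex reads `(f - 1/f)² + (g
- 1/g)² = 4(ζ - 1)` with `z = fg`, `w₁ = f/g`. This is a circle, parametrized by `t`. The equations
at the second and fourth vertices are then quadratics for `w₂` and `u`, and their discriminants are
perfect squares (`Curve.mul_sub'`, `Curve.mul_sub`). Where neither denominator vanishes, the third
equation says exactly that the signs of the two square roots are coupled (`Curve.HH`, `Curve.WW`),
which leaves one sign `κ`; the other sign `ε` is the common sign of all four half-tangents. Both
directions are proved: `FlexData.OnFlexion.eqs` and `FlexData.Eqs.exists_onFlexion`.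

All this is done for the enumeration with the prescribed sign pattern and carried to the original
one by cyclic shifts, whose fourth power is the identity. -/

/-! ### The quadratic equations behind the parameters `rᵢ` and `cᵢ` -/

theorem polyS_eq (τ x y s : ℝ) : polyS τ x y s =
    2 * (cos (x + s) * cos (x - s) * (cos τ + sin τ) +
      cos (y + s) * cos (y - s) * (cos τ - sin τ)) := by
  have h1 := Real.two_mul_cos_mul_cos (x + s) (x - s)
  have h2 := Real.two_mul_cos_mul_cos (y + s) (y - s)
  rw [show x + s - (x - s) = 2 * s by ring, show x + s + (x - s) = 2 * x by ring] at h1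
  rw [show y + s - (y - s) = 2 * s by ring, show y + s + (y - s) = 2 * y by ring] at h2
  unfold polyS
  linear_combination (-(cos τ + sin τ)) * h1 - (cos τ - sin τ) * h2

/-- In the variables `p = cos τ + sin τ`, `q = cos τ - sin τ` the form `L` differs from `S²` only by
a multiple of `p q`, which is the shape needed in `numPoly_sq`. -/
theorem polyL_eq (τ x y s : ℝ) : polyL τ x y s =
    polyS τ x y s ^ 2 + 16 * (sin (x + s) * sin (x - s) * sin (y + s) * sin (y - s)) *
      ((cos τ + sin τ) * (sin τ - cos τ)) := by
  have h1 := Real.two_mul_sin_mul_sin (x + s) (x - s)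
  have h2 := Real.two_mul_sin_mul_sin (y + s) (y - s)
  rw [show x + s - (x - s) = 2 * s by ring, show x + s + (x - s) = 2 * x by ring] at h1
  rw [show y + s - (y - s) = 2 * s by ring, show y + s + (y - s) = 2 * y by ring] at h2
  have h3 : 16 * (sin (x + s) * sin (x - s) * sin (y + s) * sin (y - s)) =
      4 * (cos (2 * s) - cos (2 * x)) * (cos (2 * s) - cos (2 * y)) := by rw [← h1, ← h2]; ring
  rw [h3]
  unfold polyS polyL
  ring

/-- Coefficients of the quadratic `den · r² - 2 num · r + con = 0` solved by `r₁`; the `kᵢ` will be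
`cos² δᵢ`. -/
def numPoly (p q k₁ k₂ k₃ k₄ : ℝ) : ℝ :=
  k₂ * q * (p + q - k₄ * q) - k₁ * p * (p + q - k₃ * p)

def denPoly (p q k₁ k₂ k₃ k₄ : ℝ) : ℝ :=
  (p + q - k₄ * q - 2 * k₁ * p) * (2 * k₂ * q - p - q) - k₃ * p * (2 * k₁ * p - p - q)

def conPoly (p q k₃ k₄ : ℝ) : ℝ := (p + q) * (p + q - k₄ * q - k₃ * p)

theorem sin_sq_half (a b : ℝ) : sin (a + b) ^ 2 =
   (1 - (cos (2*a) * cos (2*b) - sin (2*a) * sin (2*b))) / 2 := by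
  rw [← cos_add, ← mul_add, cos_two_mul', cos_sq']; ring
theorem sin_sq_half' (a b : ℝ) : sin (a - b) ^ 2 =
   (1 - (cos (2*a) * cos (2*b) + sin (2*a) * sin (2*b))) / 2 := by
  rw [← cos_sub, ← mul_sub, cos_two_mul', cos_sq']; ring
theorem cos_sq_half' (a b : ℝ) : cos (a - b) ^ 2 =
   (1 + (cos (2*a) * cos (2*b) + sin (2*a) * sin (2*b))) / 2 := by
  rw [cos_sq', sin_sq_half']; ring
theorem cos_sq_half (a b : ℝ) : cos (a + b) ^ 2 =
   (1 + (cos (2*a) * cos (2*b) - sin (2*a) * sin (2*b))) / 2 := by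
  rw [cos_sq', sin_sq_half]; ring
theorem ss (a b : ℝ) : sin a * sin b = (cos (a - b) - cos (a + b)) / 2 := by
  rw [cos_sub, cos_add]; ring
theorem cc (a b : ℝ) : cos a * cos b = (cos (a - b) + cos (a + b)) / 2 := by
  rw [cos_sub, cos_add]; ring
theorem scc (a b : ℝ) : sin a * cos b = (sin (a - b) + sin (a + b)) / 2 := by
  rw [sin_sub, sin_add]; ring

theorem polyN_eq (τ x y s : ℝ) : polyN τ x y s =
    -4 * numPoly (cos τ + sin τ) (cos τ - sin τ)
      (sin (x + s) ^ 2) (sin (y - s) ^ 2) (sin (x - s) ^ 2) (sin (y + s) ^ 2) := by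
  unfold polyN numPoly
  -- Products become sums of cosines of combinations of `2x, 2y, 2s`. After expansion both sides are
  -- polynomials in the sines and cosines of these three angles.
  have e1 : sin (x + y) * (sin (x - 3 * y) + sin (3 * x - y) + 6 * sin (x - y + 2 * s)
    - 2 * sin (x - y - 2 * s)) = ((cos (2*(2*y)) - cos (2*x-2*y)) + (cos (2*x-2*y) - cos (2*(2*x))) +
      6 * (cos (2*y-2*s) - cos (2*x+2*s)) - 2 * (cos (2*y+2*s) - cos (2*x-2*s)))/2 := by
    rw [mul_sub, mul_add, mul_add, mul_left_comm, mul_left_comm _ 2]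
    simp only [ss]
    have h : cos (-(x * 2) + y * 2) = cos (x * 2 - y * 2) := by rw [← cos_neg]; ring_nf
    ring_nf
    rw [h]
    ring
  rw [e1]
  simp only [sin_sq_half, sin_sq_half', cos_sq_half, cos_sq_half']
  generalize 2 * x = X
  generalize 2 * y = Y
  generalize 2 * s = Z
  simp only [cos_add, cos_sub, cos_two_mul]
  ring_nf
  simp only [sin_sq X, sin_sq Y, sin_sq Z]
  ring

theorem polyD_eq (τ x y s : ℝ) : polyD τ x y s =
    -2 * denPoly (cos τ + sin τ) (cos τ - sin τ)
      (sin (x + s) ^ 2) (sin (y - s) ^ 2) (sin (x - s) ^ 2) (sin (y + s) ^ 2) := by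
  unfold polyD denPoly
  have e1 : cos (x - y) * (cos (3 * x + y) + cos (x + 3 * y) + 2 * cos (x + y - 2 * s)
      + 4 * cos (x + 3 * s) * cos (y - s)) =
      (cos (2*x+2*y) + cos (2*(2*x)) + (cos (2*x+2*y) + cos (2*(2*y))) +
        2 * (cos (2*y-2*s)+cos (2*x-2*s)) + 
        2 * (cos (2 * (2*s)) + cos (2*x-2*y+2*(2*s)) + cos (2*y+2*s) + cos (2*x+2*s))) / 2 := by
    have : 4 * cos (x + 3 * s) * cos (y - s) = 2 * (cos (x - y + 4 * s) + cos (x + y+2 * s)) := by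
      rw [mul_assoc, cc]; ring_nf
    rw [this, mul_add, mul_add, mul_add, mul_left_comm, mul_left_comm _ 2, mul_add]
    simp only [cc]
    have h1 : cos (-(y * 2) + s * 2) = cos (y * 2 - s * 2) := by rw [← cos_neg]; ring_nf
    have h3 : cos (-(y * 2) - s * 2) = cos (y * 2 + s * 2) := by rw [← cos_neg]; ring_nf
    have h6 : cos (-(s * 4)) = cos (s * 4) := by rw [← cos_neg]; ring_nf
    have h7 : cos (-(x * 2)-y*2) = cos (x * 2+y*2) := by rw [← cos_neg]; ring_nf
    have h8 : cos (-(y * 4)) = cos (y * 4) := by rw [← cos_neg]; ring_nf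
    ring_nf
    simp only [h1, h3, h6, h7, h8]
    ring
  have e2 : sin (x - y) * (sin (x + 3 * y) - sin (3 * x + y) + 2 * sin (x + y - 2 * s)
      - 4 * cos (x + 3 * s) * sin (y - s)) = 
      (cos (2*(2*y)) - cos (2*x+2*y) - (cos (2*x+2*y) - cos (2*(2*x))) +
        2 * (cos (2*y-2*s)-cos (2*x-2*s)) + 
        2 * (cos (2 * (2*s)) - cos (2*x-2*y+2*(2*s)) - cos (2*y+2*s) + cos (2*x+2*s))) / 2 := by
    have : 4 * cos (x + 3 * s) * sin (y - s) = 2 * (sin (x + y+2 * s) - sin (x - y + 4 * s)) := by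
      rw [mul_assoc, mul_comm (cos _), scc, ← neg_sub (x+ 3*s), sin_neg]; ring_nf
    rw [this, mul_sub, mul_add, mul_sub, mul_left_comm, mul_left_comm _ 2, mul_sub]
    simp only [ss]
    have h1 : cos (-(y * 2) + s * 2) = cos (y * 2 - s * 2) := by rw [← cos_neg]; ring_nf
    have h3 : cos (-(y * 2) - s * 2) = cos (y * 2 + s * 2) := by rw [← cos_neg]; ring_nf
    have h6 : cos (-(s * 4)) = cos (s * 4) := by rw [← cos_neg]; ring_nf
    have h7 : cos (-(x * 2)-y*2) = cos (x * 2+y*2) := by rw [← cos_neg]; ring_nf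
    have h8 : cos (-(y * 4)) = cos (y * 4) := by rw [← cos_neg]; ring_nf
    ring_nf
    simp only [h1, h3, h6, h7, h8]
    ring
  have e3 : cos (4 * x) - cos (4 * y) - 4 * sin (x + y) * sin (x - y + 2 * s) =
      cos (2*(2*x)) - cos (2*(2*y)) - 2 * (cos (2*y-2*s) - cos (2*x+2*s)) := by
    rw [mul_assoc, ss]; ring_nf
  rw [e1, e2, e3]
  simp only [sin_sq_half, sin_sq_half']
  generalize 2 * x = X
  generalize 2 * y = Y
  generalize 2 * s = Z
  simp only [cos_add, cos_sub, sin_sub, sin_two_mul, cos_two_mul]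
  ring_nf
  simp only [sin_sq X, sin_sq Y, sin_sq Z]
  ring

/-- The left side is `S² L / 16`, so `S √L / 4` is a square root of the discriminant of the
quadratic. Squaring `u - v = e - f` expresses `u v` by `e f`; the remaining `(e f)²` is `k₁ k₂ k₃
k₄`. -/
theorem numPoly_sq {p q u v e f k₁ k₂ k₃ k₄ : ℝ} (h : u - v = e - f)
    (hu : u ^ 2 = (1 - k₁) * (1 - k₃))
    (hv : v ^ 2 = (1 - k₂) * (1 - k₄)) (he : e ^ 2 = k₁ * k₃) (hf : f ^ 2 = k₂ * k₄) :
    (u * p + v * q) ^ 2 * ((u * p + v * q) ^ 2 - 4 * (e * f) * (p * q)) =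
      numPoly p q k₁ k₂ k₃ k₄ ^ 2 - denPoly p q k₁ k₂ k₃ k₄ * conPoly p q k₃ k₄ := by
  unfold numPoly denPoly conPoly
  have h1 : 2 * (u * v) = 2 * (e * f) +
      ((1 - k₁) * (1 - k₃) + (1 - k₂) * (1 - k₄) - k₁ * k₃ - k₂ * k₄) := by
    linear_combination (-(u - v) - (e - f)) * h + hu + hv - he - hf
  have h2 : (u * p + v * q) ^ 2 = (1 - k₁) * (1 - k₃) * p ^ 2 + (1 - k₂) * (1 - k₄) * q ^ 2 +
      (2 * (e * f) + ((1 - k₁) * (1 - k₃) + (1 - k₂) * (1 - k₄) - k₁ * k₃ - k₂ * k₄)) * (p * q) := by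
    linear_combination p ^ 2 * hu + q ^ 2 * hv + p * q * h1
  have h3 : (e * f) ^ 2 = k₁ * k₃ * (k₂ * k₄) := by rw [mul_pow, he, hf]
  rw [h2]
  linear_combination (-4 * p ^ 2 * q ^ 2) * h3

/-- The numbers `(numPoly - m) / denPoly` at two vertices that differ by exchanging `k₂` and `k₄`. -/
theorem rel_sub {p q k₁ k₂ k₃ k₄ m : ℝ} 
    (hm : m ^ 2 = numPoly p q k₁ k₂ k₃ k₄ ^ 2 - denPoly p q k₁ k₂ k₃ k₄ * conPoly p q k₃ k₄)
    (hA : denPoly p q k₁ k₂ k₃ k₄ ≠ 0) (hB : denPoly p q k₁ k₄ k₃ k₂ ≠ 0) {r c : ℝ} 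
    (hr : r = (numPoly p q k₁ k₂ k₃ k₄ - m) / denPoly p q k₁ k₂ k₃ k₄)
    (hc : c = (numPoly p q k₁ k₄ k₃ k₂ + m) / denPoly p q k₁ k₄ k₃ k₂) : 
    (1 - r) * (1 - c) * (p + q) = 4 * p * k₁ * (r * c) := by
  rw [eq_div_iff hA] at hr
  rw [eq_div_iff hB] at hc
  apply mul_left_cancel₀ (mul_ne_zero hA hB)
  have e1 : denPoly p q k₁ k₂ k₃ k₄ * denPoly p q k₁ k₄ k₃ k₂ * ((1 - r) * (1 - c) * (p + q)) =
    (denPoly p q k₁ k₂ k₃ k₄ - r * denPoly p q k₁ k₂ k₃ k₄) *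
      (denPoly p q k₁ k₄ k₃ k₂ - c * denPoly p q k₁ k₄ k₃ k₂) * (p + q) := by ring
  have e2 : denPoly p q k₁ k₂ k₃ k₄ * denPoly p q k₁ k₄ k₃ k₂ * (4 * p * k₁ * (r * c)) =
     4 * p * k₁ * ((r * denPoly p q k₁ k₂ k₃ k₄) * (c * denPoly p q k₁ k₄ k₃ k₂)) := by ring
  rw [e1, e2, hr, hc]
  unfold numPoly denPoly conPoly at *
  -- Because `m` enters `r` and `c` with opposite signs, the terms linear in `m` cancel identically;
  -- only `m²` needs the discriminant.
  linear_combination (-(p + q) + 4 * p * k₁) * hm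

/-- The companion of `rel_sub` for exchanging `k₁` and `k₃`. The plus signs appear because the
adjacent vertex carries `-r` and `-c`. -/
theorem rel_add {p q k₁ k₂ k₃ k₄ m : ℝ} 
    (hm : m ^ 2 = numPoly p q k₁ k₂ k₃ k₄ ^ 2 - denPoly p q k₁ k₂ k₃ k₄ * conPoly p q k₃ k₄)
    (hA : denPoly p q k₁ k₂ k₃ k₄ ≠ 0) (hB : denPoly p q k₃ k₂ k₁ k₄ ≠ 0) {r c : ℝ} 
    (hr : r = (numPoly p q k₁ k₂ k₃ k₄ - m) / denPoly p q k₁ k₂ k₃ k₄)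
    (hc : c = (numPoly p q k₃ k₂ k₁ k₄ + m) / denPoly p q k₃ k₂ k₁ k₄) : 
    (1 + r) * (1 + c) * (p + q) = 4 * q * k₂ * (r * c) := by
  rw [eq_div_iff hA] at hr
  rw [eq_div_iff hB] at hc
  apply mul_left_cancel₀ (mul_ne_zero hA hB)
  have e1 : denPoly p q k₁ k₂ k₃ k₄ * denPoly p q k₃ k₂ k₁ k₄ * ((1 + r) * (1 + c) * (p + q)) =
    (denPoly p q k₁ k₂ k₃ k₄ + r * denPoly p q k₁ k₂ k₃ k₄) *
      (denPoly p q k₃ k₂ k₁ k₄ + c * denPoly p q k₃ k₂ k₁ k₄) * (p + q) := by ring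
  have e2 : denPoly p q k₁ k₂ k₃ k₄ * denPoly p q k₃ k₂ k₁ k₄ * (4 * q * k₂ * (r * c)) =
     4 * q * k₂ * ((r * denPoly p q k₁ k₂ k₃ k₄) * (c * denPoly p q k₃ k₂ k₁ k₄)) := by ring
  rw [e1, e2, hr, hc]
  unfold numPoly denPoly conPoly at *
  linear_combination (-(p + q) + 4 * q * k₂) * hm

theorem polyS_add_pi (τ x y s : ℝ) : polyS (τ + π) x y s = -polyS τ x y s := by
  simp only [polyS, cos_add_pi, sin_add_pi]; ring
theorem polyL_add_pi (τ x y s : ℝ) : polyL (τ + π) x y s = polyL τ x y s := by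
  simp only [polyL, cos_add_pi, sin_add_pi]; ring
theorem polyS_neg_left (τ x y s : ℝ) : polyS τ (-x) y s = polyS τ x y s := by simp [polyS]
theorem polyS_neg_right (τ x y s : ℝ) : polyS τ x (-y) s = polyS τ x y s := by simp [polyS]
theorem polyL_neg_left (τ x y s : ℝ) : polyL τ (-x) y s = polyL τ x y s := by simp [polyL]
theorem polyL_neg_right (τ x y s : ℝ) : polyL τ x (-y) s = polyL τ x y s := by simp [polyL]

theorem sin_neg_add_sq (a b : ℝ) : sin (-a + b) ^ 2 = sin (a - b) ^ 2 := by
  rw [← neg_sub a b |>.trans (by ring : b - a = -a + b), sin_neg, neg_sq]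
theorem sin_neg_sub_sq (a b : ℝ) : sin (-a - b) ^ 2 = sin (a + b) ^ 2 := by
  rw [show -a - b = -(a + b) by ring, sin_neg, neg_sq]

theorem r₁_eq (τ x y s : ℝ) : r₁ τ x y s =
    (numPoly (cos τ + sin τ) (cos τ - sin τ)
      (sin (x + s) ^ 2) (sin (y - s) ^ 2) (sin (x - s) ^ 2) (sin (y + s) ^ 2) -
      polyS τ x y s * √(polyL τ x y s) / 4) / denPoly (cos τ + sin τ) (cos τ - sin τ)
      (sin (x + s) ^ 2) (sin (y - s) ^ 2) (sin (x - s) ^ 2) (sin (y + s) ^ 2) := by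
  rw [r₁, polyN_eq, polyD_eq]
  rw [← mul_div_mul_left _ (denPoly _ _ _ _ _ _) (by norm_num : (-4 : ℝ) ≠ 0)]
  ring_nf

theorem polyS_mul_sqrt_sq {τ x y s : ℝ} (hL : 0 ≤ polyL τ x y s) :
    (polyS τ x y s * √(polyL τ x y s) / 4) ^ 2 =
    numPoly (cos τ + sin τ) (cos τ - sin τ)
      (sin (x + s) ^ 2) (sin (y - s) ^ 2) (sin (x - s) ^ 2) (sin (y + s) ^ 2) ^ 2 -
    denPoly (cos τ + sin τ) (cos τ - sin τ)
      (sin (x + s) ^ 2) (sin (y - s) ^ 2) (sin (x - s) ^ 2) (sin (y + s) ^ 2) *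
    conPoly (cos τ + sin τ) (cos τ - sin τ) (sin (x - s) ^ 2) (sin (y + s) ^ 2) := by
  rw [div_pow, mul_pow, sq_sqrt hL, polyL_eq, polyS_eq,
    ← numPoly_sq (u := cos (x + s) * cos (x - s)) (v := cos (y + s) * cos (y - s))
      (e := - sin (x + s) * sin (x - s)) (f := - sin (y + s) * sin (y - s))]
  · ring
  -- Both `u - e` and `v - f` are `cos 2s`.
  · have h1 := cos_add (x + s) (x - s)
    have h2 := cos_add (y + s) (y - s)
    have h3 := cos_sub (x + s) (x - s)
    have h4 := cos_sub (y + s) (y - s)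
    rw [show x + s - (x - s) = 2 * s by ring] at h3
    rw [show y + s - (y - s) = 2 * s by ring] at h4
    linarith
  · rw [← cos_sq', ← cos_sq']; ring
  · rw [← cos_sq', ← cos_sq']; ring
  · ring
  · ring

theorem polyD_add_pi (τ x y s : ℝ) : polyD (τ + π) x y s = polyD τ x y s := by
  simp only [polyD, cos_add_pi, sin_add_pi]; ring

/-- The four numbers are roots of quadratics of one family: `x ↦ -x` exchanges `k₁, k₃`, `y ↦ -y`
exchanges `k₂, k₄`, and `τ ↦ τ + π` leaves the quadratic forms alone but reverses `S`, hence picks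
the opposite root. Each pair is then covered by `rel_sub` or `rel_add`. -/
theorem r₁_relations {τ x y s : ℝ} (hL : 0 ≤ polyL τ x y s) (h0 : polyD τ x y s ≠ 0)
    (h2 : polyD τ (-x) (-y) s ≠ 0) (h1 : polyD (τ + π) x (-y) s ≠ 0)
    (h3 : polyD (τ + π) (-x) y s ≠ 0) :
    ((1 - r₁ τ x y s) * (1 - r₁ (τ + π) x (-y) s) * cos τ =
      2 * (cos τ + sin τ) * sin (x + s) ^ 2 * (r₁ τ x y s * r₁ (τ + π) x (-y) s)) ∧
    ((1 + r₁ τ x y s) * (1 + r₁ (τ + π) (-x) y s) * cos τ =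
      2 * (cos τ - sin τ) * sin (y - s) ^ 2 * (r₁ τ x y s * r₁ (τ + π) (-x) y s)) ∧
    ((1 - r₁ τ (-x) (-y) s) * (1 - r₁ (τ + π) (-x) y s) * cos τ =
      2 * (cos τ + sin τ) * sin (x - s) ^ 2 * (r₁ τ (-x) (-y) s * r₁ (τ + π) (-x) y s)) ∧
    ((1 + r₁ τ (-x) (-y) s) * (1 + r₁ (τ + π) x (-y) s) * cos τ =
      2 * (cos τ - sin τ) * sin (y + s) ^ 2 * (r₁ τ (-x) (-y) s * r₁ (τ + π) x (-y) s)) := by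
  have hm := polyS_mul_sqrt_sq hL
  have hm' := polyS_mul_sqrt_sq (τ := τ) (x := -x) (y := -y) (s := s)
    (by rwa [polyL_neg_left, polyL_neg_right])
  have e0 := r₁_eq τ x y s
  have e2 := r₁_eq τ (-x) (-y) s
  have e1 := r₁_eq (τ + π) x (-y) s
  have e3 := r₁_eq (τ + π) (-x) y s
  have n0 : ∀ {p q k₁ k₂ k₃ k₄ : ℝ}, numPoly (-p) (-q) k₁ k₂ k₃ k₄ = numPoly p q k₁ k₂ k₃ k₄ := by
    intros; unfold numPoly; ring
  have d0 : ∀ {p q k₁ k₂ k₃ k₄ : ℝ}, denPoly (-p) (-q) k₁ k₂ k₃ k₄ = denPoly p q k₁ k₂ k₃ k₄ := by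
    intros; unfold denPoly; ring
  rw [polyD_add_pi] at h1 h3
  rw [polyD_eq] at h0 h1 h2 h3
  simp only [polyS_add_pi, polyS_neg_left, polyS_neg_right, polyL_add_pi, polyL_neg_left,
    polyL_neg_right, sin_neg_add_sq, sin_neg_sub_sq, cos_add_pi, sin_add_pi,
    show -cos τ + -sin τ = -(cos τ + sin τ) by ring,
    show -cos τ - -sin τ = -(cos τ - sin τ) by ring, n0, d0] at e1 e2 e3 h1 h2 h3 hm'
  have h0 := right_ne_zero_of_mul h0
  have h1 := right_ne_zero_of_mul h1
  have h2 := right_ne_zero_of_mul h2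
  have h3 := right_ne_zero_of_mul h3
  rw [neg_mul, neg_div, sub_neg_eq_add] at e1 e3
  have f1 := rel_sub hm h0 h1 e0 e1
  have f2 := rel_add hm h0 h3 e0 e3
  have f3 := rel_sub hm' h2 h3 e2 e3
  have f4 := rel_add hm' h2 h1 e2 e1
  refine ⟨?_, ?_, ?_, ?_⟩ <;> linarith

/-- The relation between `r i` and `c i` at a vertex. -/
theorem ChecksPass.relation {τ : ℝ} {σα σγ : Fin 4 → ℝ} {Θ : PlanarAngles}
    (h : ChecksPass τ σα σγ Θ) (i : Fin 4) :
    (1 - r Θ.δ τ i) * (1 - c Θ.δ τ i) * cos τ =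
      2 * ![cos τ + sin τ, cos τ - sin τ, cos τ + sin τ, cos τ - sin τ] i * cos (Θ.δ i) ^ 2 *
        (r Θ.δ τ i * c Θ.δ τ i) := by
  have hs := h.δ_sum
  -- Since the angles sum to `2π`, `x + s = δ₁ - π/2`, `y - s = δ₂ - π/2`, `x - s = π/2 - δ₃` and `y
  -- + s = π/2 - δ₄`.
  have hk0 : sin (paramX Θ.δ + paramS Θ.δ) ^ 2 = cos (Θ.δ 0) ^ 2 := by
    rw [← neg_sq, ← cos_add_pi_div_two]; congr 2; unfold paramX paramS; linarith
  have hk2 : sin (paramX Θ.δ - paramS Θ.δ) ^ 2 = cos (Θ.δ 2) ^ 2 := by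
    rw [← cos_sub_pi_div_two, ← cos_neg]; congr 2; unfold paramX paramS; linarith
  have hk3 : sin (paramY Θ.δ + paramS Θ.δ) ^ 2 = cos (Θ.δ 3) ^ 2 := by
    rw [← cos_sub_pi_div_two, ← cos_neg]; congr 2; unfold paramY paramS; linarith
  have hk1 : sin (paramY Θ.δ - paramS Θ.δ) ^ 2 = cos (Θ.δ 1) ^ 2 := by
    rw [← neg_sq, ← cos_add_pi_div_two]; congr 2; unfold paramY paramS; linarith
  obtain ⟨f0, f1, f2, f3⟩ := r₁_relations h.r_zero_defined.1 h.r_zero_defined.2 h.r_two_defined.2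
    h.c_zero_defined.2 h.c_two_defined.2
  rw [hk0] at f0
  rw [hk1] at f1
  rw [hk2] at f2
  rw [hk3] at f3
  fin_cases i <;> simp [r, c] <;> linarith

theorem ChecksPass.r_mem {τ : ℝ} {σα σγ : Fin 4 → ℝ} {Θ : PlanarAngles}
    (h : ChecksPass τ σα σγ Θ) (i : Fin 4) : -1 < r Θ.δ τ i ∧ r Θ.δ τ i < 1 := by
  have h0 := h.r_zero_mem
  have h2 := h.r_two_mem
  have n0 := h.r_ne 0
  have n2 := h.r_ne 2
  have e1 : r Θ.δ τ 1 = -r Θ.δ τ 0 := by simp [r]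
  have e3 : r Θ.δ τ 3 = -r Θ.δ τ 2 := by simp [r]
  have l0 : -1 < r Θ.δ τ 0 := lt_of_le_of_ne h0.1 fun e => n0 (by linarith)
  have l2 : -1 < r Θ.δ τ 2 := lt_of_le_of_ne h2.1 fun e => n2 (by linarith)
  fin_cases i <;> constructor <;> simp only [Fin.zero_eta, Fin.mk_one, Fin.reduceFinMk] <;> linarith

theorem ChecksPass.c_mem {τ : ℝ} {σα σγ : Fin 4 → ℝ} {Θ : PlanarAngles}
    (h : ChecksPass τ σα σγ Θ) (i : Fin 4) : -1 < c Θ.δ τ i ∧ c Θ.δ τ i < 1 := by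
  have h0 := h.c_zero_mem
  have h2 := h.c_two_mem
  have n0 := h.c_ne 0
  have n2 := h.c_ne 2
  have e1 : c Θ.δ τ 1 = -c Θ.δ τ 2 := by simp [c]
  have e3 : c Θ.δ τ 3 = -c Θ.δ τ 0 := by simp [c]
  have l0 : -1 < c Θ.δ τ 0 := lt_of_le_of_ne h0.1 fun e => n0 (by linarith)
  have l2 : -1 < c Θ.δ τ 2 := lt_of_le_of_ne h2.1 fun e => n2 (by linarith)
  fin_cases i <;> constructor <;> simp only [Fin.zero_eta, Fin.mk_one, Fin.reduceFinMk] <;> linarith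

/-! ### From the checks to the OAI conditions -/

/-- If two opposite sides of an orthodiagonal quadrilateral have the same sine, then it is not
elliptic. -/
theorem exists_signs_of_cos_sq_eq {α β γ δ : ℝ} (h : cos α * cos γ = cos β * cos δ)
    (hδ : cos δ ≠ 0) (h2 : cos α ^ 2 = cos δ ^ 2) :
    ∃ e₁ e₂ e₃ : ℝ, (e₁ = 1 ∨ e₁ = -1) ∧ (e₂ = 1 ∨ e₂ = -1) ∧ (e₃ = 1 ∨ e₃ = -1) ∧
      ∃ n : ℤ, α + e₁ * β + e₂ * γ + e₃ * δ = 2 * π * n := by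
  rcases sq_eq_sq_iff_eq_or_eq_neg.1 h2 with h2 | h2
  · have h3 : cos γ = cos β := mul_left_cancel₀ hδ (by rw [h2] at h; linarith)
    obtain ⟨m, hm⟩ := Real.cos_eq_cos_iff.1 h2
    obtain ⟨n, hn⟩ := Real.cos_eq_cos_iff.1 h3
    rcases hm with hm | hm <;> rcases hn with hn | hn
    · exact ⟨1, -1, -1, by simp, by simp, by simp, -m + n, by push_cast; linarith⟩
    · exact ⟨1, 1, -1, by simp, by simp, by simp, -m + n, by push_cast; linarith⟩
    · exact ⟨1, -1, 1, by simp, by simp, by simp, m + n, by push_cast; linarith⟩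
    · exact ⟨1, 1, 1, by simp, by simp, by simp, m + n, by push_cast; linarith⟩
  · have h3 : cos γ = cos (π - β) := by
      rw [cos_pi_sub]
      exact mul_left_cancel₀ hδ (by rw [h2] at h; linarith)
    rw [← cos_pi_sub] at h2
    obtain ⟨m, hm⟩ := Real.cos_eq_cos_iff.1 h2
    obtain ⟨n, hn⟩ := Real.cos_eq_cos_iff.1 h3
    rcases hm with hm | hm <;> rcases hn with hn | hn
    · exact ⟨-1, -1, 1, by simp, by simp, by simp, -m + n, by push_cast; linarith⟩
    · exact ⟨-1, 1, 1, by simp, by simp, by simp, -m + n, by push_cast; linarith⟩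
    · exact ⟨-1, -1, -1, by simp, by simp, by simp, m + n - 1, by push_cast; linarith⟩
    · exact ⟨-1, 1, -1, by simp, by simp, by simp, m + n - 1, by push_cast; linarith⟩

theorem sin_div_sin_eq {α δ ρ : ℝ} (hα : cos α ≠ 0) (hδ : cos δ ≠ 0) (hT : tan δ ≠ 0)
    (h : tan α = ρ * tan δ) : sin (δ + α) / sin (δ - α) = (1 + ρ) / (1 - ρ) := by
  have e1 : sin (δ + α) = cos δ * cos α * tan δ * (1 + ρ) := by
    rw [mul_assoc, mul_one_add, mul_comm (tan δ), ← h, sin_add, ← tan_mul_cos hδ, ← tan_mul_cos hα]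
    ring
  have e2 : sin (δ - α) = cos δ * cos α * tan δ * (1 - ρ) := by
    rw [mul_assoc, mul_one_sub, mul_comm (tan δ), ← h, sin_sub, ← tan_mul_cos hδ, ← tan_mul_cos hα]
    ring
  rw [e1, e2, mul_div_mul_left _ _ (by positivity)]

/-- This is `cos² α = 1 / (1 + tan² α)` with denominators cleared, so that it can be used before the
factor on the left is known to be nonzero. -/
theorem cos_sq_of_tan_eq {α δ ρ r : ℝ} (hα : cos α ≠ 0) (hδ : cos δ ≠ 0) 
    (h : tan α = ρ * tan δ) (hr : -1 < r) (hρ : ρ ^ 2 = (1 - r) / (1 + r)) :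
    cos α ^ 2 * (1 - r + 2 * r * cos δ ^ 2) = (1 + r) * cos δ ^ 2 := by
  have h1 : (1 + r) ≠ 0 := by linarith
  have e1 : (tan α ^ 2) * (1 + r) = (1 - r) * tan δ ^ 2 := by
    rw [h, mul_pow, hρ]; field_simp
  rw [tan_eq_sin_div_cos, tan_eq_sin_div_cos, div_pow, div_pow, sin_sq, sin_sq] at e1
  field_simp at e1
  linarith

/-- Half-angle data for the involution factor `(1 + ρ) / (1 - ρ)`. -/
theorem involution_factor {ρ r : ℝ} (hr : -1 < r ∧ r < 1) (h0 : r ≠ 0)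
    (hρ : ρ ^ 2 = (1 - r) / (1 + r)) :
    1 - ρ ≠ 0 ∧ 1 + ρ ≠ 0 ∧ (0 < (1 + ρ) / (1 - ρ) ↔ 0 < r) ∧
      ((1 + ρ) / (1 - ρ) - 1) ^ 2 / ((1 + ρ) / (1 - ρ)) = 2 * (1 - r) / r := by
  have h1 : 0 < 1 + r := by linarith
  -- The factor has the sign of `1 - ρ²`, which is the sign of `r`.
  have e : (1 + ρ) * (1 - ρ) = 2 * r / (1 + r) := by
    have : (1 + ρ) * (1 - ρ) = 1 - ρ ^ 2 := by ring
    rw [this, hρ]; field_simp; ring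
  have hne : (1 + ρ) * (1 - ρ) ≠ 0 := by rw [e]; positivity
  have hp := left_ne_zero_of_mul hne
  have hm := right_ne_zero_of_mul hne
  refine ⟨hm, hp, ?_, ?_⟩
  · have : (1 + ρ) / (1 - ρ) = ((1 + ρ) * (1 - ρ)) / (1 - ρ) ^ 2 := by field_simp
    rw [this, e, div_pos_iff_of_pos_right (by positivity), div_pos_iff_of_pos_right h1]
    constructor <;> intro <;> linarith
  · have : ((1 + ρ) / (1 - ρ) - 1) ^ 2 / ((1 + ρ) / (1 - ρ)) = 4 * ρ ^ 2 / ((1 + ρ) * (1 - ρ)) := by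
      field_simp; ring
    rw [this, e, hρ]; field_simp; ring

/-- The facts about the planar angles from which the flexion is derived; they are invariant under
re-enumeration. -/
structure PlanarAngles.Admissible (Θ : PlanarAngles) : Prop where
  α_mem : ∀ i, 0 < Θ.α i ∧ Θ.α i < π
  γ_mem : ∀ i, 0 < Θ.γ i ∧ Θ.γ i < π
  β_mem : ∀ i, 0 ≤ Θ.β i ∧ Θ.β i ≤ π
  cos_δ : ∀ i, cos (Θ.δ i) ≠ 0
  sin_δ : ∀ i, sin (Θ.δ i) ≠ 0
  sin_sub_α : ∀ i, sin (Θ.δ i - Θ.α i) ≠ 0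
  sin_sub_γ : ∀ i, sin (Θ.δ i - Θ.γ i) ≠ 0
  orthodiagonal : ∀ i, cos (Θ.α i) * cos (Θ.γ i) = cos (Θ.β i) * cos (Θ.δ i)
  lam_zero_one : Θ.lam 0 = -Θ.lam 1
  mu_zero_three : Θ.mu 0 = -Θ.mu 3
  mu_one_two : Θ.mu 1 = -Θ.mu 2
  lam_two_three : Θ.lam 2 = -Θ.lam 3
  nu_zero_two : Θ.nu 0 ^ 2 / (Θ.lam 0 * Θ.mu 0) = Θ.nu 2 ^ 2 / (Θ.lam 2 * Θ.mu 2)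
  nu_one_three : Θ.nu 1 ^ 2 / (Θ.lam 1 * Θ.mu 1) = Θ.nu 3 ^ 2 / (Θ.lam 3 * Θ.mu 3)
  nu_sum : Θ.nu 0 ^ 2 / (Θ.lam 0 * Θ.mu 0) + Θ.nu 1 ^ 2 / (Θ.lam 1 * Θ.mu 1) = 16

namespace ChecksPass
variable {τ : ℝ} {σα σγ : Fin 4 → ℝ} {Θ : PlanarAngles}

/-- Positivity and the sum confine the angle to `(0, 2π)`, where the cosine vanishes only at the two
excluded values. -/
theorem cos_δ_ne (h : ChecksPass τ σα σγ Θ) (i : Fin 4) : cos (Θ.δ i) ≠ 0 := by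
  have h0 := h.δ_pos 0
  have h1 := h.δ_pos 1
  have h2 := h.δ_pos 2
  have h3 := h.δ_pos 3
  have hs := h.δ_sum
  have hlt : Θ.δ i < 2 * π := by fin_cases i <;> simp <;> linarith
  rw [Real.cos_ne_zero_iff]
  intro k hk
  have hp := h.δ_pos i
  have hpi := pi_pos
  have l1 : (-1 : ℝ) < k := by
    by_contra! hc
    nlinarith
  have l2 : (k : ℝ) < 2 := by
    by_contra! hc
    nlinarith
  have l1' : -1 < k := by exact_mod_cast l1
  have l2' : k < 2 := by exact_mod_cast l2
  have hr := h.δ_not_right i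
  interval_cases k
  · exact hr.1 (by rw [hk]; simp)
  · exact hr.2 (by rw [hk]; push_cast; ring)

theorem cos_α_ne (h : ChecksPass τ σα σγ Θ) (i : Fin 4) : cos (Θ.α i) ≠ 0 := fun e => by
  obtain ⟨h0, h1, h2⟩ := h.α_mem i
  exact h2 (injOn_cos ⟨h0.le, h1.le⟩ ⟨by positivity, by linarith [pi_pos]⟩ (by simpa using e))

theorem cos_γ_ne (h : ChecksPass τ σα σγ Θ) (i : Fin 4) : cos (Θ.γ i) ≠ 0 := fun e => by
  obtain ⟨h0, h1, h2⟩ := h.γ_mem i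
  exact h2 (injOn_cos ⟨h0.le, h1.le⟩ ⟨by positivity, by linarith [pi_pos]⟩ (by simpa using e))

/-- Otherwise the formula for `tan α` would give `0`, impossible for `α` in `(0, π)`. -/
theorem tan_δ_ne (h : ChecksPass τ σα σγ Θ) (i : Fin 4) : tan (Θ.δ i) ≠ 0 := fun e => by
  have h1 := h.tan_α i
  rw [e, mul_zero, tan_eq_sin_div_cos, div_eq_zero_iff] at h1
  exact h1.elim (sin_pos_of_pos_of_lt_pi (h.α_mem i).1 (h.α_mem i).2.1).ne' (h.cos_α_ne i)

theorem orthodiagonal (h : ChecksPass τ σα σγ Θ) (i : Fin 4) :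
    cos (Θ.α i) * cos (Θ.γ i) = cos (Θ.β i) * cos (Θ.δ i) := by
  have hb := h.β_check i
  rw [h.β_eq, cos_arccos hb.1.le hb.2.le, div_mul_cancel₀ _ (h.cos_δ_ne i)]

theorem sq_σα_mul_sqrt (h : ChecksPass τ σα σγ Θ) (i : Fin 4) :
    (σα i * √((1 - r Θ.δ τ i) / (1 + r Θ.δ τ i))) ^ 2 =
      (1 - r Θ.δ τ i) / (1 + r Θ.δ τ i) := by
  have hr := h.r_mem i
  have : 0 ≤ (1 - r Θ.δ τ i) / (1 + r Θ.δ τ i) := div_nonneg (by linarith) (by linarith)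
  rw [mul_pow, sq_sqrt this, sq_eq_one_iff.2 (h.σα_sign i), one_mul]

theorem sq_σγ_mul_sqrt (h : ChecksPass τ σα σγ Θ) (i : Fin 4) :
    (σγ i * √((1 - c Θ.δ τ i) / (1 + c Θ.δ τ i))) ^ 2 =
      (1 - c Θ.δ τ i) / (1 + c Θ.δ τ i) := by
  have hr := h.c_mem i
  have : 0 ≤ (1 - c Θ.δ τ i) / (1 + c Θ.δ τ i) := div_nonneg (by linarith) (by linarith)
  rw [mul_pow, sq_sqrt this, sq_eq_one_iff.2 (h.σγ_sign i), one_mul]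

theorem cos_sq_α (h : ChecksPass τ σα σγ Θ) (i : Fin 4) :
    cos (Θ.α i) ^ 2 * (1 - r Θ.δ τ i + 2 * r Θ.δ τ i * cos (Θ.δ i) ^ 2) =
      (1 + r Θ.δ τ i) * cos (Θ.δ i) ^ 2 :=
  cos_sq_of_tan_eq (h.cos_α_ne i) (h.cos_δ_ne i) (h.tan_α i) (h.r_mem i).1 (h.sq_σα_mul_sqrt i)

theorem cos_sq_γ (h : ChecksPass τ σα σγ Θ) (i : Fin 4) :
    cos (Θ.γ i) ^ 2 * (1 - c Θ.δ τ i + 2 * c Θ.δ τ i * cos (Θ.δ i) ^ 2) =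
      (1 + c Θ.δ τ i) * cos (Θ.δ i) ^ 2 :=
  cos_sq_of_tan_eq (h.cos_γ_ne i) (h.cos_δ_ne i) (h.tan_γ i) (h.c_mem i).1 (h.sq_σγ_mul_sqrt i)

/-- For `r = 0` one gets `cos² α = cos² δ`, and orthodiagonality then contradicts ellipticity. -/
theorem r_ne_zero (h : ChecksPass τ σα σγ Θ) (i : Fin 4) : r Θ.δ τ i ≠ 0 := fun e => by
  have h1 := h.cos_sq_α i
  rw [e] at h1
  obtain ⟨e₁, e₂, e₃, h₁, h₂, h₃, n, hn⟩ :=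
    exists_signs_of_cos_sq_eq (h.orthodiagonal i) (h.cos_δ_ne i) (by linarith)
  exact h.elliptic i e₁ e₂ e₃ h₁ h₂ h₃ n hn

theorem c_ne_zero (h : ChecksPass τ σα σγ Θ) (i : Fin 4) : c Θ.δ τ i ≠ 0 := fun e => by
  have h1 := h.cos_sq_γ i
  rw [e] at h1
  obtain ⟨e₁, e₂, e₃, h₁, h₂, h₃, n, hn⟩ :=
    exists_signs_of_cos_sq_eq ((mul_comm _ _).trans (h.orthodiagonal i)) (h.cos_δ_ne i) (by linarith)
  -- With `α` and `γ` exchanged, `e₂` is the coefficient of `α`. Ellipticity is stated with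
  -- coefficient `+1`, so for `e₂ = -1` the whole relation is negated.
  rcases h₂ with rfl | rfl
  · exact h.elliptic i e₁ 1 e₃ h₁ (by simp) h₃ n (by linarith)
  · exact h.elliptic i (-e₁) (-1) (-e₃) (by rcases h₁ with rfl | rfl <;> simp) (by simp)
      (by rcases h₃ with rfl | rfl <;> simp) (-n) (by push_cast; linarith)

theorem lam_eq (h : ChecksPass τ σα σγ Θ) (i : Fin 4) :
    Θ.lam i = (1 + σα i * √((1 - r Θ.δ τ i) / (1 + r Θ.δ τ i))) /
      (1 - σα i * √((1 - r Θ.δ τ i) / (1 + r Θ.δ τ i))) := by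
  rw [PlanarAngles.lam, if_neg (fun e => (h.δ_not_right i).1 e.2)]
  exact sin_div_sin_eq (h.cos_α_ne i) (h.cos_δ_ne i) (h.tan_δ_ne i) (h.tan_α i)

theorem mu_eq (h : ChecksPass τ σα σγ Θ) (i : Fin 4) :
    Θ.mu i = (1 + σγ i * √((1 - c Θ.δ τ i) / (1 + c Θ.δ τ i))) /
      (1 - σγ i * √((1 - c Θ.δ τ i) / (1 + c Θ.δ τ i))) := by
  rw [PlanarAngles.mu, if_neg (fun e => (h.δ_not_right i).1 e.2)]
  exact sin_div_sin_eq (h.cos_γ_ne i) (h.cos_δ_ne i) (h.tan_δ_ne i) (h.tan_γ i)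

theorem lam_pos_iff (h : ChecksPass τ σα σγ Θ) (i : Fin 4) : 0 < Θ.lam i ↔ 0 < r Θ.δ τ i := by
  rw [h.lam_eq]
  exact (involution_factor (h.r_mem i) (h.r_ne_zero i) (h.sq_σα_mul_sqrt i)).2.2.1

theorem mu_pos_iff (h : ChecksPass τ σα σγ Θ) (i : Fin 4) : 0 < Θ.mu i ↔ 0 < c Θ.δ τ i := by
  rw [h.mu_eq]
  exact (involution_factor (h.c_mem i) (h.c_ne_zero i) (h.sq_σγ_mul_sqrt i)).2.2.1

theorem lam_ne_zero (h : ChecksPass τ σα σγ Θ) (i : Fin 4) : Θ.lam i ≠ 0 := by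
  obtain ⟨h1, h2, -⟩ := involution_factor (h.r_mem i) (h.r_ne_zero i) (h.sq_σα_mul_sqrt i)
  rw [h.lam_eq]
  exact div_ne_zero h2 h1

theorem mu_ne_zero (h : ChecksPass τ σα σγ Θ) (i : Fin 4) : Θ.mu i ≠ 0 := by
  obtain ⟨h1, h2, -⟩ := involution_factor (h.c_mem i) (h.c_ne_zero i) (h.sq_σγ_mul_sqrt i)
  rw [h.mu_eq]
  exact div_ne_zero h2 h1

/-- The quotient splits as `(λ - 1)²/λ · (μ - 1)²/μ / cos² δ`, and each factor is given by
`involution_factor`. -/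
theorem nu_sq_div (h : ChecksPass τ σα σγ Θ) (i : Fin 4) :
    Θ.nu i ^ 2 / (Θ.lam i * Θ.mu i) =
      4 * ((1 - r Θ.δ τ i) * (1 - c Θ.δ τ i)) /
        (r Θ.δ τ i * c Θ.δ τ i * cos (Θ.δ i) ^ 2) := by
  have h1 := (involution_factor (h.r_mem i) (h.r_ne_zero i) (h.sq_σα_mul_sqrt i)).2.2.2
  have h2 := (involution_factor (h.c_mem i) (h.c_ne_zero i) (h.sq_σγ_mul_sqrt i)).2.2.2
  rw [← h.lam_eq] at h1
  rw [← h.mu_eq] at h2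
  rw [PlanarAngles.nu, if_pos (h.δ_not_right i).1, div_pow, mul_pow, div_div, mul_comm (cos _ ^ 2),
    ← div_div, mul_div_mul_comm, h1, h2]
  field_simp
  ring

theorem nu_sq_div_eq (h : ChecksPass τ σα σγ Θ) (i : Fin 4) :
    Θ.nu i ^ 2 / (Θ.lam i * Θ.mu i) =
      8 * ![cos τ + sin τ, cos τ - sin τ, cos τ + sin τ, cos τ - sin τ] i / cos τ ∧ cos τ ≠ 0 := by
  have hr := h.r_ne_zero i
  have hc := h.c_ne_zero i
  have hd := h.cos_δ_ne i
  have h0 := h.relation i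
  -- If `cos τ = 0`, the relation between `r` and `c` forces `sin τ = 0` as well, because `r`, `c`
  -- and `cos δ` do not vanish.
  have hτ : cos τ ≠ 0 := fun e => by
    have h1 : sin τ = 0 := by
      rw [e] at h0
      fin_cases i <;> simp_all
    simpa [e, h1] using sin_sq_add_cos_sq τ
  refine ⟨?_, hτ⟩
  rw [h.nu_sq_div, div_eq_div_iff (by positivity) hτ]
  linear_combination 4 * h0

/-- The inequality `|cos β| < 1` reads `cos² α cos² γ < cos² δ`. With `k = cos² δ` and the formulas
for `cos² α`, `cos² γ`, it becomes `k (1 - k) ((1 - r)(1 - c) - 4 r c k) > 0`, and the last factor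
is the claim. -/
theorem lt_nu_sq_div (h : ChecksPass τ σα σγ Θ) (i : Fin 4) (hi : 0 < Θ.lam i * Θ.mu i) :
    16 < Θ.nu i ^ 2 / (Θ.lam i * Θ.mu i) := by
  have hrc : 0 < r Θ.δ τ i * c Θ.δ τ i := by
    rcases lt_or_gt_of_ne (h.r_ne_zero i) with hr | hr <;>
      rcases lt_or_gt_of_ne (h.c_ne_zero i) with hc | hc
    · exact mul_pos_of_neg_of_neg hr hc
    · have h1 := (h.mu_pos_iff i).2 hc
      exact absurd ((h.lam_pos_iff i).1 (pos_of_mul_pos_left hi h1.le)) hr.not_gt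
    · have h1 := (h.lam_pos_iff i).2 hr
      exact absurd ((h.mu_pos_iff i).1 (pos_of_mul_pos_right hi h1.le)) hc.not_gt
    · exact mul_pos hr hc
  have hk : 0 < cos (Θ.δ i) ^ 2 := pow_two_pos_of_ne_zero (h.cos_δ_ne i)
  have hk1 : cos (Θ.δ i) ^ 2 < 1 := by
    have : 0 < sin (Θ.δ i) ^ 2 := by
      have : sin (Θ.δ i) ≠ 0 := fun e => h.tan_δ_ne i (by rw [tan_eq_sin_div_cos, e, zero_div])
      positivity
    linarith [sin_sq_add_cos_sq (Θ.δ i)]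
  rw [h.nu_sq_div, lt_div_iff₀ (by positivity)]
  have hb := h.β_check i
  have hb2 : (cos (Θ.α i) * cos (Θ.γ i)) ^ 2 < cos (Θ.δ i) ^ 2 := by
    have : (cos (Θ.α i) * cos (Θ.γ i) / cos (Θ.δ i)) ^ 2 < 1 := by
      rw [sq_lt_one_iff_abs_lt_one, abs_lt]; exact hb
    rwa [div_pow, div_lt_one hk] at this
  have ha := h.cos_sq_α i
  have hc := h.cos_sq_γ i
  have hr1 := h.r_mem i
  have hc1 := h.c_mem i
  generalize cos (Θ.δ i) ^ 2 = k at *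
  generalize r Θ.δ τ i = r at *
  generalize c Θ.δ τ i = c at *
  have hA : 0 < 1 - r + 2 * r * k := by nlinarith
  have hC : 0 < 1 - c + 2 * c * k := by nlinarith
  rw [mul_pow] at hb2
  have h1 : (1 + r) * k * ((1 + c) * k) < k * ((1 - r + 2 * r * k) * (1 - c + 2 * c * k)) := by
    rw [← ha, ← hc]
    calc _ = cos (Θ.α i) ^ 2 * cos (Θ.γ i) ^ 2 * ((1 - r + 2 * r * k) * (1 - c + 2 * c * k)) := by ring
      _ < _ := by gcongr
  have h2 : 0 < (k * (1 - k)) * ((1 - r) * (1 - c) - 4 * (r * c * k)) := by linarith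
  have h3 := pos_of_mul_pos_right h2 (by nlinarith)
  linarith

/-- Replacing `r` by `-r` inverts the radicand, so the ratios of tangents at the two ends of an edge
are reciprocal. By `factor_neg`, reciprocal ratios have opposite involution factors. -/
theorem σα_sqrt_mul_eq_one {a b r s : ℝ} (hab : a * b = 1) (hr : -1 < r ∧ r < 1) (hs : s = -r) :
    (a * √((1 - r) / (1 + r))) * (b * √((1 - s) / (1 + s))) = 1 := by
  have h1 : 0 < 1 + r := by linarith
  have h2 : 0 < 1 - r := by linarith
  rw [mul_mul_mul_comm, hab, ← sqrt_mul (by positivity), hs, one_mul, sub_neg_eq_add,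
    ← sub_eq_add_neg, div_mul_div_cancel₀ h1.ne', div_self h2.ne', sqrt_one]

theorem factor_neg {ρ σ : ℝ} (h : ρ * σ = 1) (h1 : 1 - ρ ≠ 0) (h2 : 1 - σ ≠ 0) :
    (1 + ρ) / (1 - ρ) = -((1 + σ) / (1 - σ)) := by
  rw [← neg_div, div_eq_div_iff h1 h2]
  linear_combination (-2) * h

theorem lam_eq_neg (h : ChecksPass τ σα σγ Θ) {i j : Fin 4} (hσ : σα i * σα j = 1)
    (hr : r Θ.δ τ j = -r Θ.δ τ i) : Θ.lam i = -Θ.lam j := by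
  rw [h.lam_eq, h.lam_eq]
  exact factor_neg (σα_sqrt_mul_eq_one hσ (h.r_mem i) hr)
    (involution_factor (h.r_mem i) (h.r_ne_zero i) (h.sq_σα_mul_sqrt i)).1
    (involution_factor (h.r_mem j) (h.r_ne_zero j) (h.sq_σα_mul_sqrt j)).1

theorem mu_eq_neg (h : ChecksPass τ σα σγ Θ) {i j : Fin 4} (hσ : σγ i * σγ j = 1)
    (hr : c Θ.δ τ j = -c Θ.δ τ i) : Θ.mu i = -Θ.mu j := by
  rw [h.mu_eq, h.mu_eq]
  exact factor_neg (σα_sqrt_mul_eq_one hσ (h.c_mem i) hr)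
    (involution_factor (h.c_mem i) (h.c_ne_zero i) (h.sq_σγ_mul_sqrt i)).1
    (involution_factor (h.c_mem j) (h.c_ne_zero j) (h.sq_σγ_mul_sqrt j)).1

theorem isOAI (h : ChecksPass τ σα σγ Θ) : Θ.IsOAI where
  orthodiagonal := h.orthodiagonal
  elliptic := h.elliptic
  lam_zero_one := h.lam_eq_neg h.σα_zero_one (by simp [r])
  mu_zero_three := h.mu_eq_neg h.σγ_zero_three (by simp [c])
  mu_one_two := h.mu_eq_neg h.σγ_one_two (by simp [c])
  lam_two_three := h.lam_eq_neg h.σα_two_three (by simp [r])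
  nu_zero_two := by rw [(h.nu_sq_div_eq 0).1, (h.nu_sq_div_eq 2).1]; simp
  nu_one_three := by rw [(h.nu_sq_div_eq 1).1, (h.nu_sq_div_eq 3).1]; simp
  nu_sum := by
    have hτ := (h.nu_sq_div_eq 0).2
    rw [(h.nu_sq_div_eq 0).1, (h.nu_sq_div_eq 1).1]
    simp
    field_simp
    ring

theorem admissible (h : ChecksPass τ σα σγ Θ) : Θ.Admissible where
  α_mem i := ⟨(h.α_mem i).1, (h.α_mem i).2.1⟩
  γ_mem i := ⟨(h.γ_mem i).1, (h.γ_mem i).2.1⟩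
  β_mem i := by rw [h.β_eq]; exact ⟨arccos_nonneg _, arccos_le_pi _⟩
  cos_δ := h.cos_δ_ne
  sin_δ i e := h.tan_δ_ne i (by rw [tan_eq_sin_div_cos, e, zero_div])
  -- A vanishing denominator would make `λ` equal to `0` by the convention for division by zero, but
  -- `λ` is nonzero by its expression in `r`.
  sin_sub_α i e := by
    apply h.lam_ne_zero i
    rw [PlanarAngles.lam, if_neg (fun e => (h.δ_not_right i).1 e.2), e, div_zero]
  sin_sub_γ i e := by
    apply h.mu_ne_zero i
    rw [PlanarAngles.mu, if_neg (fun e => (h.δ_not_right i).1 e.2), e, div_zero]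
  orthodiagonal := h.orthodiagonal
  lam_zero_one := h.isOAI.lam_zero_one
  mu_zero_three := h.isOAI.mu_zero_three
  mu_one_two := h.isOAI.mu_one_two
  lam_two_three := h.isOAI.lam_two_three
  nu_zero_two := h.isOAI.nu_zero_two
  nu_one_three := h.isOAI.nu_one_three
  nu_sum := h.isOAI.nu_sum

end ChecksPass

/-! ### Re-enumeration of the angles and the sign pattern -/

namespace PlanarAngles
variable {Θ : PlanarAngles}

theorem lam_rot (i : Fin 4) : Θ.rot.lam i = Θ.mu (i + 1) := rfl
theorem mu_rot (i : Fin 4) : Θ.rot.mu i = Θ.lam (i + 1) := rfl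
theorem nu_rot (i : Fin 4) (h : Θ.δ (i + 1) ≠ π / 2) : Θ.rot.nu i = Θ.nu (i + 1) := by
  simp only [nu, lam_rot, mu_rot]
  rw [if_pos (show Θ.rot.δ i ≠ π / 2 from h), if_pos h, mul_comm (Θ.mu _ - 1)]
  rfl

theorem Admissible.δ_ne (h : Θ.Admissible) (i : Fin 4) : Θ.δ i ≠ π / 2 := fun e =>
  h.cos_δ i (by rw [e, cos_pi_div_two])

theorem Admissible.rot (h : Θ.Admissible) : Θ.rot.Admissible where
  α_mem i := h.γ_mem (i + 1)
  γ_mem i := h.α_mem (i + 1)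
  β_mem i := h.β_mem (i + 1)
  cos_δ i := h.cos_δ (i + 1)
  sin_δ i := h.sin_δ (i + 1)
  sin_sub_α i := h.sin_sub_γ (i + 1)
  sin_sub_γ i := h.sin_sub_α (i + 1)
  orthodiagonal i := (mul_comm _ _).trans (h.orthodiagonal (i + 1))
  lam_zero_one := h.mu_one_two
  mu_zero_three := by
    have := h.lam_zero_one
    simp only [mu_rot, zero_add, Fin.reduceAdd]
    linarith
  mu_one_two := h.lam_two_three
  lam_two_three := by
    have := h.mu_zero_three
    simp only [lam_rot, Fin.reduceAdd]
    linarith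
  nu_zero_two := by
    simp only [lam_rot, mu_rot, nu_rot _ (h.δ_ne _), zero_add, Fin.reduceAdd]
    rw [mul_comm (Θ.mu _), mul_comm (Θ.mu _)]
    exact h.nu_one_three
  nu_one_three := by
    simp only [lam_rot, mu_rot, nu_rot _ (h.δ_ne _), Fin.reduceAdd]
    rw [mul_comm (Θ.mu _), mul_comm (Θ.mu _)]
    exact h.nu_zero_two.symm
  nu_sum := by
    simp only [lam_rot, mu_rot, nu_rot _ (h.δ_ne _), zero_add, Fin.reduceAdd]
    rw [mul_comm (Θ.mu _), mul_comm (Θ.mu _), ← h.nu_zero_two, add_comm]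
    exact h.nu_sum

theorem Admissible.rot_iterate (h : Θ.Admissible) (k : ℕ) :
    (PlanarAngles.rot^[k] Θ).Admissible := by
  induction k with
  | zero => exact h
  | succ k ih => rw [Function.iterate_succ_apply']; exact ih.rot

end PlanarAngles

/-- The quotient `ν²/(λμ)` exceeds `16` where `λμ > 0` and is at most `0` where `λμ < 0`. As
neighbouring quotients add up to `16`, the signs of `λμ` alternate around the base. With `λ₁ = -λ₂`,
`μ₂ = -μ₃` and so on, one vertex determines all signs, and only the four shifts of the pattern
remain. -/
theorem ChecksPass.exists_signPattern {τ : ℝ} {σα σγ : Fin 4 → ℝ} {Θ : PlanarAngles}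
    (h : ChecksPass τ σα σγ Θ) : ∃ k : ℕ, k < 4 ∧ (PlanarAngles.rot^[k] Θ).SignPattern := by
  have hsum := h.isOAI.nu_sum
  have h02 := h.isOAI.nu_zero_two
  have h13 := h.isOAI.nu_one_three
  have s0 := h.lt_nu_sq_div 0
  have s1 := h.lt_nu_sq_div 1
  have s2 := h.lt_nu_sq_div 2
  have s3 := h.lt_nu_sq_div 3
  have n0 : ∀ i, Θ.lam i * Θ.mu i < 0 → Θ.nu i ^ 2 / (Θ.lam i * Θ.mu i) ≤ 0 := fun i hi =>
    div_nonpos_of_nonneg_of_nonpos (sq_nonneg _) hi.le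
  have t0 := n0 0
  have t1 := n0 1
  have t2 := n0 2
  have t3 := n0 3
  have e1 := h.isOAI.lam_zero_one
  have e2 := h.isOAI.mu_zero_three
  have e3 := h.isOAI.mu_one_two
  have e4 := h.isOAI.lam_two_three
  generalize Θ.nu 0 ^ 2 / (Θ.lam 0 * Θ.mu 0) = q0 at *
  generalize Θ.nu 1 ^ 2 / (Θ.lam 1 * Θ.mu 1) = q1 at *
  generalize Θ.nu 2 ^ 2 / (Θ.lam 2 * Θ.mu 2) = q2 at *
  generalize Θ.nu 3 ^ 2 / (Θ.lam 3 * Θ.mu 3) = q3 at *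
  have g := fun i => lt_or_gt_of_ne (mul_ne_zero (h.lam_ne_zero i) (h.mu_ne_zero i))
  have hp : (0 < Θ.lam 0 * Θ.mu 0 ∧ Θ.lam 1 * Θ.mu 1 < 0 ∧ 0 < Θ.lam 2 * Θ.mu 2 ∧
      Θ.lam 3 * Θ.mu 3 < 0) ∨ (Θ.lam 0 * Θ.mu 0 < 0 ∧ 0 < Θ.lam 1 * Θ.mu 1 ∧
      Θ.lam 2 * Θ.mu 2 < 0 ∧ 0 < Θ.lam 3 * Θ.mu 3) := by
    rcases g 0 with g0 | g0
    · have := t0 g0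
      exact .inr ⟨g0, (g 1).resolve_left fun c => by linarith [t1 c],
        (g 2).resolve_right fun c => by linarith [s2 c],
        (g 3).resolve_left fun c => by linarith [t3 c]⟩
    · have := s0 g0
      exact .inl ⟨g0, (g 1).resolve_right fun c => by linarith [s1 c],
        (g 2).resolve_left fun c => by linarith [t2 c],
        (g 3).resolve_right fun c => by linarith [s3 c]⟩
  clear s0 s1 s2 s3 t0 t1 t2 t3 n0 g
  rcases hp with ⟨p0, p1, p2, p3⟩ | ⟨p0, p1, p2, p3⟩
  · rcases mul_pos_iff.1 p0 with h0 | h0 <;> rcases mul_neg_iff.1 p1 with h1 | h1 <;>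
    rcases mul_pos_iff.1 p2 with h2 | h2 <;> rcases mul_neg_iff.1 p3 with h3 | h3 <;>
    first
    | exact ⟨0, by norm_num, h0, h1, h2, h3⟩
    | exact ⟨2, by norm_num, h2, h3, h0, h1⟩
    | (exfalso; obtain ⟨_, _⟩ := h0; obtain ⟨_, _⟩ := h1; obtain ⟨_, _⟩ := h2
       obtain ⟨_, _⟩ := h3; linarith)
  · rcases mul_neg_iff.1 p0 with h0 | h0 <;> rcases mul_pos_iff.1 p1 with h1 | h1 <;>
    rcases mul_neg_iff.1 p2 with h2 | h2 <;> rcases mul_pos_iff.1 p3 with h3 | h3 <;>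
    first
    | exact ⟨1, by norm_num, h1.symm, h2.symm, h3.symm, h0.symm⟩
    | exact ⟨3, by norm_num, h3.symm, h0.symm, h1.symm, h2.symm⟩
    | (exfalso; obtain ⟨_, _⟩ := h0; obtain ⟨_, _⟩ := h1; obtain ⟨_, _⟩ := h2
       obtain ⟨_, _⟩ := h3; linarith)

/-! ### Folding a half-plane about an edge -/

/-- The point with coordinates `(a, h)` in the half-plane through the line `p + ℝ u` that has
exterior dihedral angle `φ` with the horizontal plane. -/
def fold (p u : ℂ) (φ : Real.Angle) (a h : ℝ) : E3 :=
  !₂[(p + u * ⟨a, -(h * φ.cos)⟩).re, (p + u * ⟨a, -(h * φ.cos)⟩).im, h * φ.sin]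

theorem fold_zero (p u : ℂ) (φ : Real.Angle) (a : ℝ) : fold p u φ a 0 = emb (p + u * a) := by
  ext j; fin_cases j <;> simp [fold, emb]

theorem normSq_eq_one {u : ℂ} (hu : ‖u‖ = 1) : u.re ^ 2 + u.im ^ 2 = 1 := by
  have := Complex.sq_norm u
  rw [hu, Complex.normSq_apply] at this
  linarith

theorem dist_sq_E3 (X Y : E3) :
    dist X Y ^ 2 = (X 0 - Y 0) ^ 2 + (X 1 - Y 1) ^ 2 + (X 2 - Y 2) ^ 2 := by
  rw [EuclideanSpace.dist_eq, sq_sqrt (by positivity), Fin.sum_univ_three]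
  simp only [Real.dist_eq, sq_abs]

/-- `a, h, φ` are cylindrical coordinates about the edge, so this is Pythagoras along the axis plus
the law of cosines across it. -/
theorem dist_fold_sq {u : ℂ} (hu : ‖u‖ = 1) (p : ℂ) (φ ψ : Real.Angle) (a h b k : ℝ) :
    dist (fold p u φ a h) (fold p u ψ b k) ^ 2 =
      (a - b) ^ 2 + (h ^ 2 + k ^ 2 - 2 * h * k * (φ - ψ).cos) := by
  have hu := normSq_eq_one hu
  have h1 := φ.cos_sq_add_sin_sq
  have h2 := ψ.cos_sq_add_sin_sq
  rw [dist_sq_E3, sub_eq_add_neg φ, Real.Angle.cos_add, Real.Angle.cos_neg, Real.Angle.sin_neg]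
  simp [fold]
  linear_combination ((a - b) ^ 2 + (h * φ.cos - k * ψ.cos) ^ 2) * hu + h ^ 2 * h1 + k ^ 2 * h2

theorem dist_emb_fold_sq {u : ℂ} (hu : ‖u‖ = 1) (p : ℂ) (φ : Real.Angle) (a h b : ℝ) :
    dist (emb (p + u * b)) (fold p u φ a h) ^ 2 = (a - b) ^ 2 + h ^ 2 := by
  rw [← fold_zero p u φ, dist_fold_sq hu]
  ring

theorem exists_fold {u : ℂ} (hu : ‖u‖ = 1) (p : ℂ) (X : E3) :
    ∃ (φ : Real.Angle) (a h : ℝ), 0 ≤ h ∧ X = fold p u φ a h := by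
  set v : ℂ := (⟨X 0, X 1⟩ - p) * (starRingEnd ℂ) u with hv
  set w : ℂ := ⟨-v.im, X 2⟩ with hw
  have e : u * (starRingEnd ℂ) u = 1 := by
    rw [Complex.mul_conj, Complex.normSq_eq_norm_sq, hu]; simp
  have e1 : p + u * v = ⟨X 0, X 1⟩ := by
    rw [hv]; linear_combination (⟨X 0, X 1⟩ - p) * e
  refine ⟨(w.arg : Real.Angle), v.re, ‖w‖, norm_nonneg _, ?_⟩
  have e2 : (⟨v.re, -(‖w‖ * (w.arg : Real.Angle).cos)⟩ : ℂ) = v := by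
    rw [Real.Angle.cos_coe, Complex.norm_mul_cos_arg]; simp [hw]
  rw [fold, e2, e1, Real.Angle.sin_coe, Complex.norm_mul_sin_arg]
  ext j; fin_cases j <;> simp [hw]

/-- Distances to two points of the axis determine the axial coordinate and the distance from the
axis; only the angle stays free. -/
theorem eq_fold_of_dist {u : ℂ} (hu : ‖u‖ = 1) {p : ℂ} {X : E3} {l a h : ℝ} {φ : Real.Angle}
    (hl : l ≠ 0) (hh : 0 ≤ h) (h0 : dist (emb p) X = dist (emb p) (fold p u φ a h))
    (h1 : dist (emb (p + u * l)) X = dist (emb (p + u * l)) (fold p u φ a h)) :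
    ∃ ψ, X = fold p u ψ a h := by
  obtain ⟨ψ, b, k, hk, rfl⟩ := exists_fold hu p X
  have e0 := congrArg (· ^ 2) h0
  have e1 := congrArg (· ^ 2) h1
  have e2 := dist_emb_fold_sq hu p ψ b k 0
  have e3 := dist_emb_fold_sq hu p φ a h 0
  simp only [Complex.ofReal_zero, mul_zero, add_zero, sub_zero] at e2 e3
  simp only [dist_emb_fold_sq hu] at e1
  simp only [e2, e3] at e0
  have hab : b = a := mul_left_cancel₀ hl (by linarith)
  subst hab
  have : k = h := by
    rw [← sq_eq_sq₀ hk hh]; linarith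
  exact ⟨ψ, by rw [this]⟩

theorem angle_eq_of_cos_eq_one {φ ψ : Real.Angle} (h : (φ - ψ).cos = 1) : φ = ψ := by
  rw [← Real.Angle.cos_zero, Real.Angle.cos_eq_iff_eq_or_eq_neg] at h
  simpa [sub_eq_zero] using h

theorem angle_eq_of_dist {u : ℂ} (hu : ‖u‖ = 1) {p : ℂ} {a h b k : ℝ} {φ ψ χ : Real.Angle}
    (hh : 0 < h) (hk : 0 < k)
    (e : dist (fold p u φ a h) (fold p u ψ b k) = dist (fold p u χ a h) (fold p u χ b k)) :
    φ = ψ := by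
  apply angle_eq_of_cos_eq_one
  have e0 := congrArg (· ^ 2) e
  simp only [dist_fold_sq hu, sub_self, Real.Angle.cos_zero] at e0
  exact mul_left_cancel₀ (mul_pos hh hk).ne' (by linarith)

theorem fold_lineMap (p u : ℂ) (φ : Real.Angle) (a h b k t : ℝ) :
    AffineMap.lineMap (fold p u φ a h) (fold p u φ b k) t =
      fold p u φ (AffineMap.lineMap a b t) (AffineMap.lineMap h k t) := by
  ext j; fin_cases j <;> simp [fold, AffineMap.lineMap_apply] <;> ring

theorem fold_inj {u : ℂ} (hu : ‖u‖ = 1) {p : ℂ} {a h b k : ℝ} {φ : Real.Angle}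
    (e : fold p u φ a h = fold p u φ b k) : a = b ∧ h = k := by
  have e0 := dist_fold_sq hu p φ φ a h b k
  rw [e, dist_self, sub_self, Real.Angle.cos_zero] at e0
  constructor <;> nlinarith [sq_nonneg (a - b), sq_nonneg (h - k)]

/-- The condition on the right does not involve `φ`, hence disjointness of the lateral sides is
preserved by every folding. -/
theorem disjoint_segment_iff {u : ℂ} (hu : ‖u‖ = 1) {p : ℂ} {a h b k l : ℝ} {φ : Real.Angle} :
    Disjoint (segment ℝ (emb p) (fold p u φ a h)) (segment ℝ (emb (p + u * l)) (fold p u φ b k)) ↔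
      ∀ t ∈ Set.Icc (0 : ℝ) 1, ∀ s ∈ Set.Icc (0 : ℝ) 1,
        t * a = l + s * (b - l) → t * h ≠ s * k := by
  have e0 : emb p = fold p u φ 0 0 := by rw [fold_zero]; simp
  have e1 : ∀ t, (AffineMap.lineMap (0 : ℝ) a) t = t * a := by simp [AffineMap.lineMap_apply]
  have e2 : ∀ t, (AffineMap.lineMap (0 : ℝ) h) t = t * h := by simp [AffineMap.lineMap_apply]
  have e3 : ∀ s, (AffineMap.lineMap (0 : ℝ) k) s = s * k := by simp [AffineMap.lineMap_apply]
  have e4 : ∀ s, (AffineMap.lineMap l b) s = l + s * (b - l) := by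
    simp [AffineMap.lineMap_apply, add_comm]
  rw [e0, ← fold_zero p u φ, segment_eq_image_lineMap, segment_eq_image_lineMap,
    Set.disjoint_left]
  constructor
  · intro H t ht s hs h1 h2
    refine H ⟨t, ht, rfl⟩ ⟨s, hs, ?_⟩
    rw [fold_lineMap, fold_lineMap, e1, e2, e3, e4, h1, h2]
  · rintro H _ ⟨t, ht, rfl⟩ ⟨s, hs, e⟩
    rw [fold_lineMap, fold_lineMap, e1, e2, e3, e4] at e
    obtain ⟨h1, h2⟩ := fold_inj hu e
    exact H t ht s hs h1.symm h2.symm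

theorem mem_line_emb {p u : ℂ} {l : ℝ} (hl : l ≠ 0) {X : E3} :
    X ∈ line[ℝ, emb p, emb (p + u * l)] ↔ ∃ c : ℝ, X = emb (p + u * c) := by
  rw [show emb p = fold p u 0 0 0 by rw [fold_zero]; simp, ← fold_zero p u 0 l,
    mem_affineSpan_pair_iff_exists_lineMap_eq]
  simp only [fold_lineMap]
  constructor
  · rintro ⟨r, rfl⟩
    refine ⟨r * l, ?_⟩
    simp [AffineMap.lineMap_apply, fold_zero]
  · rintro ⟨c, rfl⟩
    refine ⟨c / l, ?_⟩
    simp [AffineMap.lineMap_apply, fold_zero, hl]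

theorem fold_sub_emb (p u : ℂ) (φ : Real.Angle) (a h c : ℝ) :
    fold p u φ a h -ᵥ emb (p + u * c) = fold 0 u φ (a - c) h := by
  ext j; fin_cases j <;> simp [fold, emb] <;> ring

theorem fold_mem_line_iff {u : ℂ} (hu : ‖u‖ = 1) {p : ℂ} {l a h : ℝ} (hl : l ≠ 0) {φ : Real.Angle} :
    fold p u φ a h ∈ line[ℝ, emb p, emb (p + u * l)] ↔ h = 0 := by
  rw [mem_line_emb hl]
  constructor
  · rintro ⟨c, hc⟩
    rw [← fold_zero p u φ] at hc
    exact (fold_inj hu hc).2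
  · rintro rfl
    exact ⟨a, fold_zero _ _ _ _⟩

theorem smul_fold_zero (u : ℂ) (φ : Real.Angle) (a h r : ℝ) :
    r • fold 0 u φ a h = fold 0 u φ (r * a) (r * h) := by
  ext j; fin_cases j <;> simp [fold] <;> ring

theorem angle_eq_of_fold_eq {u : ℂ} (hu : ‖u‖ = 1) {p : ℂ} {a h b k : ℝ} {φ ψ : Real.Angle}
    (hh : 0 < h) (hk : 0 < k) (e : fold p u φ a h = fold p u ψ b k) : φ = ψ := by
  apply angle_eq_of_cos_eq_one
  have e0 := dist_fold_sq hu p φ ψ a h b k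
  rw [e, dist_self] at e0
  have h1 : 0 ≤ h * k * (1 - (φ - ψ).cos) :=
    mul_nonneg (mul_pos hh hk).le (by nlinarith [(φ - ψ).cos_sq_add_sin_sq, sq_nonneg (φ - ψ).sin])
  have h2 : h * k * (1 - (φ - ψ).cos) = 0 := by nlinarith [sq_nonneg (a - b), sq_nonneg (h - k)]
  have := (mul_eq_zero.1 h2).resolve_left (mul_pos hh hk).ne'
  linarith

/-- Planarity of a side face thus amounts to a single dihedral angle shared by its two lateral
edges. -/
theorem sSameSide_fold_iff {u : ℂ} (hu : ‖u‖ = 1) {p : ℂ} {a h b k l : ℝ} (hl : l ≠ 0)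
    {φ ψ : Real.Angle} (hh : 0 ≤ h) (hk : 0 ≤ k) :
    line[ℝ, emb p, emb (p + u * l)].SSameSide (fold p u φ a h) (fold p u ψ b k) ↔
      0 < h ∧ 0 < k ∧ φ = ψ := by
  constructor
  · rintro ⟨⟨p₁, h₁, p₂, h₂, hr⟩, hX, hY⟩
    rw [fold_mem_line_iff hu hl] at hX hY
    have hh : 0 < h := lt_of_le_of_ne hh (Ne.symm hX)
    have hk : 0 < k := lt_of_le_of_ne hk (Ne.symm hY)
    refine ⟨hh, hk, ?_⟩
    obtain ⟨c, rfl⟩ := (mem_line_emb hl).1 h₁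
    obtain ⟨d, rfl⟩ := (mem_line_emb hl).1 h₂
    rw [fold_sub_emb, fold_sub_emb] at hr
    have ne : ∀ {χ : Real.Angle} {a h : ℝ}, 0 < h → fold 0 u χ a h ≠ 0 := by
      intro χ a h hh e
      have : (0 : E3) = fold 0 u χ 0 0 := by ext j; fin_cases j <;> simp [fold]
      exact hh.ne' (fold_inj hu (e.trans this)).2
    obtain ⟨r₁, r₂, hr₁, hr₂, e⟩ := hr.exists_pos (ne hh) (ne hk)
    rw [smul_fold_zero, smul_fold_zero] at e
    exact angle_eq_of_fold_eq hu (mul_pos hr₁ hh) (mul_pos hr₂ hk) e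
  · rintro ⟨hh, hk, rfl⟩
    refine ⟨⟨emb (p + u * a), (mem_line_emb hl).2 ⟨a, rfl⟩, emb (p + u * b),
      (mem_line_emb hl).2 ⟨b, rfl⟩, ?_⟩, ?_, ?_⟩
    · rw [fold_sub_emb, fold_sub_emb, sub_self, sub_self]
      have : ∀ r, fold 0 u φ 0 r = r • fold 0 u φ 0 1 := fun r => by
        rw [smul_fold_zero]; simp
      rw [this h, this k]
      exact (SameRay.sameRay_pos_smul_left _ hh).pos_smul_right hk
    · rw [fold_mem_line_iff hu hl]; exact hh.ne'
    · rw [fold_mem_line_iff hu hl]; exact hk.ne'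

theorem angle_eq_iff_dist_sq {X V Y : E3} {R S θ : ℝ} (hR : 0 < R) (hS : 0 < S)
    (hX : dist X V = R) (hY : dist Y V = S) (hθ : 0 ≤ θ) (hθ' : θ ≤ π) :
    ∠ X V Y = θ ↔ dist X Y ^ 2 = R ^ 2 + S ^ 2 - 2 * (R * S) * cos θ := by
  have h := EuclideanGeometry.law_cos X V Y
  rw [hX, hY] at h
  constructor
  · rintro rfl
    linarith
  · intro e
    apply injOn_cos ⟨EuclideanGeometry.angle_nonneg _ _ _, EuclideanGeometry.angle_le_pi _ _ _⟩
      ⟨hθ, hθ'⟩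
    exact mul_left_cancel₀ (mul_pos hR hS).ne' (by linarith)

theorem dist_emb {u : ℂ} (hu : ‖u‖ = 1) (p : ℂ) {l : ℝ} (hl : 0 < l) :
    dist (emb (p + u * l)) (emb p) = l := by
  have e := dist_emb_fold_sq hu p 0 0 0 l
  rw [fold_zero] at e
  simp only [Complex.ofReal_zero, mul_zero, add_zero, zero_sub] at e
  rw [← sq_eq_sq₀ dist_nonneg hl.le]
  linarith

/-- The point of the folded half-plane with polar coordinates `R, θ` about `p`. -/
def foldOut (p u : ℂ) (φ : Real.Angle) (R θ : ℝ) : E3 := fold p u φ (R * cos θ) (R * sin θ)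

/-- The point of the folded half-plane with polar coordinates `R, θ` about `p + l u`, the angle
being measured from the ray towards `p`. -/
def foldIn (p u : ℂ) (l : ℝ) (φ : Real.Angle) (R θ : ℝ) : E3 :=
  fold p u φ (l - R * cos θ) (R * sin θ)

theorem dist_foldOut {u : ℂ} (hu : ‖u‖ = 1) (p : ℂ) (φ : Real.Angle) {R : ℝ} (hR : 0 < R) (θ : ℝ) :
    dist (foldOut p u φ R θ) (emb p) = R := by
  have e := dist_emb_fold_sq hu p φ (R * cos θ) (R * sin θ) 0
  simp only [Complex.ofReal_zero, mul_zero, add_zero, sub_zero] at e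
  rw [← sq_eq_sq₀ dist_nonneg hR.le, dist_comm, foldOut, e]
  linear_combination R ^ 2 * sin_sq_add_cos_sq θ

theorem dist_foldIn {u : ℂ} (hu : ‖u‖ = 1) (p : ℂ) (l : ℝ) (φ : Real.Angle) {R : ℝ} (hR : 0 < R)
    (θ : ℝ) : dist (foldIn p u l φ R θ) (emb (p + u * l)) = R := by
  rw [← sq_eq_sq₀ dist_nonneg hR.le, dist_comm, foldIn, dist_emb_fold_sq hu]
  linear_combination R ^ 2 * sin_sq_add_cos_sq θ

theorem angle_foldOut {u : ℂ} (hu : ‖u‖ = 1) (p : ℂ) {l : ℝ} (hl : 0 < l) (φ : Real.Angle)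
    {R θ : ℝ} (hR : 0 < R) (hθ : 0 ≤ θ) (hθ' : θ ≤ π) :
    ∠ (emb (p + u * l)) (emb p) (foldOut p u φ R θ) = θ := by
  rw [angle_eq_iff_dist_sq hl hR (dist_emb hu p hl) (dist_foldOut hu p φ hR θ) hθ hθ', foldOut,
    dist_emb_fold_sq hu]
  linear_combination R ^ 2 * sin_sq_add_cos_sq θ

theorem angle_foldIn {u : ℂ} (hu : ‖u‖ = 1) (p : ℂ) {l : ℝ} (hl : 0 < l) (φ : Real.Angle)
    {R θ : ℝ} (hR : 0 < R) (hθ : 0 ≤ θ) (hθ' : θ ≤ π) :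
    ∠ (emb p) (emb (p + u * l)) (foldIn p u l φ R θ) = θ := by
  have e := dist_emb_fold_sq hu p φ (l - R * cos θ) (R * sin θ) 0
  simp only [Complex.ofReal_zero, mul_zero, add_zero, sub_zero] at e
  rw [angle_eq_iff_dist_sq hl hR ((dist_comm _ _).trans (dist_emb hu p hl))
    (dist_foldIn hu p l φ hR θ) hθ hθ', foldIn, e]
  linear_combination R ^ 2 * sin_sq_add_cos_sq θ

theorem exists_foldOut {u : ℂ} (hu : ‖u‖ = 1) (p : ℂ) {l : ℝ} (hl : 0 < l) {φ : Real.Angle}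
    {a h θ : ℝ} (hh : 0 < h) (hθ : 0 ≤ θ) (hθ' : θ ≤ π)
    (e : ∠ (emb (p + u * l)) (emb p) (fold p u φ a h) = θ) :
    ∃ R, 0 < R ∧ fold p u φ a h = foldOut p u φ R θ := by
  have hR : 0 < √(a ^ 2 + h ^ 2) := by positivity
  have hR2 : √(a ^ 2 + h ^ 2) ^ 2 = a ^ 2 + h ^ 2 := sq_sqrt (by positivity)
  generalize √(a ^ 2 + h ^ 2) = R at *
  have e0 := dist_emb_fold_sq hu p φ a h 0
  simp only [Complex.ofReal_zero, mul_zero, add_zero, sub_zero] at e0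
  rw [angle_eq_iff_dist_sq hl hR (dist_emb hu p hl) (by
    rw [← sq_eq_sq₀ dist_nonneg hR.le, dist_comm, e0, hR2]) hθ hθ', dist_emb_fold_sq hu] at e
  have ha : a = R * cos θ := mul_left_cancel₀ hl.ne' (by linarith)
  have hs : h = R * sin θ := by
    rw [← sq_eq_sq₀ hh.le (mul_nonneg hR.le (sin_nonneg_of_nonneg_of_le_pi hθ hθ'))]
    rw [ha] at hR2
    linear_combination -hR2 - R ^ 2 * sin_sq_add_cos_sq θ
  exact ⟨R, hR, by rw [foldOut, ha, hs]⟩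

theorem exists_foldIn {u : ℂ} (hu : ‖u‖ = 1) (p : ℂ) {l : ℝ} (hl : 0 < l) {φ : Real.Angle}
    {b k θ : ℝ} (hk : 0 < k) (hθ : 0 ≤ θ) (hθ' : θ ≤ π)
    (e : ∠ (emb p) (emb (p + u * l)) (fold p u φ b k) = θ) :
    ∃ R, 0 < R ∧ fold p u φ b k = foldIn p u l φ R θ := by
  have hR : 0 < √((b - l) ^ 2 + k ^ 2) := by positivity
  have hR2 : √((b - l) ^ 2 + k ^ 2) ^ 2 = (b - l) ^ 2 + k ^ 2 := sq_sqrt (by positivity)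
  generalize √((b - l) ^ 2 + k ^ 2) = R at *
  have e0 := dist_emb_fold_sq hu p φ b k 0
  simp only [Complex.ofReal_zero, mul_zero, add_zero, sub_zero] at e0
  rw [angle_eq_iff_dist_sq hl hR ((dist_comm _ _).trans (dist_emb hu p hl)) (by
    rw [← sq_eq_sq₀ dist_nonneg hR.le, dist_comm, dist_emb_fold_sq hu, hR2]) hθ hθ', e0] at e
  have ha : l - b = R * cos θ := mul_left_cancel₀ hl.ne' (by linarith)
  have hs : k = R * sin θ := by
    rw [← sq_eq_sq₀ hk.le (mul_nonneg hR.le (sin_nonneg_of_nonneg_of_le_pi hθ hθ'))]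
    rw [show b - l = -(l - b) by ring, ha] at hR2
    linear_combination -hR2 - R ^ 2 * sin_sq_add_cos_sq θ
  exact ⟨R, hR, by rw [foldIn, ← ha, hs]; ring_nf⟩

/-- The cosine of the angle opposite to the base angle `δ` of a spherical quadrilateral with
lateral sides `θ, θ'` and exterior dihedral angles `φ, ψ`. -/
def cornerCos (δ θ θ' : ℝ) (φ ψ : Real.Angle) : ℝ :=
  cos θ * (cos θ' * cos δ - sin θ' * sin δ * ψ.cos) -
    sin θ * φ.cos * (cos θ' * sin δ + sin θ' * cos δ * ψ.cos) + sin θ * sin θ' * φ.sin * ψ.sin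

theorem cornerCos_comm (δ θ θ' : ℝ) (φ ψ : Real.Angle) :
    cornerCos δ θ θ' φ ψ = cornerCos δ θ' θ ψ φ := by
  unfold cornerCos; ring

theorem dist_foldOut_foldIn_sq {u u' p p' : ℂ} {l δ : ℝ} (hu : ‖u‖ = 1) (hp : p = p' + u' * l)
    (hu' : u' = -(Complex.exp (δ * Complex.I) * u)) (φ ψ : Real.Angle) (R S θ θ' : ℝ) :
    dist (foldOut p u φ R θ) (foldIn p' u' l ψ S θ') ^ 2 =
      R ^ 2 + S ^ 2 - 2 * (R * S) * cornerCos δ θ θ' φ ψ := by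
  have hn := normSq_eq_one hu
  have h1 := φ.cos_sq_add_sin_sq
  have h2 := ψ.cos_sq_add_sin_sq
  have h3 := sin_sq_add_cos_sq θ
  have h4 := sin_sq_add_cos_sq θ'
  have h5 := sin_sq_add_cos_sq δ
  rw [dist_sq_E3, hp, hu', cornerCos]
  simp [foldOut, foldIn, fold, Complex.exp_ofReal_mul_I_re, Complex.exp_ofReal_mul_I_im]
  -- `A + B i` is the horizontal part of the difference divided by `u`, so `u` drops out through
  -- `|u| = 1`.
  set A := R * cos θ - (S * cos θ' * cos δ - S * sin θ' * ψ.cos * sin δ)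
  set B := -(R * sin θ * φ.cos) - (S * cos θ' * sin δ + S * sin θ' * ψ.cos * cos δ)
  have e : (u.re * A - u.im * B) ^ 2 + (u.re * B + u.im * A) ^ 2 = A ^ 2 + B ^ 2 := by
    linear_combination (A ^ 2 + B ^ 2) * hn
  have e2 : A ^ 2 + B ^ 2 + (R * sin θ * φ.sin - S * sin θ' * ψ.sin) ^ 2 =
      R ^ 2 + S ^ 2 - 2 * (R * S) * (cos θ * (cos θ' * cos δ - sin θ' * sin δ * ψ.cos) -
    sin θ * φ.cos * (cos θ' * sin δ + sin θ' * cos δ * ψ.cos) + sin θ * sin θ' * φ.sin * ψ.sin) := by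
    simp only [A, B]
    linear_combination R ^ 2 * h3 + S ^ 2 * h4 + R ^ 2 * sin θ ^ 2 * h1 + S ^ 2 * sin θ' ^ 2 * h2 +
      S ^ 2 * (cos θ' ^ 2 + sin θ' ^ 2 * ψ.cos ^ 2) * h5
  rw [← e2, ← e]
  ring

theorem angle_corner_iff {u u' p p' : ℂ} {l δ : ℝ} (hu : ‖u‖ = 1) (hp : p = p' + u' * l)
    (hu' : u' = -(Complex.exp (δ * Complex.I) * u)) (φ ψ : Real.Angle) {R S β : ℝ} (θ θ' : ℝ)
    (hR : 0 < R) (hS : 0 < S) (hβ : 0 ≤ β) (hβ' : β ≤ π) :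
    ∠ (foldOut p u φ R θ) (emb p) (foldIn p' u' l ψ S θ') = β ↔
      cornerCos δ θ θ' φ ψ = cos β := by
  have hu1 : ‖u'‖ = 1 := by rw [hu', norm_neg, norm_mul, Complex.norm_exp_ofReal_mul_I, hu, one_mul]
  rw [angle_eq_iff_dist_sq hR hS (dist_foldOut hu p φ hR θ)
    (by rw [hp]; exact dist_foldIn hu1 p' l ψ hS θ') hβ hβ', dist_foldOut_foldIn_sq hu hp hu']
  constructor
  · intro e
    exact mul_left_cancel₀ (mul_pos hR hS).ne' (by linarith)
  · intro e; rw [e]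

theorem extDihedral_fold (P : Fin 4 → ℂ) (i : Fin 4) (hP : P (i + 1) ≠ P i) (φ : Real.Angle)
    (a : ℝ) {h : ℝ} (hh : 0 < h) :
    extDihedral P i (fold (P i) ((P (i + 1) - P i) / ‖P (i + 1) - P i‖) φ a h) = φ := by
  have hn : P (i + 1) - P i ≠ 0 := sub_ne_zero.2 hP
  have hn' : ‖P (i + 1) - P i‖ ≠ 0 := norm_ne_zero_iff.2 hn
  unfold extDihedral
  generalize P (i + 1) - P i = w at *
  have e1 : ((⟨(fold (P i) (w / ‖w‖) φ a h) 0, (fold (P i) (w / ‖w‖) φ a h) 1⟩ : ℂ) - P i) / w =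
      (⟨a, -(h * φ.cos)⟩ : ℂ) / (‖w‖ : ℝ) := by
    have : (⟨(fold (P i) (w / ‖w‖) φ a h) 0, (fold (P i) (w / ‖w‖) φ a h) 1⟩ : ℂ) =
      P i + w / ‖w‖ * ⟨a, -(h * φ.cos)⟩ := by apply Complex.ext <;> simp [fold]
    rw [this]
    field_simp
    ring
  rw [e1, Complex.div_ofReal_im, neg_mul, div_mul_cancel₀ _ hn', neg_neg,
    show (fold (P i) (w / ‖w‖) φ a h) 2 = h * φ.sin from rfl,
    show (⟨h * φ.cos, h * φ.sin⟩ : ℂ) = h * (φ.cos + φ.sin * Complex.I) by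
      apply Complex.ext <;> simp]
  exact Complex.arg_mul_cos_add_sin_mul_I_coe_angle hh φ

/-! ### Surfaces over a base in terms of dihedral angles -/

/-- The lateral neighbour of `A i` in the side face on the edge `A i, A (i + 1)`. -/
def outPt (K : Surface) : Fin 4 → E3 := ![K.B 0, K.C 1, K.B 2, K.C 3]

/-- The lateral neighbour of `A i` in the side face on the edge `A (i - 1), A i`. -/
def inPt (K : Surface) : Fin 4 → E3 := ![K.C 0, K.B 1, K.C 2, K.B 3]

def outAng (Θ : PlanarAngles) : Fin 4 → ℝ := ![Θ.α 0, Θ.γ 1, Θ.α 2, Θ.γ 3]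
def inAng (Θ : PlanarAngles) : Fin 4 → ℝ := ![Θ.γ 0, Θ.α 1, Θ.γ 2, Θ.α 3]

/-- Indexing by edges in cyclic order removes the alternation of `B, α` with `C, γ`, so later
arguments treat all four side faces alike. -/
theorem isKokotsakis_iff {Θ : PlanarAngles} {P : Fin 4 → ℂ} {K : Surface} :
    IsKokotsakis Θ P K ↔ HasInteriorAngles P Θ.δ ∧ (∀ i, K.A i = emb (P i)) ∧
      (∀ i, ∠ (outPt K i) (K.A i) (inPt K i) = Θ.β i) ∧
      ∀ i, ∠ (K.A (i + 1)) (K.A i) (outPt K i) = outAng Θ i ∧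
        ∠ (K.A i) (K.A (i + 1)) (inPt K (i + 1)) = inAng Θ (i + 1) ∧
        line[ℝ, K.A i, K.A (i + 1)].SSameSide (outPt K i) (inPt K (i + 1)) ∧
        Disjoint (segment ℝ (K.A i) (outPt K i)) (segment ℝ (K.A (i + 1)) (inPt K (i + 1))) := by
  constructor
  · intro h
    refine ⟨h.interior, h.base, ?_, ?_⟩
    · intro i
      fin_cases i
      · exact h.angle_β 0
      · exact (EuclideanGeometry.angle_comm _ _ _).trans (h.angle_β 1)
      · exact h.angle_β 2
      · exact (EuclideanGeometry.angle_comm _ _ _).trans (h.angle_β 3)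
    · intro i
      fin_cases i
      · exact ⟨h.angle_α 0, h.angle_α 1, h.sameSide_B 0, h.disjoint_B 0⟩
      · exact ⟨h.angle_γ 1, h.angle_γ 2, h.sameSide_C 1, h.disjoint_C 1⟩
      · exact ⟨h.angle_α 2, h.angle_α 3, h.sameSide_B 2, h.disjoint_B 2⟩
      · exact ⟨h.angle_γ 3, h.angle_γ 0, h.sameSide_C 3, h.disjoint_C 3⟩
  · rintro ⟨h1, h2, h3, h4⟩
    obtain ⟨a0, b0, c0, d0⟩ := h4 0
    obtain ⟨a1, b1, c1, d1⟩ := h4 1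
    obtain ⟨a2, b2, c2, d2⟩ := h4 2
    obtain ⟨a3, b3, c3, d3⟩ := h4 3
    refine ⟨h1, h2, ?_, ?_, ?_, ?_, ?_, ?_, ?_⟩ <;> intro i <;> fin_cases i
    · exact a0
    · exact b0
    · exact a2
    · exact b2
    · exact b3
    · exact a1
    · exact b1
    · exact a3
    · exact h3 0
    · exact (EuclideanGeometry.angle_comm _ _ _).trans (h3 1)
    · exact h3 2
    · exact (EuclideanGeometry.angle_comm _ _ _).trans (h3 3)
    · exact c0
    · exact Set.pair_comm (K.A 0) (K.A 1) ▸ c0.symm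
    · exact c2
    · exact Set.pair_comm (K.A 2) (K.A 3) ▸ c2.symm
    · exact Set.pair_comm (K.A 3) (K.A 0) ▸ c3.symm
    · exact c1
    · exact Set.pair_comm (K.A 1) (K.A 2) ▸ c1.symm
    · exact c3
    · exact d0
    · exact d0.symm
    · exact d2
    · exact d2.symm
    · exact d3.symm
    · exact d1
    · exact d1.symm
    · exact d3

theorem faceIsometric_iff {K L : Surface} :
    FaceIsometric K L ↔ (∀ i j, dist (L.A i) (L.A j) = dist (K.A i) (K.A j)) ∧
      (∀ i, dist (outPt L i) (inPt L i) = dist (outPt K i) (inPt K i)) ∧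
      ∀ i, dist (L.A i) (outPt L i) = dist (K.A i) (outPt K i) ∧
        dist (L.A (i + 1)) (outPt L i) = dist (K.A (i + 1)) (outPt K i) ∧
        dist (L.A i) (inPt L (i + 1)) = dist (K.A i) (inPt K (i + 1)) ∧
        dist (L.A (i + 1)) (inPt L (i + 1)) = dist (K.A (i + 1)) (inPt K (i + 1)) ∧
        dist (outPt L i) (inPt L (i + 1)) = dist (outPt K i) (inPt K (i + 1)) := by
  constructor
  · rintro ⟨h0, h⟩
    obtain ⟨a0, b0, c0, d0, e0, f0, g0⟩ := h 0
    obtain ⟨a1, b1, c1, d1, e1, f1, g1⟩ := h 1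
    obtain ⟨a2, b2, c2, d2, e2, f2, g2⟩ := h 2
    obtain ⟨a3, b3, c3, d3, e3, f3, g3⟩ := h 3
    refine ⟨h0, ?_, ?_⟩ <;> intro i <;> fin_cases i
    · exact g0
    · exact (dist_comm _ _).trans (g1.trans (dist_comm _ _))
    · exact g2
    · exact (dist_comm _ _).trans (g3.trans (dist_comm _ _))
    · exact ⟨a0, b1, b0, a1, c0⟩
    · exact ⟨d1, e2, e1, d2, f1⟩
    · exact ⟨a2, b3, b2, a3, c2⟩
    · exact ⟨d3, e0, e3, d0, f3⟩
  · rintro ⟨h0, h1, h⟩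
    obtain ⟨a0, b1, b0, a1, c0⟩ := h 0
    obtain ⟨d1, e2, e1, d2, f1⟩ := h 1
    obtain ⟨a2, b3, b2, a3, c2⟩ := h 2
    obtain ⟨d3, e0, e3, d0, f3⟩ := h 3
    refine ⟨h0, ?_⟩
    intro i
    fin_cases i
    · exact ⟨a0, b0, c0, d0, e0, (dist_comm _ _).trans (f3.trans (dist_comm _ _)), h1 0⟩
    · exact ⟨a1, b1, (dist_comm _ _).trans (c0.trans (dist_comm _ _)), d1, e1, f1,
        (dist_comm _ _).trans ((h1 1).trans (dist_comm _ _))⟩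
    · exact ⟨a2, b2, c2, d2, e2, (dist_comm _ _).trans (f1.trans (dist_comm _ _)), h1 2⟩
    · exact ⟨a3, b3, (dist_comm _ _).trans (c2.trans (dist_comm _ _)), d3, e3, f3,
        (dist_comm _ _).trans ((h1 3).trans (dist_comm _ _))⟩

/-- The length of the edge `P i, P (i + 1)`. -/
def len (P : Fin 4 → ℂ) (i : Fin 4) : ℝ := ‖P (i + 1) - P i‖

/-- The unit vector along the edge `P i, P (i + 1)`. -/
def unitVec (P : Fin 4 → ℂ) (i : Fin 4) : ℂ := (P (i + 1) - P i) / ‖P (i + 1) - P i‖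

theorem HasInteriorAngles.len_pos {P : Fin 4 → ℂ} {δ : Fin 4 → ℝ} (h : HasInteriorAngles P δ)
    (i : Fin 4) : 0 < len P i := norm_pos_iff.2 (sub_ne_zero.2 (h i).1)

theorem HasInteriorAngles.norm_unitVec {P : Fin 4 → ℂ} {δ : Fin 4 → ℝ}
    (h : HasInteriorAngles P δ) (i : Fin 4) : ‖unitVec P i‖ = 1 := by
  have := (h.len_pos i).ne'
  rw [len] at this
  rw [unitVec, norm_div, Complex.norm_real, norm_norm, div_self this]

theorem HasInteriorAngles.add_unitVec {P : Fin 4 → ℂ} {δ : Fin 4 → ℝ}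
    (h : HasInteriorAngles P δ) (i : Fin 4) : P i + unitVec P i * len P i = P (i + 1) := by
  have : ((len P i : ℝ) : ℂ) ≠ 0 := Complex.ofReal_ne_zero.2 (h.len_pos i).ne'
  rw [len] at this
  rw [unitVec, len, div_mul_cancel₀ _ this]
  ring

/-- Taking norms identifies `ρ` as the ratio of the adjacent edge lengths; dividing by the lengths
leaves the pure rotation. -/
theorem HasInteriorAngles.unitVec_eq {P : Fin 4 → ℂ} {δ : Fin 4 → ℝ}
    (h : HasInteriorAngles P δ) (i : Fin 4) :
    unitVec P i = -(Complex.exp (δ (i + 1) * Complex.I) * unitVec P (i + 1)) := by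
  obtain ⟨-, ρ, hρ, e⟩ := h (i + 1)
  rw [add_sub_cancel_right] at e
  have e1 : len P i = ρ * len P (i + 1) := by
    have := congrArg norm e
    rwa [norm_mul, norm_mul, Complex.norm_exp_ofReal_mul_I, Complex.norm_real,
      Real.norm_of_nonneg hρ.le, mul_one, norm_sub_rev] at this
  have h0 : ((len P (i + 1) : ℝ) : ℂ) ≠ 0 := Complex.ofReal_ne_zero.2 (h.len_pos (i + 1)).ne'
  have h1 : (ρ : ℂ) ≠ 0 := Complex.ofReal_ne_zero.2 hρ.ne'
  have e2 : unitVec P i = (P (i + 1) - P i) / ((len P i : ℝ) : ℂ) := rfl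
  have e3 : unitVec P (i + 1) = (P (i + 1 + 1) - P (i + 1)) / ((len P (i + 1) : ℝ) : ℂ) := rfl
  rw [e2, e3, e1]
  push_cast
  field_simp
  linear_combination -e

/-- The surface over the base `P` with exterior dihedral angles `φ` and with lateral edges of
lengths `R i` (at `P i`) and `S i` (at `P (i + 1)`) in the side face on the edge `P i, P (i + 1)`. -/
def foldedSurface (Θ : PlanarAngles) (P : Fin 4 → ℂ) (R S : Fin 4 → ℝ) (φ : Fin 4 → Real.Angle) :
    Surface :=
  let o := fun i => foldOut (P i) (unitVec P i) (φ i) (R i) (outAng Θ i)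
  let n := fun i => foldIn (P i) (unitVec P i) (len P i) (φ i) (S i) (inAng Θ (i + 1))
  { A := fun i => emb (P i)
    B := ![o 0, n 0, o 2, n 2]
    C := ![n 3, o 1, n 1, o 3] }

theorem outPt_foldedSurface (Θ : PlanarAngles) (P : Fin 4 → ℂ) (R S : Fin 4 → ℝ)
    (φ : Fin 4 → Real.Angle) (i : Fin 4) : outPt (foldedSurface Θ P R S φ) i =
      foldOut (P i) (unitVec P i) (φ i) (R i) (outAng Θ i) := by
  fin_cases i <;> rfl

theorem inPt_foldedSurface (Θ : PlanarAngles) (P : Fin 4 → ℂ) (R S : Fin 4 → ℝ)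
    (φ : Fin 4 → Real.Angle) (i : Fin 4) : inPt (foldedSurface Θ P R S φ) (i + 1) =
      foldIn (P i) (unitVec P i) (len P i) (φ i) (S i) (inAng Θ (i + 1)) := by
  fin_cases i <;> rfl

/-- The closing condition at the vertex `i + 1`. -/
def Closes (Θ : PlanarAngles) (φ : Fin 4 → Real.Angle) : Prop :=
  ∀ i, cornerCos (Θ.δ (i + 1)) (outAng Θ (i + 1)) (inAng Θ (i + 1)) (φ (i + 1)) (φ i) =
    cos (Θ.β (i + 1))

/-- The lateral sides of the side faces do not meet. -/
def LateralDisjoint (Θ : PlanarAngles) (P : Fin 4 → ℂ) (R S : Fin 4 → ℝ) : Prop :=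
  ∀ i, ∀ t ∈ Set.Icc (0 : ℝ) 1, ∀ s ∈ Set.Icc (0 : ℝ) 1,
    t * (R i * cos (outAng Θ i)) =
      len P i + s * (len P i - S i * cos (inAng Θ (i + 1)) - len P i) →
    t * (R i * sin (outAng Θ i)) ≠ s * (S i * sin (inAng Θ (i + 1)))

theorem surface_ext {K L : Surface} (hA : ∀ i, K.A i = L.A i) (ho : ∀ i, outPt K i = outPt L i)
    (hi : ∀ i, inPt K i = inPt L i) : K = L := by
  obtain ⟨A, B, C⟩ := K
  obtain ⟨A', B', C'⟩ := L
  congr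
  · exact funext hA
  · funext i; fin_cases i
    exacts [ho 0, hi 1, ho 2, hi 3]
  · funext i; fin_cases i
    exacts [hi 0, ho 1, hi 2, ho 3]

namespace PlanarAngles.Admissible
variable {Θ : PlanarAngles}

theorem outAng_mem (h : Θ.Admissible) (i : Fin 4) : 0 < outAng Θ i ∧ outAng Θ i < π := by
  fin_cases i
  exacts [h.α_mem 0, h.γ_mem 1, h.α_mem 2, h.γ_mem 3]

theorem inAng_mem (h : Θ.Admissible) (i : Fin 4) : 0 < inAng Θ i ∧ inAng Θ i < π := by
  fin_cases i
  exacts [h.γ_mem 0, h.α_mem 1, h.γ_mem 2, h.α_mem 3]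

end PlanarAngles.Admissible

theorem forall_succ {p : Fin 4 → Prop} (h : ∀ i, p (i + 1)) (i : Fin 4) : p i := by
  have := h (i - 1)
  rwa [sub_add_cancel] at this

section
variable {Θ : PlanarAngles} {P : Fin 4 → ℂ} {R S : Fin 4 → ℝ} {φ : Fin 4 → Real.Angle}

/-- The dihedral angles enter only the corner triangles and the lateral lengths only the
disjointness, so the two kinds of conditions separate. -/
theorem isKokotsakis_foldedSurface_iff (hΘ : Θ.Admissible) (hP : HasInteriorAngles P Θ.δ)
    (hR : ∀ i, 0 < R i) (hS : ∀ i, 0 < S i) : IsKokotsakis Θ P (foldedSurface Θ P R S φ) ↔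
      Closes Θ φ ∧ LateralDisjoint Θ P R S := by
  have hβ : ∀ i, ∠ (outPt (foldedSurface Θ P R S φ) (i + 1)) (emb (P (i + 1)))
      (inPt (foldedSurface Θ P R S φ) (i + 1)) = Θ.β (i + 1) ↔
      cornerCos (Θ.δ (i + 1)) (outAng Θ (i + 1)) (inAng Θ (i + 1)) (φ (i + 1)) (φ i) =
    cos (Θ.β (i + 1)) := fun i => by
    rw [outPt_foldedSurface, inPt_foldedSurface]
    exact angle_corner_iff (hP.norm_unitVec _) (hP.add_unitVec i).symm (hP.unitVec_eq i) _ _ _ _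
      (hR _) (hS _) (hΘ.β_mem _).1 (hΘ.β_mem _).2
  have hd : ∀ i, Disjoint (segment ℝ (emb (P i)) (outPt (foldedSurface Θ P R S φ) i))
      (segment ℝ (emb (P (i + 1))) (inPt (foldedSurface Θ P R S φ) (i + 1))) ↔
      ∀ t ∈ Set.Icc (0 : ℝ) 1, ∀ s ∈ Set.Icc (0 : ℝ) 1,
    t * (R i * cos (outAng Θ i)) =
      len P i + s * (len P i - S i * cos (inAng Θ (i + 1)) - len P i) →
    t * (R i * sin (outAng Θ i)) ≠ s * (S i * sin (inAng Θ (i + 1))) := fun i => by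
    rw [outPt_foldedSurface, inPt_foldedSurface, ← hP.add_unitVec i]
    exact disjoint_segment_iff (hP.norm_unitVec i)
  rw [isKokotsakis_iff]
  constructor
  · rintro ⟨-, -, h1, h2⟩
    exact ⟨fun i => (hβ i).1 (h1 (i + 1)), fun i => (hd i).1 (h2 i).2.2.2⟩
  · rintro ⟨h1, h2⟩
    refine ⟨hP, fun i => rfl, forall_succ fun i => (hβ i).2 (h1 i), fun i => ⟨?_, ?_, ?_,
      (hd i).2 (h2 i)⟩⟩
    · change ∠ (emb (P (i + 1))) (emb (P i)) _ = _
      rw [outPt_foldedSurface, ← hP.add_unitVec i]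
      exact angle_foldOut (hP.norm_unitVec i) _ (hP.len_pos i) _ (hR i) (hΘ.outAng_mem i).1.le
        (hΘ.outAng_mem i).2.le
    · change ∠ (emb (P i)) (emb (P (i + 1))) _ = _
      rw [inPt_foldedSurface, ← hP.add_unitVec i]
      exact angle_foldIn (hP.norm_unitVec i) _ (hP.len_pos i) _ (hS i) (hΘ.inAng_mem _).1.le
        (hΘ.inAng_mem _).2.le
    · change line[ℝ, emb (P i), emb (P (i + 1))].SSameSide _ _
      have s1 := mul_pos (hR i) (sin_pos_of_pos_of_lt_pi (hΘ.outAng_mem i).1 (hΘ.outAng_mem i).2)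
      have s2 := mul_pos (hS i)
        (sin_pos_of_pos_of_lt_pi (hΘ.inAng_mem (i + 1)).1 (hΘ.inAng_mem (i + 1)).2)
      rw [outPt_foldedSurface, inPt_foldedSurface, ← hP.add_unitVec i]
      exact (sSameSide_fold_iff (hP.norm_unitVec i) (hP.len_pos i).ne' s1.le s2.le).2 ⟨s1, s2, rfl⟩

theorem IsKokotsakis.exists_foldedSurface {K : Surface} (hΘ : Θ.Admissible)
    (h : IsKokotsakis Θ P K) : ∃ (R S : Fin 4 → ℝ) (φ : Fin 4 → Real.Angle), (∀ i, 0 < R i) ∧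
      (∀ i, 0 < S i) ∧ K = foldedSurface Θ P R S φ := by
  have hP := h.interior
  obtain ⟨-, hA, -, h4⟩ := isKokotsakis_iff.1 h
  have key : ∀ i, ∃ (R S : ℝ) (φ : Real.Angle), 0 < R ∧ 0 < S ∧
      outPt K i = foldOut (P i) (unitVec P i) φ R (outAng Θ i) ∧
      inPt K (i + 1) = foldIn (P i) (unitVec P i) (len P i) φ S (inAng Θ (i + 1)) := by
    intro i
    obtain ⟨h1, h2, h3, -⟩ := h4 i
    rw [hA, hA, ← hP.add_unitVec i] at h1 h2 h3
    have hu := hP.norm_unitVec i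
    obtain ⟨φ, a, k, hk, e⟩ := exists_fold hu (P i) (outPt K i)
    obtain ⟨ψ, b, l, hl, e'⟩ := exists_fold hu (P i) (inPt K (i + 1))
    rw [e, e'] at h3
    obtain ⟨hk, hl, rfl⟩ := (sSameSide_fold_iff hu (hP.len_pos i).ne' hk hl).1 h3
    rw [e] at h1 ⊢
    rw [e'] at h2 ⊢
    obtain ⟨R, hR, eR⟩ := exists_foldOut hu (P i) (hP.len_pos i) hk (hΘ.outAng_mem i).1.le
      (hΘ.outAng_mem i).2.le h1
    obtain ⟨S, hS, eS⟩ := exists_foldIn hu (P i) (hP.len_pos i) hl (hΘ.inAng_mem _).1.le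
      (hΘ.inAng_mem _).2.le h2
    exact ⟨R, S, φ, hR, hS, eR, eS⟩
  choose R S φ hR hS ho hi using key
  refine ⟨R, S, φ, hR, hS, surface_ext hA (fun i => ?_) (forall_succ fun i => ?_)⟩
  · rw [ho, outPt_foldedSurface]
  · rw [hi, inPt_foldedSurface]

/-- Distances within the base or a side face do not depend on the dihedral angles, and the closing
conditions fix those in the corner triangles. -/
theorem faceIsometric_foldedSurface {ψ : Fin 4 → Real.Angle} (hP : HasInteriorAngles P Θ.δ)
    (h : Closes Θ φ) (h' : Closes Θ ψ) :
    FaceIsometric (foldedSurface Θ P R S φ) (foldedSurface Θ P R S ψ) := by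
  have e : ∀ {a b : ℝ}, 0 ≤ a → 0 ≤ b → a ^ 2 = b ^ 2 → a = b := fun ha hb e =>
    (sq_eq_sq₀ ha hb).1 e
  rw [faceIsometric_iff]
  refine ⟨fun i j => rfl, forall_succ fun i => e dist_nonneg dist_nonneg ?_, fun i =>
    ⟨e dist_nonneg dist_nonneg ?_, e dist_nonneg dist_nonneg ?_, e dist_nonneg dist_nonneg ?_,
      e dist_nonneg dist_nonneg ?_, e dist_nonneg dist_nonneg ?_⟩⟩
  · rw [outPt_foldedSurface, inPt_foldedSurface, outPt_foldedSurface, inPt_foldedSurface,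
      dist_foldOut_foldIn_sq (hP.norm_unitVec _) (hP.add_unitVec i).symm (hP.unitVec_eq i),
      dist_foldOut_foldIn_sq (hP.norm_unitVec _) (hP.add_unitVec i).symm (hP.unitVec_eq i),
      h i, h' i]
  all_goals
    have hu := hP.norm_unitVec i
    have hA : ∀ ψ, emb (P i) = fold (P i) (unitVec P i) ψ 0 0 := fun ψ => by rw [fold_zero]; simp
    have hB : ∀ ψ, emb (P (i + 1)) = fold (P i) (unitVec P i) ψ (len P i) 0 := fun ψ => by
      rw [fold_zero, hP.add_unitVec]
    simp only [outPt_foldedSurface, inPt_foldedSurface]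
  · change dist (emb (P i)) _ ^ 2 = dist (emb (P i)) _ ^ 2
    rw [hA (φ i), foldOut, foldOut, dist_fold_sq hu, dist_fold_sq hu]; ring
  · change dist (emb (P (i + 1))) _ ^ 2 = dist (emb (P (i + 1))) _ ^ 2
    rw [hB (φ i), foldOut, foldOut, dist_fold_sq hu, dist_fold_sq hu]; ring
  · change dist (emb (P i)) _ ^ 2 = dist (emb (P i)) _ ^ 2
    rw [hA (φ i), foldIn, foldIn, dist_fold_sq hu, dist_fold_sq hu]; ring
  · change dist (emb (P (i + 1))) _ ^ 2 = dist (emb (P (i + 1))) _ ^ 2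
    rw [hB (φ i), foldIn, foldIn, dist_fold_sq hu, dist_fold_sq hu]; ring
  · rw [foldOut, foldOut, foldIn, foldIn, dist_fold_sq hu, dist_fold_sq hu, sub_self, sub_self]

/-- Distances to the base vertices place each lateral vertex up to rotation about its edge, the
distance between the two lateral vertices of a face makes their rotation angles equal, and the
corner distances give back the closing conditions. -/
theorem FaceIsometric.exists_foldedSurface (hΘ : Θ.Admissible) (hP : HasInteriorAngles P Θ.δ)
    (hR : ∀ i, 0 < R i) (hS : ∀ i, 0 < S i) (hφ : Closes Θ φ) {L : Surface}
    (hA : L.A = (foldedSurface Θ P R S φ).A) (h : FaceIsometric (foldedSurface Θ P R S φ) L) :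
    ∃ ψ, L = foldedSurface Θ P R S ψ ∧ Closes Θ ψ := by
  obtain ⟨-, h1, h2⟩ := faceIsometric_iff.1 h
  have hA' : ∀ i, L.A i = emb (P i) := fun i => by rw [hA]; rfl
  have key : ∀ i, ∃ ψ : Real.Angle,
      outPt L i = foldOut (P i) (unitVec P i) ψ (R i) (outAng Θ i) ∧
      inPt L (i + 1) = foldIn (P i) (unitVec P i) (len P i) ψ (S i) (inAng Θ (i + 1)) := by
    intro i
    have hu := hP.norm_unitVec i
    have hl := (hP.len_pos i).ne'
    have s1 := mul_pos (hR i) (sin_pos_of_pos_of_lt_pi (hΘ.outAng_mem i).1 (hΘ.outAng_mem i).2)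
    have s2 := mul_pos (hS i)
      (sin_pos_of_pos_of_lt_pi (hΘ.inAng_mem (i + 1)).1 (hΘ.inAng_mem (i + 1)).2)
    obtain ⟨a, b, c, d, e⟩ := h2 i
    rw [outPt_foldedSurface, hA, foldOut] at a b
    rw [inPt_foldedSurface, hA, foldIn] at c d
    rw [outPt_foldedSurface, inPt_foldedSurface, foldIn, foldOut] at e
    change dist (emb (P i)) _ = dist (emb (P i)) _ at a c
    change dist (emb (P (i + 1))) _ = dist (emb (P (i + 1))) _ at b d
    rw [← hP.add_unitVec i] at b d
    obtain ⟨ψ, e1⟩ := eq_fold_of_dist hu hl s1.le a b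
    obtain ⟨χ, e2⟩ := eq_fold_of_dist hu hl s2.le c d
    rw [e1, e2] at e
    obtain rfl := angle_eq_of_dist hu s1 s2 e
    exact ⟨ψ, e1, e2⟩
  choose ψ ho hi using key
  have hL : L = foldedSurface Θ P R S ψ :=
    surface_ext hA' (fun i => by rw [ho, outPt_foldedSurface])
      (forall_succ fun i => by rw [hi, inPt_foldedSurface])
  refine ⟨ψ, hL, fun i => ?_⟩
  subst hL
  have e := congrArg (· ^ 2) (h1 (i + 1))
  simp only [outPt_foldedSurface, inPt_foldedSurface,
      dist_foldOut_foldIn_sq (hP.norm_unitVec _) (hP.add_unitVec i).symm (hP.unitVec_eq i), hφ i] at e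
  exact mul_left_cancel₀ (mul_pos (hR (i + 1)) (hS i)).ne' (by linarith)

theorem dihedrals_foldedSurface (hΘ : Θ.Admissible) (hP : HasInteriorAngles P Θ.δ)
    (hR : ∀ i, 0 < R i) :
    dihedrals P (foldedSurface Θ P R S φ) = ![φ 0, φ 3, φ 2, φ 1] := by
  have key : ∀ i, extDihedral P i (outPt (foldedSurface Θ P R S φ) i) = φ i := fun i => by
    rw [outPt_foldedSurface]
    exact extDihedral_fold P i (hP i).1 _ _
      (mul_pos (hR i) (sin_pos_of_pos_of_lt_pi (hΘ.outAng_mem i).1 (hΘ.outAng_mem i).2))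
  funext j
  fin_cases j
  exacts [key 0, key 3, key 2, key 1]

end

/-! ### The closing condition in terms of half-angles -/

/-- The homogeneous form of `(z + λ / z) (w + μ / w) = ν` for `z = tan x`, `w = tan y`. -/
def Bricard (l m n x y : ℝ) : Prop :=
  (sin x ^ 2 + l * cos x ^ 2) * (sin y ^ 2 + m * cos y ^ 2) = n * (sin x * cos x * (sin y * cos y))

namespace PlanarAngles.Admissible
variable {Θ : PlanarAngles}

theorem lam_eq (h : Θ.Admissible) (i : Fin 4) :
    Θ.lam i = sin (Θ.δ i + Θ.α i) / sin (Θ.δ i - Θ.α i) := if_neg fun e => h.δ_ne i e.2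

theorem mu_eq (h : Θ.Admissible) (i : Fin 4) :
    Θ.mu i = sin (Θ.δ i + Θ.γ i) / sin (Θ.δ i - Θ.γ i) := if_neg fun e => h.δ_ne i e.2

theorem nu_eq (h : Θ.Admissible) (i : Fin 4) :
    Θ.nu i = 4 * sin (Θ.α i) * sin (Θ.γ i) * cos (Θ.δ i) /
      (sin (Θ.δ i - Θ.α i) * sin (Θ.δ i - Θ.γ i)) := by
  have hδ := h.cos_δ i
  have h1 := h.sin_sub_α i
  have h2 := h.sin_sub_γ i
  rw [PlanarAngles.nu, if_pos (h.δ_ne i), h.lam_eq, h.mu_eq, div_sub_one h1, div_sub_one h2,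
    show sin (Θ.δ i + Θ.α i) - sin (Θ.δ i - Θ.α i) = 2 * cos (Θ.δ i) * sin (Θ.α i) by
      rw [sin_add, sin_sub]; ring,
    show sin (Θ.δ i + Θ.γ i) - sin (Θ.δ i - Θ.γ i) = 2 * cos (Θ.δ i) * sin (Θ.γ i) by
      rw [sin_add, sin_sub]; ring]
  field_simp
  ring

theorem nu_ne_zero (h : Θ.Admissible) (i : Fin 4) : Θ.nu i ≠ 0 := by
  rw [h.nu_eq]
  have h1 := sin_pos_of_pos_of_lt_pi (h.α_mem i).1 (h.α_mem i).2
  have h2 := sin_pos_of_pos_of_lt_pi (h.γ_mem i).1 (h.γ_mem i).2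
  exact div_ne_zero (mul_ne_zero (by positivity) (h.cos_δ i))
    (mul_ne_zero (h.sin_sub_α i) (h.sin_sub_γ i))

end PlanarAngles.Admissible

/-- Multiplied by `cos δ`, the corner condition has constant term `cos α cos γ` by orthodiagonality.
Together with `-cos² δ cos α cos γ` it leaves `sin² δ cos α cos γ`, which completes the product
`(sin δ cos α + cos δ sin α cos φ)(sin δ cos γ + cos δ sin γ cos ψ)`. In half-angles the two factors
become the brackets of `Bricard`. -/
theorem PlanarAngles.Admissible.cornerCos_iff {Θ : PlanarAngles} (h : Θ.Admissible) (i : Fin 4)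
    (x y : ℝ) : cornerCos (Θ.δ i) (Θ.α i) (Θ.γ i) ((2 * x : ℝ) : Real.Angle)
      ((2 * y : ℝ) : Real.Angle) = cos (Θ.β i) ↔ Bricard (Θ.lam i) (Θ.mu i) (Θ.nu i) x y := by
  have ho := h.orthodiagonal i
  have hδ := h.cos_δ i
  have h1 := h.sin_sub_α i
  have h2 := h.sin_sub_γ i
  have hlam := h.lam_eq i
  have hmu := h.mu_eq i
  have hnu := h.nu_eq i
  have e1 : sin (Θ.δ i - Θ.α i) * sin (Θ.δ i - Θ.γ i) *
      ((sin x ^ 2 + Θ.lam i * cos x ^ 2) * (sin y ^ 2 + Θ.mu i * cos y ^ 2)) =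
      (sin (Θ.δ i - Θ.α i) * sin x ^ 2 + sin (Θ.δ i + Θ.α i) * cos x ^ 2) *
      (sin (Θ.δ i - Θ.γ i) * sin y ^ 2 + sin (Θ.δ i + Θ.γ i) * cos y ^ 2) := by
    rw [hlam, hmu]; field_simp
  have e2 : sin (Θ.δ i - Θ.α i) * sin (Θ.δ i - Θ.γ i) *
      (Θ.nu i * (sin x * cos x * (sin y * cos y))) =
      4 * sin (Θ.α i) * sin (Θ.γ i) * cos (Θ.δ i) * (sin x * cos x * (sin y * cos y)) := by
    rw [hnu]; field_simp
  have key : cos (Θ.δ i) * (cos (Θ.β i) - cornerCos (Θ.δ i) (Θ.α i) (Θ.γ i)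
      ((2 * x : ℝ) : Real.Angle) ((2 * y : ℝ) : Real.Angle)) =
      sin (Θ.δ i - Θ.α i) * sin (Θ.δ i - Θ.γ i) *
      ((sin x ^ 2 + Θ.lam i * cos x ^ 2) * (sin y ^ 2 + Θ.mu i * cos y ^ 2) -
      Θ.nu i * (sin x * cos x * (sin y * cos y))) := by
    rw [mul_sub (sin (Θ.δ i - Θ.α i) * sin (Θ.δ i - Θ.γ i)), e1, e2, cornerCos]
    simp only [Real.Angle.cos_coe, Real.Angle.sin_coe, sin_two_mul, cos_two_mul', sin_add, sin_sub]
    have hx := sin_sq_add_cos_sq x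
    have hy := sin_sq_add_cos_sq y
    have hd := sin_sq_add_cos_sq (Θ.δ i)
    rw [mul_sub, mul_comm (cos (Θ.δ i)) (cos (Θ.β i)), ← ho]
    generalize Θ.α i = α
    generalize Θ.γ i = γ
    generalize Θ.δ i = δ at *
    have hx' := cos_sq' x
    have hy' := cos_sq' y
    have hd' := sin_sq δ
    generalize sin α = sa
    generalize sin γ = sg
    generalize cos α = ca
    generalize cos γ = cg
    simp only [hx', hy']
    generalize sin δ = sd at *
    generalize cos δ = cd at *
    linear_combination (-(ca * cg)) * hd
  unfold Bricard
  constructor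
  · intro e
    rw [e, sub_self, mul_zero, eq_comm] at key
    have := (mul_eq_zero.1 key).resolve_left (mul_ne_zero h1 h2)
    linarith
  · intro e
    rw [e, sub_self, mul_zero] at key
    have := (mul_eq_zero.1 key).resolve_left hδ
    linarith

theorem PlanarAngles.Admissible.closes_iff {Θ : PlanarAngles} (h : Θ.Admissible) (x : Fin 4 → ℝ) :
    Closes Θ (fun i => ((2 * x i : ℝ) : Real.Angle)) ↔
      Bricard (Θ.lam 0) (Θ.mu 0) (Θ.nu 0) (x 0) (x 3) ∧
      Bricard (Θ.lam 1) (Θ.mu 1) (Θ.nu 1) (x 0) (x 1) ∧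
      Bricard (Θ.lam 2) (Θ.mu 2) (Θ.nu 2) (x 2) (x 1) ∧
      Bricard (Θ.lam 3) (Θ.mu 3) (Θ.nu 3) (x 2) (x 3) := by
  rw [← h.cornerCos_iff, ← h.cornerCos_iff, ← h.cornerCos_iff, ← h.cornerCos_iff,
    cornerCos_comm (Θ.δ 1), cornerCos_comm (Θ.δ 3)]
  constructor
  · intro H
    exact ⟨H 3, H 0, H 1, H 2⟩
  · rintro ⟨h0, h1, h2, h3⟩ i
    fin_cases i
    exacts [h1, h2, h3, h0]

/-! ### The projective line -/

theorem two_mul_coe_eq_iff {x y : ℝ} : ((2 * x : ℝ) : Real.Angle) = ((2 * y : ℝ) : Real.Angle) ↔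
    sin x * cos y = cos x * sin y := by
  rw [Real.Angle.angle_eq_iff_two_pi_dvd_sub, ← sub_eq_zero (a := sin x * cos y), ← sin_sub,
    sin_eq_zero_iff]
  constructor
  · rintro ⟨n, hn⟩
    exact ⟨n, by linarith⟩
  · rintro ⟨n, hn⟩
    exact ⟨n, by linarith⟩

theorem exists_two_mul_coe (φ : Real.Angle) : ∃ x : ℝ, φ = ((2 * x : ℝ) : Real.Angle) := by
  induction φ using Real.Angle.induction_on with
  | _ y => exact ⟨y / 2, by rw [mul_div_cancel₀ _ two_ne_zero]⟩

theorem sin_arctan_eq (v : ℝ) : sin (arctan v) = v * cos (arctan v) := by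
  rw [← tan_mul_cos (cos_arctan_pos v).ne', tan_arctan]

theorem twoArctan_coe_iff {v x : ℝ} :
    ((2 * x : ℝ) : Real.Angle) = twoArctan (v : OnePoint ℝ) ↔ sin x = v * cos x := by
  rw [show twoArctan (v : OnePoint ℝ) = ((2 * arctan v : ℝ) : Real.Angle) from rfl,
    two_mul_coe_eq_iff, sin_arctan_eq, mul_left_comm, ← mul_assoc v]
  exact mul_left_inj' (cos_arctan_pos v).ne'

/-- The point `k X / W = k W / Y` of the projective line is `tan x`. -/
def OnBranch (k X Y W x : ℝ) : Prop := W * sin x = k * X * cos x ∧ Y * sin x = k * W * cos x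

/-- For `W ≠ 0` the second equation of `OnBranch` follows from the first. For `W = 0` exactly one of
`X, Y` vanishes, which tells the value `0` from `∞`; hence `0` is the correct value of the quotient
`0/0`. -/
theorem twoArctan_ratio_iff {k X Y W x : ℝ} (hk : k ≠ 0) (h : X * Y = W ^ 2) (hXY : 0 < X + Y) :
    ((2 * x : ℝ) : Real.Angle) = twoArctan (ratio (k * X) W) ↔ OnBranch k X Y W x := by
  unfold ratio OnBranch
  split_ifs with hW hX
  · have hX := (mul_eq_zero.1 hX).resolve_left hk
    rw [twoArctan_coe_iff, hW, hX]
    have hY : Y ≠ 0 := by linarith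
    simp [hY]
  · have hX := right_ne_zero_of_mul hX
    rw [hW, zero_pow two_ne_zero] at h
    have hY := (mul_eq_zero.1 h).resolve_left hX
    rw [show twoArctan OnePoint.infty = ((2 * (π / 2) : ℝ) : Real.Angle) by
      rw [mul_div_cancel₀ _ two_ne_zero]; rfl, two_mul_coe_eq_iff, hW, hY]
    simp [hk, hX, eq_comm]
  · rw [twoArctan_coe_iff, div_mul_eq_mul_div, eq_div_iff hW, mul_comm (sin x)]
    refine ⟨fun e => ⟨e, ?_⟩, And.left⟩
    apply mul_left_cancel₀ hW
    linear_combination Y * e + k * cos x * h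

/-- The two solutions of a quadratic equation of Bricard type. -/
theorem onBranch_or_onBranch {k X Y W B x : ℝ} (h : X * Y = W ^ 2) (hXY : X + Y = 2 * B)
    (hB : 0 < B) (e : W * (sin x ^ 2 + k ^ 2 * cos x ^ 2) = k * (2 * B) * (sin x * cos x)) :
    OnBranch k X Y W x ∨ OnBranch k Y X W x := by
  unfold OnBranch
  rcases eq_or_ne W 0 with rfl | hW
  · have h0 : k * (sin x * cos x) = 0 := by
      have : (2 * B) * (k * (sin x * cos x)) = 0 := by linarith
      exact (mul_eq_zero.1 this).resolve_left (by positivity)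
    rw [zero_pow two_ne_zero] at h
    rcases mul_eq_zero.1 h0 with hk | h0
    · subst hk
      rcases mul_eq_zero.1 h with h | h <;> simp [h]
    · rcases mul_eq_zero.1 h0 with h0 | h0 <;> rcases mul_eq_zero.1 h with h | h <;> simp [h, h0]
  -- Multiplying the equation by `W` and using `W² = X Y` makes the quadratic split.
  · have : (W * sin x - k * X * cos x) * (W * sin x - k * Y * cos x) = 0 := by
      linear_combination W * e - k * W * sin x * cos x * hXY + k ^ 2 * cos x ^ 2 * h
    rcases mul_eq_zero.1 this with e1 | e1
    · refine .inl ⟨by linarith, mul_left_cancel₀ hW ?_⟩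
      linear_combination Y * e1 + k * cos x * h
    · refine .inr ⟨by linarith, mul_left_cancel₀ hW ?_⟩
      linear_combination X * e1 + k * cos x * h

/-- For `v = tan x = k X / W` this and `OnBranch.sub` are the homogeneous forms of `v ± k²/v = k (X
± Y)/W`. -/
theorem OnBranch.add {k X Y W x : ℝ} (h : OnBranch k X Y W x) :
    W * (sin x ^ 2 + k ^ 2 * cos x ^ 2) = k * (X + Y) * (sin x * cos x) := by
  obtain ⟨h1, h2⟩ := h
  linear_combination sin x * h1 - k * cos x * h2

theorem OnBranch.sub {k X Y W x : ℝ} (h : OnBranch k X Y W x) :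
    W * (sin x ^ 2 - k ^ 2 * cos x ^ 2) = k * (X - Y) * (sin x * cos x) := by
  obtain ⟨h1, h2⟩ := h
  linear_combination sin x * h1 + k * cos x * h2

theorem OnBranch.mul_eq_zero {k X Y x : ℝ} (h : OnBranch k X Y 0 x) (hk : k ≠ 0) (hXY : 0 < X + Y) :
    sin x * cos x = 0 := by
  have := h.add
  rw [zero_mul, eq_comm, mul_assoc] at this
  exact (_root_.mul_eq_zero.1 ((_root_.mul_eq_zero.1 this).resolve_left hk)).resolve_left hXY.ne'

/-! ### The parametrization -/

/-- The algebraic relations between `s = sin t`, `c = cos t`, `e = √(1 + A² s²)`,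
`d = √(1 + A² c²)`, `A = √(ζ - 1)` and `B = √(ζ + 1)`. -/
structure Curve (A B s c e d : ℝ) : Prop where
  A_pos : 0 < A
  B_pos : 0 < B
  e_pos : 0 < e
  d_pos : 0 < d
  sq_add : s ^ 2 + c ^ 2 = 1
  e_sq : e ^ 2 = 1 + A ^ 2 * s ^ 2
  d_sq : d ^ 2 = 1 + A ^ 2 * c ^ 2
  B_sq : B ^ 2 = A ^ 2 + 2

namespace Curve
variable {A B s c e d : ℝ}

/-- `B² - (s d - c e)²` is the discriminant of the quadratic for `u`; being the square of `s e + c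
d`, it introduces no new radical. `mul_sub'` does the same for `w₂`. -/
theorem mul_sub (h : Curve A B s c e d) :
    (B + (s * e + c * d)) * (B - (s * e + c * d)) = (s * d - c * e) ^ 2 := by
  linear_combination h.B_sq - (s ^ 2 + c ^ 2) * h.e_sq - (s ^ 2 + c ^ 2) * h.d_sq
    - (A ^ 2 * (s ^ 2 + c ^ 2) + A ^ 2 + 2) * h.sq_add

theorem mul_sub' (h : Curve A B s c e d) :
    (B + (s * e - c * d)) * (B - (s * e - c * d)) = (s * d + c * e) ^ 2 := by
  linear_combination h.B_sq - (s ^ 2 + c ^ 2) * h.e_sq - (s ^ 2 + c ^ 2) * h.d_sq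
    - (A ^ 2 * (s ^ 2 + c ^ 2) + A ^ 2 + 2) * h.sq_add

theorem F_mul_inv (h : Curve A B s c e d) : (A * s + e) * (e - A * s) = 1 := by
  linear_combination h.e_sq

theorem F_mul_inv' (h : Curve A B s c e d) : (A * c + d) * (d - A * c) = 1 := by
  linear_combination h.d_sq

/-- Together with `WW`: the product of the two discriminant roots is `ζ = A² + 1` times the product
of the two denominators. This is why the third closing condition holds identically in `t`. -/
theorem HH (h : Curve A B s c e d) :
    (s * e + c * d) * (s * e - c * d) = (A ^ 2 + 1) * (s ^ 2 - c ^ 2) := by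
  linear_combination s ^ 2 * h.e_sq - c ^ 2 * h.d_sq + A ^ 2 * (s ^ 2 - c ^ 2) * h.sq_add

theorem WW (h : Curve A B s c e d) :
    (s * d - c * e) * (s * d + c * e) = s ^ 2 - c ^ 2 := by
  linear_combination s ^ 2 * h.d_sq - c ^ 2 * h.e_sq

/-- Where the denominator of `w₂` vanishes, so does the discriminant root of `u`; there `κ` does not
influence `u`. -/
theorem H_eq_zero_of_W' (h : Curve A B s c e d) (hW : s * d + c * e = 0) : s * e + c * d = 0 := by
  have h1 := h.WW
  rw [hW, mul_zero] at h1
  have : e = d := by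
    rw [← sq_eq_sq₀ h.e_pos.le h.d_pos.le, h.e_sq, h.d_sq]; linear_combination -A ^ 2 * h1
  rw [this] at hW ⊢
  exact hW

theorem H'_eq_zero_of_W (h : Curve A B s c e d) (hW : s * d - c * e = 0) : s * e - c * d = 0 := by
  have h1 := h.WW
  rw [hW, zero_mul] at h1
  have : e = d := by
    rw [← sq_eq_sq₀ h.e_pos.le h.d_pos.le, h.e_sq, h.d_sq]; linear_combination -A ^ 2 * h1
  rw [this] at hW ⊢
  exact hW

end Curve

/-- Normal form of the four involution factors `l², m², n², o²` (up to sign), with the signs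
`s₀, s₁, s₂, s₃` of the coefficients `ν`. -/
structure FlexData where
  l : ℝ
  m : ℝ
  n : ℝ
  o : ℝ
  s₀ : ℝ
  s₁ : ℝ
  s₂ : ℝ
  s₃ : ℝ
  A : ℝ
  B : ℝ
  l_pos : 0 < l
  m_pos : 0 < m
  n_pos : 0 < n
  o_pos : 0 < o
  s₀_sq : s₀ ^ 2 = 1
  s₁_sq : s₁ ^ 2 = 1
  s₂_sq : s₂ ^ 2 = 1
  s₃_sq : s₃ ^ 2 = 1
  A_pos : 0 < A
  B_pos : 0 < B
  B_sq : B ^ 2 = A ^ 2 + 2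

namespace FlexData
variable (D : FlexData)

/-- The four closing conditions. -/
def Eqs (x : Fin 4 → ℝ) : Prop :=
  Bricard (D.l ^ 2) (D.m ^ 2) (D.s₀ * (4 * (D.A ^ 2 + 1) * (D.l * D.m))) (x 0) (x 3) ∧
  Bricard (-D.l ^ 2) (D.o ^ 2) (D.s₁ * (4 * (D.A * D.B) * (D.l * D.o))) (x 0) (x 1) ∧
  Bricard (-D.n ^ 2) (-D.o ^ 2) (D.s₂ * (4 * (D.A ^ 2 + 1) * (D.n * D.o))) (x 2) (x 1) ∧
  Bricard (D.n ^ 2) (-D.m ^ 2) (D.s₃ * (4 * (D.A * D.B) * (D.n * D.m))) (x 2) (x 3)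

/-- The points of the flexion. -/
def OnFlexion (ε κ s c e d : ℝ) (x : Fin 4 → ℝ) : Prop :=
  sin (x 0) = ε * (D.s₀ * D.l * (D.A * s + e) * (D.A * c + d)) * cos (x 0) ∧
  sin (x 3) = ε * (D.m * (D.A * s + e) * (d - D.A * c)) * cos (x 3) ∧
  OnBranch (ε * (D.s₃ * D.n)) (D.B + κ * (s * e + c * d)) (D.B - κ * (s * e + c * d))
    (s * d - c * e) (x 2) ∧
  OnBranch (ε * (D.o * (D.s₀ * D.s₁)))
    (D.B + κ * (D.s₀ * D.s₁ * D.s₂ * D.s₃) * (s * e - c * d))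
    (D.B - κ * (D.s₀ * D.s₁ * D.s₂ * D.s₃) * (s * e - c * d)) (s * d + c * e) (x 1)

variable {D} {ε κ s c e d : ℝ} {x : Fin 4 → ℝ}

/-- With `f = A s + e` and `g = A c + d`, whose inverses are `e - A s` and `d - A c`, the product is
`f² + f⁻² + g² + g⁻² = 4 A² (s² + c²) + 4`. -/
theorem F_prod (h : Curve D.A D.B s c e d) :
    ((D.A * s + e) * (D.A * c + d) + (e - D.A * s) * (d - D.A * c)) *
      ((D.A * s + e) * (d - D.A * c) + (e - D.A * s) * (D.A * c + d)) = 4 * (D.A ^ 2 + 1) := by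
  linear_combination (2 * (e ^ 2 + D.A ^ 2 * s ^ 2)) * h.F_mul_inv' +
    (2 * (d ^ 2 + D.A ^ 2 * c ^ 2)) * h.F_mul_inv + 2 * h.e_sq + 2 * h.d_sq +
    4 * D.A ^ 2 * h.sq_add

theorem affine_add {K M M' y : ℝ} (hy : sin y = K * M * cos y) (hM : M * M' = 1) :
    sin y ^ 2 + K ^ 2 * cos y ^ 2 = sin y * cos y * (K * (M + M')) := by
  rw [hy]; linear_combination (-K ^ 2 * cos y ^ 2) * hM

theorem affine_sub {K M M' y : ℝ} (hy : sin y = K * M * cos y) (hM : M * M' = 1) :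
    sin y ^ 2 - K ^ 2 * cos y ^ 2 = sin y * cos y * (K * (M - M')) := by
  rw [hy]; linear_combination (K ^ 2 * cos y ^ 2) * hM

theorem z_inv (h : Curve D.A D.B s c e d) :
    ((D.A * s + e) * (D.A * c + d)) * ((e - D.A * s) * (d - D.A * c)) = 1 := by
  rw [mul_mul_mul_comm, h.F_mul_inv, h.F_mul_inv', one_mul]

theorem w_inv (h : Curve D.A D.B s c e d) :
    ((D.A * s + e) * (d - D.A * c)) * ((e - D.A * s) * (D.A * c + d)) = 1 := by
  rw [mul_mul_mul_comm, h.F_mul_inv, mul_comm (d - _), h.F_mul_inv', one_mul]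

theorem F_sub_z (D : FlexData) (s c e d : ℝ) :
    (D.A * s + e) * (D.A * c + d) - (e - D.A * s) * (d - D.A * c) = 2 * D.A * (s * d + c * e) := by
  ring

theorem F_sub_w (D : FlexData) (s c e d : ℝ) :
    (D.A * s + e) * (d - D.A * c) - (e - D.A * s) * (D.A * c + d) = 2 * D.A * (s * d - c * e) := by
  ring

/-- Each point of the flexion satisfies the closing conditions. -/
theorem OnFlexion.eqs (h : Curve D.A D.B s c e d) (hε : ε ^ 2 = 1) (hκ : κ ^ 2 = 1)
    (hx : D.OnFlexion ε κ s c e d x) : D.Eqs x := by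
  obtain ⟨h0, h3, h2, h1⟩ := hx
  have K0 : (ε * D.s₀ * D.l) ^ 2 = D.l ^ 2 := by rw [mul_pow, mul_pow, hε, D.s₀_sq]; ring
  have K3 : (ε * D.m) ^ 2 = D.m ^ 2 := by rw [mul_pow, hε]; ring
  have K2 : (ε * (D.s₃ * D.n)) ^ 2 = D.n ^ 2 := by rw [mul_pow, mul_pow, hε, D.s₃_sq]; ring
  have K1 : (ε * (D.o * (D.s₀ * D.s₁))) ^ 2 = D.o ^ 2 := by
    rw [mul_pow, mul_pow, mul_pow, hε, D.s₀_sq, D.s₁_sq]; ring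
  have h0' : sin (x 0) = (ε * D.s₀ * D.l) * ((D.A * s + e) * (D.A * c + d)) * cos (x 0) := by
    rw [h0]; ring
  have h3' : sin (x 3) = (ε * D.m) * ((D.A * s + e) * (d - D.A * c)) * cos (x 3) := by
    rw [h3]; ring
  have P0 := affine_add h0' (z_inv h)
  have M0 := affine_sub h0' (z_inv h)
  have P3 := affine_add h3' (w_inv h)
  have M3 := affine_sub h3' (w_inv h)
  have P1 := h1.add
  have M1 := h1.sub
  have P2 := h2.add
  have M2 := h2.sub
  rw [F_sub_z, K0] at M0
  rw [F_sub_w, K3] at M3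
  rw [K0] at P0
  rw [K3] at P3
  rw [K1] at P1 M1
  rw [K2] at P2 M2
  unfold Eqs Bricard
  refine ⟨?_, ?_, ?_, ?_⟩
  · rw [P0, P3]
    linear_combination (ε ^ 2 * D.s₀ * D.l * D.m * sin (x 0) * cos (x 0) * sin (x 3) * cos (x 3)) *
      F_prod h + (D.s₀ * D.l * D.m * sin (x 0) * cos (x 0) * sin (x 3) * cos (x 3) *
        (4 * (D.A ^ 2 + 1))) * hε
  · rw [neg_mul, ← sub_eq_add_neg, M0]
    linear_combination (sin (x 0) * cos (x 0) * ε * D.s₀ * D.l * 2 * D.A) * P1 +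
      (sin (x 0) * cos (x 0) * sin (x 1) * cos (x 1) * 4 * D.A * D.B * D.l * D.o * D.s₁) *
       (D.s₀ ^ 2 * hε + D.s₀_sq)
  · rw [neg_mul, ← sub_eq_add_neg, neg_mul, ← sub_eq_add_neg]
    -- The product of the two branch equations needs nonzero denominators. If one of them vanishes,
    -- both sides of the third condition are zero: that denominator makes `sin · cos` vanish at its
    -- own edge, and the bracket at the other edge vanishes too.
    by_cases hW : (s * d - c * e) = 0
    · have hH := h.H'_eq_zero_of_W hW
      have hW' : s * d + c * e ≠ 0 := fun hW' => by
        have := h.mul_sub'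
        rw [hH, hW'] at this
        have := h.B_pos
        nlinarith
      rw [hH] at M1
      have e1 := (mul_eq_zero.1 (M1.trans (by ring))).resolve_left hW'
      rw [hW] at h2
      have e2 := h2.mul_eq_zero (mul_ne_zero (by rintro rfl; simp at hε)
        (mul_ne_zero (by intro e; simpa [e] using D.s₃_sq) D.n_pos.ne')) (by linarith [D.B_pos])
      rw [e1, e2]
      ring
    by_cases hW' : (s * d + c * e) = 0
    · have hH := h.H_eq_zero_of_W' hW'
      rw [hH] at M2
      have e1 := (mul_eq_zero.1 (M2.trans (by ring))).resolve_left hW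
      rw [hW'] at h1
      have e2 := h1.mul_eq_zero (mul_ne_zero (by rintro rfl; simp at hε)
        (mul_ne_zero D.o_pos.ne' (mul_ne_zero (by intro e; simpa [e] using D.s₀_sq)
          (by intro e; simpa [e] using D.s₁_sq)))) (by linarith [D.B_pos])
      rw [e1, e2]
      ring
    · apply mul_left_cancel₀ (mul_ne_zero hW hW')
      have e1 := congrArg₂ (· * ·) M2 M1
      have e2 : (s * d - c * e) * (s * d + c * e) * ((sin (x 2) ^ 2 - D.n ^ 2 * cos (x 2) ^ 2) *
          (sin (x 1) ^ 2 - D.o ^ 2 * cos (x 1) ^ 2)) = (ε ^ 2 * κ ^ 2) * (D.s₀ ^ 2 * D.s₁ ^ 2 *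
          D.s₃ ^ 2) * (D.s₂ * (D.n * D.o) * 4 * (sin (x 2) * cos (x 2) * (sin (x 1) * cos (x 1)))) *
          ((s * e + c * d) * (s * e - c * d)) := by
        linear_combination e1
      rw [e2, hε, hκ, D.s₀_sq, D.s₁_sq, D.s₃_sq, h.HH, h.WW]
      ring
  · rw [neg_mul, ← sub_eq_add_neg, M3]
    linear_combination (sin (x 3) * cos (x 3) * ε * D.m * 2 * D.A) * P2 +
      (sin (x 2) * cos (x 2) * sin (x 3) * cos (x 3) * 4 * D.A * D.B * D.n * D.m * D.s₃) * hε

theorem exists_cos_sin {a b : ℝ} (h : b ^ 2 + a ^ 2 = 1) :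
    ∃ t, 0 ≤ t ∧ t < 2 * π ∧ sin t = b ∧ cos t = a := by
  have hn : ‖(⟨a, b⟩ : ℂ)‖ = 1 := by
    rw [← sq_eq_sq₀ (norm_nonneg _) zero_le_one, Complex.sq_norm, Complex.normSq_mk]; linarith
  have h1 := Complex.norm_mul_cos_arg ⟨a, b⟩
  have h2 := Complex.norm_mul_sin_arg ⟨a, b⟩
  rw [hn, one_mul] at h1 h2
  have h3 := Complex.neg_pi_lt_arg ⟨a, b⟩
  have h4 := Complex.arg_le_pi ⟨a, b⟩
  rcases le_or_gt 0 (Complex.arg ⟨a, b⟩) with h | h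
  · exact ⟨_, h, by linarith [pi_pos], h2, h1⟩
  · exact ⟨Complex.arg ⟨a, b⟩ + 2 * π, by linarith, by linarith, by rw [sin_add_two_pi, h2],
      by rw [cos_add_two_pi, h1]⟩

/-- Writing `z = f g`, `w = f / g` turns the equation into `(f - 1/f)² + (g - 1/g)² = 4 A²`; `t` is
the polar angle on this circle, and `f` is recovered from `f - 1/f` as `A sin t + √(1 + A² sin² t)`.
-/
theorem exists_param {A z w : ℝ} (hA : 0 < A) (hz : 0 < z) (hw : 0 < w)
    (h : (z ^ 2 + 1) * (w ^ 2 + 1) = 4 * (A ^ 2 + 1) * (z * w)) :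
    ∃ t, 0 ≤ t ∧ t < 2 * π ∧
      z = (A * sin t + √(1 + A ^ 2 * sin t ^ 2)) * (A * cos t + √(1 + A ^ 2 * cos t ^ 2)) ∧
      w = (A * sin t + √(1 + A ^ 2 * sin t ^ 2)) * (√(1 + A ^ 2 * cos t ^ 2) - A * cos t) := by
  obtain ⟨f, hf, g, hg, hzf, hwf⟩ : ∃ f, 0 < f ∧ ∃ g, 0 < g ∧ z = f * g ∧ w = f * g⁻¹ := by
    refine ⟨√(z * w), by positivity, √(z / w), by positivity, ?_, ?_⟩
    · rw [← sqrt_mul (by positivity), show z * w * (z / w) = z ^ 2 by field_simp,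
        sqrt_sq hz.le]
    · rw [← sqrt_inv, ← sqrt_mul (by positivity), show z * w * (z / w)⁻¹ = w ^ 2 by field_simp,
        sqrt_sq hw.le]
  have h2 : (f - f⁻¹) ^ 2 + (g - g⁻¹) ^ 2 = 4 * A ^ 2 := by
    rw [hzf, hwf] at h
    field_simp at h ⊢
    linear_combination h
  obtain ⟨t, t0, t1, hs, hc⟩ := exists_cos_sin (b := (f - f⁻¹) / (2 * A)) (a := (g - g⁻¹) / (2 * A))
    (by rw [div_pow, div_pow, ← add_div, h2]; field_simp; norm_num)
  have key : ∀ {f : ℝ}, 0 < f → √(1 + A ^ 2 * ((f - f⁻¹) / (2 * A)) ^ 2) = (f + f⁻¹) / 2 := by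
    intro f hf
    rw [sqrt_eq_iff_mul_self_eq_of_pos (by positivity)]
    field_simp
    ring
  have k2 : ∀ f : ℝ, A * ((f - f⁻¹) / (2 * A)) = (f - f⁻¹) / 2 := fun f => by field_simp
  refine ⟨t, t0, t1, ?_, ?_⟩
  · rw [hs, hc, key hf, key hg, k2, k2, hzf]; ring
  · rw [hs, hc, key hf, key hg, k2, k2, hwf]; ring

theorem curve (D : FlexData) (t : ℝ) : Curve D.A D.B (sin t) (cos t) √(1 + D.A ^ 2 * sin t ^ 2)
    √(1 + D.A ^ 2 * cos t ^ 2) where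
  A_pos := D.A_pos
  B_pos := D.B_pos
  e_pos := by positivity
  d_pos := by positivity
  sq_add := sin_sq_add_cos_sq t
  e_sq := sq_sqrt (by positivity)
  d_sq := sq_sqrt (by positivity)
  B_sq := D.B_sq

theorem sign_cases {a : ℝ} (h : a ^ 2 = 1) : a = 1 ∨ a = -1 := sq_eq_one_iff.1 h

/-- Every solution of the closing conditions is a point of the flexion. -/
theorem Eqs.exists_onFlexion (hx : D.Eqs x) : ∃ ε κ t : ℝ, (ε = 1 ∨ ε = -1) ∧ (κ = 1 ∨ κ = -1) ∧
    0 ≤ t ∧ t < 2 * π ∧ D.OnFlexion ε κ (sin t) (cos t) √(1 + D.A ^ 2 * sin t ^ 2)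
      √(1 + D.A ^ 2 * cos t ^ 2) x := by
  obtain ⟨E0, E1, E2, E3⟩ := hx
  unfold Bricard at E0 E1 E2 E3
  have hl := D.l_pos
  have hm := D.m_pos
  have hA := D.A_pos
  have hc0 : ∀ y : ℝ, 0 < sin y ^ 2 + D.l ^ 2 * cos y ^ 2 := fun y => by
    have := sin_sq_add_cos_sq y
    by_cases hy : cos y = 0
    · rw [hy] at this ⊢; nlinarith
    · positivity
  have hc3 : ∀ y : ℝ, 0 < sin y ^ 2 + D.m ^ 2 * cos y ^ 2 := fun y => by
    have := sin_sq_add_cos_sq y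
    by_cases hy : cos y = 0
    · rw [hy] at this ⊢; nlinarith
    · positivity
  have hpos := mul_pos (hc0 (x 0)) (hc3 (x 3))
  -- The left side of the first condition is positive, so `z` and `w₁` are finite and nonzero.
  have hne : sin (x 0) * cos (x 0) * (sin (x 3) * cos (x 3)) ≠ 0 := by
    intro e
    rw [E0, e, mul_zero] at hpos
    exact hpos.false
  have hn0 := left_ne_zero_of_mul hne
  have hn3 := right_ne_zero_of_mul hne
  have hs0 := left_ne_zero_of_mul hn0
  have hk0 := right_ne_zero_of_mul hn0
  have hs3 := left_ne_zero_of_mul hn3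
  have hk3 := right_ne_zero_of_mul hn3
  have hz : sin (x 0) = sin (x 0) / cos (x 0) * cos (x 0) := by field_simp
  have hw : sin (x 3) = sin (x 3) / cos (x 3) * cos (x 3) := by field_simp
  have hz0 : sin (x 0) / cos (x 0) ≠ 0 := div_ne_zero hs0 hk0
  have hw0 : sin (x 3) / cos (x 3) ≠ 0 := div_ne_zero hs3 hk3
  generalize sin (x 0) / cos (x 0) = z at *
  generalize sin (x 3) / cos (x 3) = w at *
  have E0' : (z ^ 2 + D.l ^ 2) * (w ^ 2 + D.m ^ 2) =
      4 * (D.A ^ 2 + 1) * D.l * D.m * (D.s₀ * z * w) := by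
    apply mul_left_cancel₀ (mul_ne_zero (pow_ne_zero 2 hk0) (pow_ne_zero 2 hk3))
    rw [hz, hw] at E0
    linear_combination E0
  have hzw : 0 < D.s₀ * z * w := by
    have : 0 < (4 * (D.A ^ 2 + 1) * D.l * D.m) * (D.s₀ * z * w) := by
      rw [← E0']; positivity
    exact pos_of_mul_pos_right this (by positivity)
  -- `ε` is the sign of `w₁`; since `s₀ z w₁ > 0`, it is also the sign of `s₀ z`, so both can be
  -- made positive.
  obtain ⟨ε, hε, hεw⟩ : ∃ ε : ℝ, (ε = 1 ∨ ε = -1) ∧ 0 < ε * w := by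
    rcases lt_or_gt_of_ne hw0 with h | h
    · exact ⟨-1, by simp, by linarith⟩
    · exact ⟨1, by simp, by linarith⟩
  have hε2 : ε ^ 2 = 1 := sq_eq_one_iff.2 hε
  have hεz : 0 < ε * D.s₀ * z := by
    have : 0 < (ε * w) * (ε * D.s₀ * z) := by
      rw [show (ε * w) * (ε * D.s₀ * z) = ε ^ 2 * (D.s₀ * z * w) by ring, hε2, one_mul]
      exact hzw
    exact pos_of_mul_pos_right this hεw.le
  obtain ⟨t, t0, t1, hz1, hw1⟩ := exists_param (z := ε * D.s₀ * z / D.l) (w := ε * w / D.m) hA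
    (div_pos hεz hl) (div_pos hεw hm) (by
      have e1 : (ε * D.s₀ * z / D.l) ^ 2 + 1 = (z ^ 2 + D.l ^ 2) / D.l ^ 2 := by
        rw [div_pow, mul_pow, mul_pow, hε2, D.s₀_sq]; field_simp
      have e2 : (ε * w / D.m) ^ 2 + 1 = (w ^ 2 + D.m ^ 2) / D.m ^ 2 := by
        rw [div_pow, mul_pow, hε2]; field_simp
      rw [e1, e2, div_mul_div_comm, E0']
      have e3 : ε * D.s₀ * z / D.l * (ε * w / D.m) = ε ^ 2 * (D.s₀ * z * w) / (D.l * D.m) := by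
        field_simp
      rw [e3, hε2]
      field_simp)
  have C := curve D t
  suffices H : ∃ κ : ℝ, (κ = 1 ∨ κ = -1) ∧ D.OnFlexion ε κ (sin t) (cos t)
      √(1 + D.A ^ 2 * sin t ^ 2) √(1 + D.A ^ 2 * cos t ^ 2) x by
    obtain ⟨κ, hκ, H⟩ := H
    exact ⟨ε, κ, t, hε, hκ, t0, t1, H⟩
  generalize √(1 + D.A ^ 2 * sin t ^ 2) = e at *
  generalize √(1 + D.A ^ 2 * cos t ^ 2) = d at *
  have h0 : sin (x 0) = ε * (D.s₀ * D.l * (D.A * sin t + e) * (D.A * cos t + d)) * cos (x 0) := by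
    rw [div_eq_iff hl.ne'] at hz1
    have : z = ε * D.s₀ * (ε * D.s₀ * z) := by
      linear_combination (-D.s₀ ^ 2 * z) * hε2 - z * D.s₀_sq
    rw [hz, this, hz1]; ring
  have h3 : sin (x 3) = ε * (D.m * (D.A * sin t + e) * (d - D.A * cos t)) * cos (x 3) := by
    rw [div_eq_iff hm.ne'] at hw1
    have : w = ε * (ε * w) := by linear_combination (-w) * hε2
    rw [hw, this, hw1]; ring
  have K0 : (ε * D.s₀ * D.l) ^ 2 = D.l ^ 2 := by rw [mul_pow, mul_pow, hε2, D.s₀_sq]; ring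
  have K3 : (ε * D.m) ^ 2 = D.m ^ 2 := by rw [mul_pow, hε2]; ring
  have K2 : (ε * (D.s₃ * D.n)) ^ 2 = D.n ^ 2 := by rw [mul_pow, mul_pow, hε2, D.s₃_sq]; ring
  have K1 : (ε * (D.o * (D.s₀ * D.s₁))) ^ 2 = D.o ^ 2 := by
    rw [mul_pow, mul_pow, mul_pow, hε2, D.s₀_sq, D.s₁_sq]; ring
  have M0 := affine_sub (K := ε * D.s₀ * D.l)
    (M := (D.A * sin t + e) * (D.A * cos t + d)) (by rw [h0]; ring) (z_inv C)
  have M3 := affine_sub (K := ε * D.m)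
    (M := (D.A * sin t + e) * (d - D.A * cos t)) (by rw [h3]; ring) (w_inv C)
  rw [F_sub_z, K0] at M0
  rw [F_sub_w, K3] at M3
  rw [neg_mul, ← sub_eq_add_neg, M0] at E1
  rw [neg_mul (D.m ^ 2), ← sub_eq_add_neg, M3] at E3
  -- Inserting `z - l²/z = 2 A ε s₀ l (s d + c e)` into the second condition and cancelling leaves a
  -- quadratic for `w₂`; `B2` is the analogous one for `u`.
  have B1 : (sin t * d + cos t * e) * (sin (x 1) ^ 2 + (ε * (D.o * (D.s₀ * D.s₁))) ^ 2 *
      cos (x 1) ^ 2) = (ε * (D.o * (D.s₀ * D.s₁))) * (2 * D.B) * (sin (x 1) * cos (x 1)) := by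
    rw [K1]
    apply mul_left_cancel₀ (mul_ne_zero hn0 (mul_pos hl hA).ne')
    linear_combination (ε * D.s₀ / 2) * E1 -
      (sin (x 0) * cos (x 0) * D.l * D.A * (sin t * d + cos t * e) *
        (sin (x 1) ^ 2 + D.o ^ 2 * cos (x 1) ^ 2)) * (D.s₀ ^ 2 * hε2 + D.s₀_sq)
  have B2 : (sin t * d - cos t * e) * (sin (x 2) ^ 2 + (ε * (D.s₃ * D.n)) ^ 2 *
      cos (x 2) ^ 2) = (ε * (D.s₃ * D.n)) * (2 * D.B) * (sin (x 2) * cos (x 2)) := by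
    rw [K2]
    apply mul_left_cancel₀ (mul_ne_zero hn3 (mul_pos hm hA).ne')
    linear_combination (ε / 2) * E3 -
      (sin (x 3) * cos (x 3) * D.m * D.A * (sin t * d - cos t * e) *
        (sin (x 2) ^ 2 + D.n ^ 2 * cos (x 2) ^ 2)) * hε2
  have hσ : (D.s₀ * D.s₁ * D.s₂ * D.s₃) ^ 2 = 1 := by
    rw [mul_pow, mul_pow, mul_pow, D.s₀_sq, D.s₁_sq, D.s₂_sq, D.s₃_sq]; norm_num
  have O1 : ∃ κ : ℝ, (κ = 1 ∨ κ = -1) ∧ OnBranch (ε * (D.o * (D.s₀ * D.s₁)))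
      (D.B + κ * (D.s₀ * D.s₁ * D.s₂ * D.s₃) * (sin t * e - cos t * d))
      (D.B - κ * (D.s₀ * D.s₁ * D.s₂ * D.s₃) * (sin t * e - cos t * d))
      (sin t * d + cos t * e) (x 1) := by
    rcases onBranch_or_onBranch C.mul_sub' (by ring) D.B_pos B1 with h | h <;>
      rcases sign_cases hσ with e1 | e1 <;> rw [e1]
    · exact ⟨1, by simp, by convert h using 1 <;> ring⟩
    · exact ⟨-1, by simp, by convert h using 1 <;> ring⟩
    · exact ⟨-1, by simp, by convert h using 1 <;> ring⟩
    · exact ⟨1, by simp, by convert h using 1 <;> ring⟩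
  have O2 : ∃ κ : ℝ, (κ = 1 ∨ κ = -1) ∧ OnBranch (ε * (D.s₃ * D.n))
      (D.B + κ * (sin t * e + cos t * d)) (D.B - κ * (sin t * e + cos t * d))
      (sin t * d - cos t * e) (x 2) := by
    rcases onBranch_or_onBranch C.mul_sub (by ring) D.B_pos B2 with h | h
    · exact ⟨1, by simp, by convert h using 1 <;> ring⟩
    · exact ⟨-1, by simp, by convert h using 1 <;> ring⟩
  obtain ⟨κ, hκ, O1⟩ := O1
  obtain ⟨κ', hκ', O2⟩ := O2
  -- The two branches come with separate signs. If one denominator vanishes, the other branch does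
  -- not see its sign, so a common one may be chosen; otherwise the third condition will force the
  -- signs to agree.
  by_cases hW : sin t * d - cos t * e = 0
  · refine ⟨κ', hκ', h0, h3, O2, ?_⟩
    rw [C.H'_eq_zero_of_W hW, mul_zero] at O1 ⊢
    exact O1
  by_cases hW' : sin t * d + cos t * e = 0
  · refine ⟨κ, hκ, h0, h3, ?_, O1⟩
    rw [C.H_eq_zero_of_W' hW', mul_zero] at O2 ⊢
    exact O2
  refine ⟨κ, hκ, h0, h3, ?_, O1⟩
  suffices κ' = κ by rwa [← this]
  have M1 := O1.sub
  have M2 := O2.sub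
  rw [K1] at M1
  rw [K2] at M2
  have hp : ∀ {k X Y W y : ℝ}, k ≠ 0 → X * Y = W ^ 2 → W ≠ 0 → OnBranch k X Y W y →
      sin y * cos y ≠ 0 := by
    intro k X Y W y hk hXY hW h
    have hX : X ≠ 0 := by
      rintro rfl
      rw [zero_mul, eq_comm] at hXY
      exact hW (pow_eq_zero_iff two_ne_zero |>.1 hXY)
    have hy := sin_sq_add_cos_sq y
    intro h0
    rcases mul_eq_zero.1 h0 with h0 | h0
    · have := h.1
      rw [h0, mul_zero, eq_comm] at this
      have := (mul_eq_zero.1 this).resolve_left (mul_ne_zero hk hX)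
      rw [h0, this] at hy; norm_num at hy
    · have := h.1
      rw [h0, mul_zero] at this
      have := (mul_eq_zero.1 this).resolve_left hW
      rw [h0, this] at hy; norm_num at hy
  have hεne : ε ≠ 0 := by rintro rfl; simp at hε2
  have hs0 : D.s₀ ≠ 0 := by intro e; simpa [e] using D.s₀_sq
  have hs1 : D.s₁ ≠ 0 := by intro e; simpa [e] using D.s₁_sq
  have hs2 : D.s₂ ≠ 0 := by intro e; simpa [e] using D.s₂_sq
  have hs3 : D.s₃ ≠ 0 := by intro e; simpa [e] using D.s₃_sq
  have hκ2 : κ ^ 2 = 1 := sq_eq_one_iff.2 hκ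
  have hp2 := hp (mul_ne_zero hεne (mul_ne_zero hs3 D.n_pos.ne')) (by
    rw [← C.mul_sub]; linear_combination (-(sin t * e + cos t * d) ^ 2) * sq_eq_one_iff.2 hκ') hW O2
  have hp1 := hp (mul_ne_zero hεne (mul_ne_zero D.o_pos.ne' (mul_ne_zero hs0 hs1))) (by
    rw [← C.mul_sub']
    linear_combination (-(sin t * e - cos t * d) ^ 2) * (κ ^ 2 * hσ + hκ2)) hW' O1
  rw [neg_mul, ← sub_eq_add_neg, neg_mul, ← sub_eq_add_neg] at E2
  have e1 := congrArg₂ (· * ·) M2 M1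
  have e2 : ε ^ 2 * (D.s₀ ^ 2 * D.s₁ ^ 2 * D.s₃ ^ 2) * (κ * κ') * D.s₂ * (D.n * D.o) * 4 *
      (sin (x 2) * cos (x 2) * (sin (x 1) * cos (x 1))) *
      ((sin t * e + cos t * d) * (sin t * e - cos t * d)) =
      (sin t * d - cos t * e) * (sin t * d + cos t * e) * (D.s₂ * (4 * (D.A ^ 2 + 1) *
        (D.n * D.o)) * (sin (x 2) * cos (x 2) * (sin (x 1) * cos (x 1)))) := by
    rw [← E2]
    linear_combination -e1
  have hWW := mul_ne_zero hW hW'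
  rw [C.WW] at hWW
  rw [hε2, D.s₀_sq, D.s₁_sq, D.s₃_sq, C.HH, C.WW] at e2
  -- The product of the two branches carries the factor `κ κ'`, while the third condition demands
  -- the factor `1`; everything else is nonzero and cancels.
  have e3 : κ * κ' = 1 := by
    have : (D.s₂ * (D.n * D.o) * 4 * (sin (x 2) * cos (x 2) * (sin (x 1) * cos (x 1))) *
        ((D.A ^ 2 + 1) * (sin t ^ 2 - cos t ^ 2))) ≠ 0 := by
      have := D.n_pos
      have := D.o_pos
      have : 0 < D.A ^ 2 + 1 := by positivity
      exact mul_ne_zero (mul_ne_zero (mul_ne_zero (mul_ne_zero hs2 (by positivity)) four_ne_zero)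
        (mul_ne_zero hp2 hp1)) (mul_ne_zero this.ne' hWW)
    apply mul_left_cancel₀ this
    linear_combination e2
  linear_combination κ * e3 - κ' * hκ2

end FlexData

/-! ### Reduction of admissible angles to the normal form -/

theorem eq_sign_mul {a b : ℝ} (hb : 0 ≤ b) (h : a ^ 2 = b ^ 2) : a = Real.sign a * b := by
  rw [← abs_of_nonneg hb, ← (sq_eq_sq_iff_abs_eq_abs _ _).1 h]
  rcases lt_trichotomy a 0 with ha | ha | ha
  · rw [Real.sign_of_neg ha, abs_of_neg ha]; ring
  · simp [ha]
  · rw [Real.sign_of_pos ha, abs_of_pos ha, one_mul]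

theorem sign_sq {a : ℝ} (h : a ≠ 0) : Real.sign a ^ 2 = 1 := by
  rcases Real.sign_apply_eq_of_ne_zero a h with e | e <;> rw [e] <;> norm_num

theorem sign_mul (a b : ℝ) : Real.sign (a * b) = Real.sign a * Real.sign b := by
  rcases lt_trichotomy a 0 with ha | ha | ha <;> rcases lt_trichotomy b 0 with hb | hb | hb
  · rw [Real.sign_of_neg ha, Real.sign_of_neg hb, Real.sign_of_pos (mul_pos_of_neg_of_neg ha hb)]
    norm_num
  · simp [hb]
  · rw [Real.sign_of_neg ha, Real.sign_of_pos hb, Real.sign_of_neg (mul_neg_of_neg_of_pos ha hb)]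
    norm_num
  · simp [ha]
  · simp [ha]
  · simp [ha]
  · rw [Real.sign_of_pos ha, Real.sign_of_neg hb, Real.sign_of_neg (mul_neg_of_pos_of_neg ha hb)]
    norm_num
  · simp [hb]
  · rw [Real.sign_of_pos ha, Real.sign_of_pos hb, Real.sign_of_pos (mul_pos ha hb)]
    norm_num

namespace PlanarAngles.Admissible
variable {Θ : PlanarAngles}

theorem zeta_sq (hs : Θ.SignPattern) :
    16 * zeta Θ ^ 2 = Θ.nu 0 ^ 2 / (Θ.lam 0 * Θ.mu 0) := by
  have := mul_pos hs.1.1 hs.1.2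
  rw [zeta, div_pow, sq_abs, mul_pow, sq_sqrt this.le]
  field_simp
  ring

/-- By the sign pattern the second summand of `nu_sum` is negative, so the first one, `16 ζ²`,
exceeds `16`. -/
theorem one_lt_zeta (h : Θ.Admissible) (hs : Θ.SignPattern) : 1 < zeta Θ := by
  have h1 := zeta_sq hs
  have h2 := h.nu_sum
  have h3 : Θ.nu 1 ^ 2 / (Θ.lam 1 * Θ.mu 1) < 0 :=
    div_neg_of_pos_of_neg (pow_two_pos_of_ne_zero (h.nu_ne_zero 1))
      (mul_neg_of_neg_of_pos hs.2.1.1 hs.2.1.2)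
  have h4 : 0 ≤ zeta Θ := div_nonneg (abs_nonneg _) (by positivity)
  nlinarith

/-- The normal form of admissible angles with the right sign pattern. -/
def flexData (h : Θ.Admissible) (hs : Θ.SignPattern) : FlexData where
  l := √(Θ.lam 0)
  m := √(Θ.mu 0)
  n := √(-Θ.lam 2)
  o := √(-Θ.mu 2)
  s₀ := Real.sign (Θ.nu 0)
  s₁ := Real.sign (Θ.nu 1)
  s₂ := Real.sign (Θ.nu 2)
  s₃ := Real.sign (Θ.nu 3)
  A := √(zeta Θ - 1)
  B := √(zeta Θ + 1)
  l_pos := sqrt_pos.2 hs.1.1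
  m_pos := sqrt_pos.2 hs.1.2
  n_pos := sqrt_pos.2 (by linarith [hs.2.2.1.1])
  o_pos := sqrt_pos.2 (by linarith [hs.2.2.1.2])
  s₀_sq := sign_sq (h.nu_ne_zero 0)
  s₁_sq := sign_sq (h.nu_ne_zero 1)
  s₂_sq := sign_sq (h.nu_ne_zero 2)
  s₃_sq := sign_sq (h.nu_ne_zero 3)
  A_pos := sqrt_pos.2 (by linarith [h.one_lt_zeta hs])
  B_pos := sqrt_pos.2 (by linarith [h.one_lt_zeta hs])
  B_sq := by
    have := h.one_lt_zeta hs
    rw [sq_sqrt (by linarith), sq_sqrt (by linarith)]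
    ring

variable (h : Θ.Admissible) (hs : Θ.SignPattern)

theorem A_sq : (h.flexData hs).A ^ 2 = zeta Θ - 1 := by
  have := h.one_lt_zeta hs
  exact sq_sqrt (by linarith)

/-- The OAI relations leave four independent factors and give `ν² = 16 ζ² λμ` at the first and third
vertices, `ν² = 16 (1 - ζ²) λμ` at the others. With `A B = √(ζ² - 1)`, each `ν` is known up to sign.
-/
theorem closes_iff_eqs (x : Fin 4 → ℝ) :
    Closes Θ (fun i => ((2 * x i : ℝ) : Real.Angle)) ↔ (h.flexData hs).Eqs x := by
  have hζ := h.one_lt_zeta hs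
  have hζ2 := zeta_sq hs
  have hA := h.A_sq hs
  have hB := (h.flexData hs).B_sq
  have l2 : (h.flexData hs).l ^ 2 = Θ.lam 0 := sq_sqrt hs.1.1.le
  have m2 : (h.flexData hs).m ^ 2 = Θ.mu 0 := sq_sqrt hs.1.2.le
  have n2 : (h.flexData hs).n ^ 2 = -Θ.lam 2 := sq_sqrt (by linarith [hs.2.2.1.1])
  have o2 : (h.flexData hs).o ^ 2 = -Θ.mu 2 := sq_sqrt (by linarith [hs.2.2.1.2])
  have p1 := (h.flexData hs).l_pos
  have p2 := (h.flexData hs).m_pos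
  have p3 := (h.flexData hs).n_pos
  have p4 := (h.flexData hs).o_pos
  have p5 := (h.flexData hs).A_pos
  have p6 := (h.flexData hs).B_pos
  have e1 := h.lam_zero_one
  have e2 := h.mu_zero_three
  have e3 := h.mu_one_two
  have e4 := h.lam_two_three
  have f2 := h.nu_zero_two
  have f3 := h.nu_one_three
  have f1 := h.nu_sum
  rw [← hζ2] at f1 f2
  have L1 : Θ.lam 1 = -(h.flexData hs).l ^ 2 := by linarith
  have M1 : Θ.mu 1 = (h.flexData hs).o ^ 2 := by linarith
  have L2 : Θ.lam 2 = -(h.flexData hs).n ^ 2 := by linarith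
  have M2 : Θ.mu 2 = -(h.flexData hs).o ^ 2 := by linarith
  have L3 : Θ.lam 3 = (h.flexData hs).n ^ 2 := by linarith
  have M3 : Θ.mu 3 = -(h.flexData hs).m ^ 2 := by linarith
  have f4 : Θ.nu 1 ^ 2 / (Θ.lam 1 * Θ.mu 1) = 16 - 16 * zeta Θ ^ 2 := by linarith
  rw [f4] at f3
  rw [L1, M1] at f4
  rw [L2, M2] at f2
  rw [L3, M3] at f3
  rw [← l2, ← m2] at hζ2
  have N0 : Θ.nu 0 = (h.flexData hs).s₀ *
      (4 * ((h.flexData hs).A ^ 2 + 1) * ((h.flexData hs).l * (h.flexData hs).m)) := by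
    refine eq_sign_mul (by positivity) ?_
    rw [hA]
    field_simp at hζ2
    linear_combination -hζ2
  have N1 : Θ.nu 1 = (h.flexData hs).s₁ *
      (4 * ((h.flexData hs).A * (h.flexData hs).B) * ((h.flexData hs).l * (h.flexData hs).o)) := by
    refine eq_sign_mul (by positivity) ?_
    rw [mul_pow, mul_pow 4, mul_pow, mul_pow, hB, hA]
    field_simp at f4
    linear_combination -f4
  have N2 : Θ.nu 2 = (h.flexData hs).s₂ *
      (4 * ((h.flexData hs).A ^ 2 + 1) * ((h.flexData hs).n * (h.flexData hs).o)) := by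
    refine eq_sign_mul (by positivity) ?_
    rw [hA]
    field_simp at f2
    linear_combination -f2
  have N3 : Θ.nu 3 = (h.flexData hs).s₃ *
      (4 * ((h.flexData hs).A * (h.flexData hs).B) * ((h.flexData hs).n * (h.flexData hs).m)) := by
    refine eq_sign_mul (by positivity) ?_
    rw [mul_pow, mul_pow 4, mul_pow, mul_pow, hB, hA]
    field_simp at f3
    linear_combination f3
  rw [h.closes_iff, ← l2, ← m2, L1, M1, L2, M2, L3, M3, N0, N1, N2, N3]
  rfl

theorem fnF_eq (t : ℝ) : fnF (zeta Θ) t = (h.flexData hs).A * sin t +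
    √(1 + (h.flexData hs).A ^ 2 * sin t ^ 2) := by
  rw [fnF, h.A_sq hs, mul_comm (sin t)]; rfl

theorem fnG_eq (t : ℝ) : fnG (zeta Θ) t = sin t * √(1 + (h.flexData hs).A ^ 2 * sin t ^ 2) := by
  rw [fnG, h.A_sq hs]

theorem fnV_eq (t : ℝ) : fnV (zeta Θ) t = sin t * √(1 + (h.flexData hs).A ^ 2 * cos t ^ 2) := by
  rw [fnV, h.A_sq hs]

end PlanarAngles.Admissible

namespace FlexData

/-- The angles of the flexion. -/
def angles (D : FlexData) (ε κ t : ℝ) : Fin 4 → Real.Angle :=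
  let s := sin t
  let c := cos t
  let e := √(1 + D.A ^ 2 * s ^ 2)
  let d := √(1 + D.A ^ 2 * c ^ 2)
  fun j => twoArctan (![
    ((ε * (D.s₀ * D.l * (D.A * s + e) * (D.A * c + d)) : ℝ) : OnePoint ℝ),
    ((ε * (D.m * (D.A * s + e) * (d - D.A * c)) : ℝ) : OnePoint ℝ),
    ratio (ε * (D.s₃ * D.n) * (D.B + κ * (s * e + c * d))) (s * d - c * e),
    ratio (ε * (D.o * (D.s₀ * D.s₁)) * (D.B + κ * (D.s₀ * D.s₁ * D.s₂ * D.s₃) * (s * e - c * d)))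
      (s * d + c * e)] j)

variable {D : FlexData}

theorem s_ne_zero (D : FlexData) : D.s₀ ≠ 0 ∧ D.s₁ ≠ 0 ∧ D.s₂ ≠ 0 ∧ D.s₃ ≠ 0 := by
  refine ⟨?_, ?_, ?_, ?_⟩ <;> intro e
  · simpa [e] using D.s₀_sq
  · simpa [e] using D.s₁_sq
  · simpa [e] using D.s₂_sq
  · simpa [e] using D.s₃_sq

theorem mul_sub_sign (D : FlexData) {κ : ℝ} (hκ : κ ^ 2 = 1) (t : ℝ) :
    (D.B + κ * (sin t * √(1 + D.A ^ 2 * sin t ^ 2) + cos t * √(1 + D.A ^ 2 * cos t ^ 2))) *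
    (D.B - κ * (sin t * √(1 + D.A ^ 2 * sin t ^ 2) + cos t * √(1 + D.A ^ 2 * cos t ^ 2))) =
    (sin t * √(1 + D.A ^ 2 * cos t ^ 2) - cos t * √(1 + D.A ^ 2 * sin t ^ 2)) ^ 2 := by
  rw [← (curve D t).mul_sub]
  linear_combination (-(sin t * √(1 + D.A ^ 2 * sin t ^ 2) +
    cos t * √(1 + D.A ^ 2 * cos t ^ 2)) ^ 2) * hκ

theorem mul_sub_sign' (D : FlexData) {κ : ℝ} (hκ : κ ^ 2 = 1) (t : ℝ) :
    (D.B + κ * (D.s₀ * D.s₁ * D.s₂ * D.s₃) * (sin t * √(1 + D.A ^ 2 * sin t ^ 2) -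
      cos t * √(1 + D.A ^ 2 * cos t ^ 2))) *
    (D.B - κ * (D.s₀ * D.s₁ * D.s₂ * D.s₃) * (sin t * √(1 + D.A ^ 2 * sin t ^ 2) -
      cos t * √(1 + D.A ^ 2 * cos t ^ 2))) =
    (sin t * √(1 + D.A ^ 2 * cos t ^ 2) + cos t * √(1 + D.A ^ 2 * sin t ^ 2)) ^ 2 := by
  have hσ : (κ * (D.s₀ * D.s₁ * D.s₂ * D.s₃)) ^ 2 = 1 := by
    rw [mul_pow, mul_pow, mul_pow, mul_pow, D.s₀_sq, D.s₁_sq, D.s₂_sq, D.s₃_sq, hκ]; norm_num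
  rw [← (curve D t).mul_sub']
  linear_combination (-(sin t * √(1 + D.A ^ 2 * sin t ^ 2) -
    cos t * √(1 + D.A ^ 2 * cos t ^ 2)) ^ 2) * hσ

theorem coe_eq_angles_two_iff {ε κ : ℝ} (hε : ε ≠ 0) (hκ : κ ^ 2 = 1) {t x : ℝ} :
    ((2 * x : ℝ) : Real.Angle) = D.angles ε κ t 2 ↔ OnBranch (ε * (D.s₃ * D.n))
      (D.B + κ * (sin t * √(1 + D.A ^ 2 * sin t ^ 2) + cos t * √(1 + D.A ^ 2 * cos t ^ 2)))
      (D.B - κ * (sin t * √(1 + D.A ^ 2 * sin t ^ 2) + cos t * √(1 + D.A ^ 2 * cos t ^ 2)))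
      (sin t * √(1 + D.A ^ 2 * cos t ^ 2) - cos t * √(1 + D.A ^ 2 * sin t ^ 2)) x :=
  twoArctan_ratio_iff (mul_ne_zero hε (mul_ne_zero D.s_ne_zero.2.2.2 D.n_pos.ne'))
    (D.mul_sub_sign hκ t) (by linarith [D.B_pos])

theorem coe_eq_angles_three_iff {ε κ : ℝ} (hε : ε ≠ 0) (hκ : κ ^ 2 = 1) {t x : ℝ} :
    ((2 * x : ℝ) : Real.Angle) = D.angles ε κ t 3 ↔ OnBranch (ε * (D.o * (D.s₀ * D.s₁)))
      (D.B + κ * (D.s₀ * D.s₁ * D.s₂ * D.s₃) * (sin t * √(1 + D.A ^ 2 * sin t ^ 2) -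
        cos t * √(1 + D.A ^ 2 * cos t ^ 2)))
      (D.B - κ * (D.s₀ * D.s₁ * D.s₂ * D.s₃) * (sin t * √(1 + D.A ^ 2 * sin t ^ 2) -
        cos t * √(1 + D.A ^ 2 * cos t ^ 2)))
      (sin t * √(1 + D.A ^ 2 * cos t ^ 2) + cos t * √(1 + D.A ^ 2 * sin t ^ 2)) x :=
  twoArctan_ratio_iff (mul_ne_zero hε (mul_ne_zero D.o_pos.ne'
    (mul_ne_zero D.s_ne_zero.1 D.s_ne_zero.2.1))) (D.mul_sub_sign' hκ t) (by linarith [D.B_pos])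

theorem onFlexion_iff {ε κ : ℝ} (hε : ε ≠ 0) (hκ : κ ^ 2 = 1) {t : ℝ} {x : Fin 4 → ℝ} :
    D.OnFlexion ε κ (sin t) (cos t) √(1 + D.A ^ 2 * sin t ^ 2) √(1 + D.A ^ 2 * cos t ^ 2) x ↔
      ((2 * x 0 : ℝ) : Real.Angle) = D.angles ε κ t 0 ∧
      ((2 * x 3 : ℝ) : Real.Angle) = D.angles ε κ t 1 ∧
      ((2 * x 2 : ℝ) : Real.Angle) = D.angles ε κ t 2 ∧
      ((2 * x 1 : ℝ) : Real.Angle) = D.angles ε κ t 3 := by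
  rw [coe_eq_angles_two_iff hε hκ, coe_eq_angles_three_iff hε hκ]
  exact and_congr twoArctan_coe_iff.symm (and_congr twoArctan_coe_iff.symm Iff.rfl)

end FlexData

theorem PlanarAngles.Admissible.flexionAngles_eq {Θ : PlanarAngles} (h : Θ.Admissible)
    (hs : Θ.SignPattern) (ε κ t : ℝ) : flexionAngles Θ ε κ t = (h.flexData hs).angles ε κ t := by
  have s1 := sin_add_pi_div_two t
  have s2 := sin_sub_pi_div_two t
  have c1 := cos_add_pi_div_two t
  have c2 := cos_sub_pi_div_two t
  funext j
  unfold flexionAngles FlexData.angles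
  congr 1
  fin_cases j
  · change ((_ : ℝ) : OnePoint ℝ) = ((_ : ℝ) : OnePoint ℝ)
    rw [h.fnF_eq hs, h.fnF_eq hs, s1]
    rfl
  · change ((_ : ℝ) : OnePoint ℝ) = ((_ : ℝ) : OnePoint ℝ)
    rw [h.fnF_eq hs, h.fnF_eq hs, s2]
    congr 1
    rw [neg_sq]
    change ε * ((h.flexData hs).m * _ * _) = _
    ring
  · change ratio _ _ = ratio _ _
    rw [h.fnG_eq hs, h.fnG_eq hs, h.fnV_eq hs, h.fnV_eq hs, s1, c1, neg_sq]
    congr 1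
    change ε * ((h.flexData hs).s₃ * (h.flexData hs).n * ((h.flexData hs).B + _)) = _
    ring
  · change ratio _ _ = ratio _ _
    rw [h.fnG_eq hs, h.fnG_eq hs, h.fnV_eq hs, h.fnV_eq hs, s2, c2, neg_sq, sign_mul, sign_mul]
    congr 1
    -- Here `s₀ s₁ B + κ s₂ s₃ H = s₀ s₁ (B + κ s₀ s₁ s₂ s₃ H)`, because the signs square to `1`.
    · change ε * ((h.flexData hs).o * ((h.flexData hs).s₀ * (h.flexData hs).s₁ *
        (h.flexData hs).B + κ * ((h.flexData hs).s₂ * (h.flexData hs).s₃) * _)) = _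
      have e0 := (h.flexData hs).s₀_sq
      have e1 := (h.flexData hs).s₁_sq
      generalize √(1 + (h.flexData hs).A ^ 2 * sin t ^ 2) = e
      generalize √(1 + (h.flexData hs).A ^ 2 * cos t ^ 2) = d
      linear_combination (-ε * (h.flexData hs).o * κ * ((h.flexData hs).s₂ * (h.flexData hs).s₃) *
        (sin t * e - cos t * d)) * ((h.flexData hs).s₁ ^ 2 * e0 + e1)
    · ring

/-! ### Continuity and non-constancy of the angles -/

theorem cos_twoArctan (v : ℝ) : (twoArctan (v : OnePoint ℝ)).cos = (1 - v ^ 2) / (1 + v ^ 2) := by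
  change Real.Angle.cos ((2 * arctan v : ℝ) : Real.Angle) = _
  have : 0 < 1 + v ^ 2 := by positivity
  rw [Real.Angle.cos_coe, cos_two_mul, cos_sq_arctan]
  field_simp
  ring

theorem sin_twoArctan (v : ℝ) : (twoArctan (v : OnePoint ℝ)).sin = 2 * v / (1 + v ^ 2) := by
  change Real.Angle.sin ((2 * arctan v : ℝ) : Real.Angle) = _
  rw [Real.Angle.sin_coe, sin_two_mul, sin_arctan_eq, show 2 * (v * cos (arctan v)) *
    cos (arctan v) = 2 * v * cos (arctan v) ^ 2 by ring, cos_sq_arctan]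
  ring

theorem sq_eq_sq_of_cos_twoArctan_eq {v w : ℝ}
    (h : (twoArctan (v : OnePoint ℝ)).cos = (twoArctan (w : OnePoint ℝ)).cos) : v ^ 2 = w ^ 2 := by
  rw [cos_twoArctan, cos_twoArctan, div_eq_div_iff (by positivity) (by positivity)] at h
  linarith

theorem OnBranch.cos_eq {k X Y W x : ℝ} (h : OnBranch k X Y W x) (hpos : 0 < Y + k ^ 2 * X) :
    cos (2 * x) = (Y - k ^ 2 * X) / (Y + k ^ 2 * X) := by
  obtain ⟨h1, h2⟩ := h
  rw [eq_div_iff hpos.ne', cos_two_mul']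
  linear_combination -2 * sin x * h2 - 2 * k * cos x * h1 +
    (Y - k ^ 2 * X) * sin_sq_add_cos_sq x

theorem OnBranch.sin_eq {k X Y W x : ℝ} (h : OnBranch k X Y W x) (hpos : 0 < Y + k ^ 2 * X) :
    sin (2 * x) = 2 * k * W / (Y + k ^ 2 * X) := by
  obtain ⟨h1, h2⟩ := h
  rw [eq_div_iff hpos.ne', sin_two_mul]
  linear_combination 2 * cos x * h2 - 2 * k * sin x * h1 + 2 * k * W * sin_sq_add_cos_sq x

theorem add_sq_mul_pos {k X Y W : ℝ} (hk : k ≠ 0) (h : X * Y = W ^ 2) (hXY : 0 < X + Y) :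
    0 < Y + k ^ 2 * X := by
  have h0 : 0 ≤ X * Y := h ▸ sq_nonneg W
  have hk : 0 < k ^ 2 := by positivity
  rcases mul_nonneg_iff.1 h0 with ⟨h1, h2⟩ | ⟨h1, h2⟩
  · rcases h1.eq_or_lt with h1 | h1
    · subst h1; linarith
    · positivity
  · linarith

/-- Continuity of a family of angles, expressed by the sine and cosine. -/
def TrigContinuous (f : ℝ → Real.Angle) : Prop :=
  (Continuous fun t => (f t).cos) ∧ Continuous fun t => (f t).sin

theorem trigContinuous_twoArctan {v : ℝ → ℝ} (hv : Continuous v) :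
    TrigContinuous fun t => twoArctan (v t : OnePoint ℝ) := by
  have h : ∀ t, 1 + v t ^ 2 ≠ 0 := fun t => by positivity
  constructor
  · simp only [cos_twoArctan]
    exact Continuous.div (by fun_prop) (by fun_prop) h
  · simp only [sin_twoArctan]
    exact Continuous.div (by fun_prop) (by fun_prop) h

/-- On a branch `tan² x = k² X / Y`, so sine and cosine of `2x` are fractions with the positive
denominator `Y + k² X`. They stay continuous where `W = 0`, that is, through the values `0` and `∞`.
-/
theorem trigContinuous_of_onBranch {k : ℝ} {X Y W : ℝ → ℝ} {f : ℝ → Real.Angle}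
    (hX : Continuous X) (hY : Continuous Y) (hW : Continuous W) (hk : k ≠ 0)
    (h : ∀ t, X t * Y t = W t ^ 2) (hXY : ∀ t, 0 < X t + Y t)
    (hf : ∀ t x, ((2 * x : ℝ) : Real.Angle) = f t → OnBranch k (X t) (Y t) (W t) x) :
    TrigContinuous f := by
  have hpos := fun t => add_sq_mul_pos hk (h t) (hXY t)
  have hc : (fun t => (f t).cos) = fun t => (Y t - k ^ 2 * X t) / (Y t + k ^ 2 * X t) := by
    funext t
    obtain ⟨x, hx⟩ := exists_two_mul_coe (f t)
    rw [← (hf t x hx.symm).cos_eq (hpos t), hx, Real.Angle.cos_coe]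
  have hs : (fun t => (f t).sin) = fun t => 2 * k * W t / (Y t + k ^ 2 * X t) := by
    funext t
    obtain ⟨x, hx⟩ := exists_two_mul_coe (f t)
    rw [← (hf t x hx.symm).sin_eq (hpos t), hx, Real.Angle.sin_coe]
  constructor
  · rw [hc]
    exact Continuous.div (by fun_prop) (by fun_prop) fun t => (hpos t).ne'
  · rw [hs]
    exact Continuous.div (by fun_prop) (by fun_prop) fun t => (hpos t).ne'

namespace FlexData
variable (D : FlexData)

theorem trigContinuous_angles {ε κ : ℝ} (hε : ε ≠ 0) (hκ : κ ^ 2 = 1) (j : Fin 4) :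
    TrigContinuous fun t => D.angles ε κ t j := by
  have he : Continuous fun t => √(1 + D.A ^ 2 * sin t ^ 2) := by fun_prop
  have hd : Continuous fun t => √(1 + D.A ^ 2 * cos t ^ 2) := by fun_prop
  have hB := D.B_pos
  obtain ⟨n0, n1, n2, n3⟩ := D.s_ne_zero
  fin_cases j
  · exact trigContinuous_twoArctan (by fun_prop)
  · exact trigContinuous_twoArctan (by fun_prop)
  · exact trigContinuous_of_onBranch (by fun_prop) (by fun_prop) (by fun_prop)
      (mul_ne_zero hε (mul_ne_zero n3 D.n_pos.ne')) (D.mul_sub_sign hκ)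
      (fun t => by linarith) fun t x hx => (coe_eq_angles_two_iff hε hκ).1 hx
  · exact trigContinuous_of_onBranch (by fun_prop) (by fun_prop) (by fun_prop)
      (mul_ne_zero hε (mul_ne_zero D.o_pos.ne' (mul_ne_zero n0 n1))) (D.mul_sub_sign' hκ)
      (fun t => by linarith) fun t x hx => (coe_eq_angles_three_iff hε hκ).1 hx

theorem one_lt_add_sqrt {a : ℝ} (ha : 0 < a) : 1 < a + √(1 + a ^ 2) := by
  have : 1 ≤ √(1 + a ^ 2) := by rw [one_le_sqrt]; nlinarith [sq_nonneg a]
  linarith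

theorem add_sqrt_mul (a : ℝ) : (a + √(1 + a ^ 2)) * (-a + √(1 + a ^ 2)) = 1 := by
  have : √(1 + a ^ 2) ^ 2 = 1 + a ^ 2 := sq_sqrt (by positivity)
  linear_combination this

/-- The two brackets are reciprocal and the first exceeds `1`; equality of the squares would make
its eighth power `1`. -/
theorem sq_ne_sq_of_add_sqrt {a k v w : ℝ} (ha : 0 < a) (hk : k ≠ 0)
    (hv : v = k * (a + √(1 + a ^ 2)) ^ 2) (hw : w = k * (-a + √(1 + a ^ 2)) ^ 2) :
    v ^ 2 ≠ w ^ 2 := by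
  intro e
  have h1 := one_lt_add_sqrt ha
  have h2 := add_sqrt_mul a
  set F := a + √(1 + a ^ 2)
  set F' := -a + √(1 + a ^ 2)
  rw [hv, hw, mul_pow, mul_pow, ← pow_mul, ← pow_mul] at e
  have e := mul_left_cancel₀ (pow_ne_zero 2 hk) e
  have h3 : F ^ 8 = 1 := by
    have h4 : (F * F') ^ 4 = 1 := by rw [h2, one_pow]
    linear_combination F ^ 4 * e + h4
  have := one_lt_pow₀ h1 (n := 8) (by norm_num)
  linarith

/-- The angles at the first edge take two values with different cosines. -/
theorem cos_angles_zero_ne {ε : ℝ} (hε : ε ≠ 0) (κ : ℝ) :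
    (D.angles ε κ (π / 4) 0).cos ≠ (D.angles ε κ (π / 4 + π) 0).cos := by
  intro h
  refine sq_ne_sq_of_add_sqrt (a := D.A * (√2 / 2)) (k := ε * (D.s₀ * D.l))
    (mul_pos D.A_pos (by positivity))
    (mul_ne_zero hε (mul_ne_zero D.s_ne_zero.1 D.l_pos.ne')) ?_ ?_
    (sq_eq_sq_of_cos_twoArctan_eq h)
  · rw [sin_pi_div_four, cos_pi_div_four]; ring_nf
  · rw [sin_add_pi, cos_add_pi, sin_pi_div_four, cos_pi_div_four, neg_sq]; ring_nf

theorem cos_angles_one_ne {ε : ℝ} (hε : ε ≠ 0) (κ : ℝ) :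
    (D.angles ε κ (-(π / 4) + π) 1).cos ≠ (D.angles ε κ (-(π / 4)) 1).cos := by
  intro h
  refine sq_ne_sq_of_add_sqrt (a := D.A * (√2 / 2)) (k := ε * D.m)
    (mul_pos D.A_pos (by positivity)) (mul_ne_zero hε D.m_pos.ne') ?_ ?_
    (sq_eq_sq_of_cos_twoArctan_eq h)
  · rw [sin_add_pi, cos_add_pi, sin_neg, cos_neg, sin_pi_div_four, cos_pi_div_four, neg_neg,
      neg_sq]
    ring_nf
  · rw [sin_neg, cos_neg, sin_pi_div_four, cos_pi_div_four, neg_sq]; ring_nf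

/-- A zero denominator puts the half-tangent at `0` or `∞`, a nonzero one never does. So `u` and
`w₂` vary between `t = ±π/4` and `t = 0`. -/
theorem OnBranch.not_zero_and {k X Y X' Y' W x : ℝ} (h : OnBranch k X Y 0 x)
    (h' : OnBranch k X' Y' W x) (hk : k ≠ 0) (hW : W ≠ 0) (hXY : 0 < X + Y) : False := by
  have h1 := h.mul_eq_zero hk hXY
  have h2 := h'.add
  rw [h1, mul_zero] at h2
  have h3 := (mul_eq_zero.1 h2).resolve_left hW
  have h4 : 0 < k ^ 2 := by positivity
  nlinarith [sin_sq_add_cos_sq x, sq_nonneg (sin x), sq_nonneg (cos x),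
    mul_nonneg h4.le (sq_nonneg (cos x))]

theorem angles_not_constant {ε κ : ℝ} (hε : ε ≠ 0) (hκ : κ ^ 2 = 1) (j : Fin 4) :
    ∃ t t', D.angles ε κ t j ≠ D.angles ε κ t' j := by
  have hB := D.B_pos
  obtain ⟨n0, n1, n2, n3⟩ := D.s_ne_zero
  fin_cases j
  · exact ⟨_, _, fun h => D.cos_angles_zero_ne hε κ (congrArg _ h)⟩
  · exact ⟨_, _, fun h => D.cos_angles_one_ne hε κ (congrArg _ h)⟩
  · refine ⟨π / 4, 0, fun h => ?_⟩
    obtain ⟨x, hx⟩ := exists_two_mul_coe (D.angles ε κ (π / 4) 2)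
    have h1 := (coe_eq_angles_two_iff hε hκ).1 hx.symm
    have h2 := (coe_eq_angles_two_iff hε hκ).1 (hx.symm.trans h)
    rw [sin_pi_div_four, cos_pi_div_four, sub_self] at h1
    exact OnBranch.not_zero_and h1 h2 (mul_ne_zero hε (mul_ne_zero n3 D.n_pos.ne')) (by simp)
      (by linarith)
  · refine ⟨-(π / 4), 0, fun h => ?_⟩
    obtain ⟨x, hx⟩ := exists_two_mul_coe (D.angles ε κ (-(π / 4)) 3)
    have h1 := (coe_eq_angles_three_iff hε hκ).1 hx.symm
    have h2 := (coe_eq_angles_three_iff hε hκ).1 (hx.symm.trans h)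
    rw [sin_neg, cos_neg, sin_pi_div_four, cos_pi_div_four, neg_sq, neg_mul (√2 / 2) √_,
      neg_add_cancel] at h1
    exact OnBranch.not_zero_and h1 h2 (mul_ne_zero hε (mul_ne_zero D.o_pos.ne'
      (mul_ne_zero n0 n1))) (by simp) (by linarith)

end FlexData

/-! ### The flexion of surfaces with the prescribed sign pattern -/

theorem continuous_fold {f : ℝ → Real.Angle} (hf : TrigContinuous f) (p u : ℂ) (a h : ℝ) :
    Continuous fun t => fold p u (f t) a h := by
  have h1 := hf.1
  have h2 := hf.2
  refine (PiLp.continuous_toLp 2 _).comp (continuous_pi fun j => ?_)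
  fin_cases j
  · simp [Complex.mul_re]; fun_prop
  · simp [Complex.mul_im]; fun_prop
  · simp; fun_prop

theorem continuousFamily_foldedSurface (Θ : PlanarAngles) (P : Fin 4 → ℂ) (R S : Fin 4 → ℝ)
    {φ : ℝ → Fin 4 → Real.Angle} (hφ : ∀ i, TrigContinuous fun t => φ t i) :
    Surface.ContinuousFamily fun t => foldedSurface Θ P R S (φ t) := by
  intro m i
  fin_cases m
  · exact continuous_const
  all_goals fin_cases i <;> exact continuous_fold (hφ _) _ _ _ _

theorem dist_emb_mul_fold_sq {u : ℂ} (hu : ‖u‖ = 1) (p : ℂ) (φ : Real.Angle) (a h : ℝ) (w : ℂ) :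
    dist (emb (p + u * w)) (fold p u φ a h) ^ 2 =
      (a - w.re) ^ 2 + w.im ^ 2 + h ^ 2 + 2 * h * w.im * φ.cos := by
  have h1 := normSq_eq_one hu
  have h2 := φ.cos_sq_add_sin_sq
  rw [dist_sq_E3]
  simp [emb, fold, Complex.mul_re, Complex.mul_im]
  linear_combination ((a - w.re) ^ 2 + (h * φ.cos + w.im) ^ 2) * h1 + h ^ 2 * h2

section
variable {Θ : PlanarAngles} {P : Fin 4 → ℂ} {R S : Fin 4 → ℝ} {φ ψ : Fin 4 → Real.Angle}

/-- The angle at the first edge enters the distance from `A₄` to `B₁`. -/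
theorem cos_eq_of_congruent (hΘ : Θ.Admissible) (hP : HasInteriorAngles P Θ.δ)
    (hR : ∀ i, 0 < R i) (h : (foldedSurface Θ P R S φ).Congruent (foldedSurface Θ P R S ψ)) :
    (φ 0).cos = (ψ 0).cos := by
  have e : P 3 = P 0 + unitVec P 0 * (Complex.exp (Θ.δ 0 * Complex.I) * len P 3) := by
    have h1 := hP.add_unitVec 3
    have h2 := hP.unitVec_eq 3
    simp only [Fin.reduceAdd] at h1 h2
    rw [h2] at h1
    linear_combination h1
  have hd := h 0 1 3 0
  change dist (emb (P 3)) (fold _ _ _ _ _) = dist (emb (P 3)) (fold _ _ _ _ _) at hd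
  have hd := congrArg (· ^ 2) hd
  simp only [e, dist_emb_mul_fold_sq (hP.norm_unitVec 0)] at hd
  have h3 : (Complex.exp (Θ.δ 0 * Complex.I) * len P 3).im = sin (Θ.δ 0) * len P 3 := by
    rw [Complex.im_mul_ofReal, Complex.exp_ofReal_mul_I_im]
  have h4 : 0 < R 0 * sin (outAng Θ 0) := mul_pos (hR 0)
    (sin_pos_of_pos_of_lt_pi (hΘ.outAng_mem 0).1 (hΘ.outAng_mem 0).2)
  have h5 := hΘ.sin_δ 0
  have h6 := (hP.len_pos 3).ne'
  have h7 : R 0 * sin (outAng Θ 0) * (sin (Θ.δ 0) * len P 3) ≠ 0 :=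
    mul_ne_zero h4.ne' (mul_ne_zero h5 h6)
  rw [h3] at hd
  apply mul_left_cancel₀ h7
  linarith

/-- The angles of the flexion, in the order of the edges. -/
def flexionEdges (D : FlexData) (ε κ t : ℝ) : Fin 4 → Real.Angle :=
  ![D.angles ε κ t 0, D.angles ε κ t 3, D.angles ε κ t 2, D.angles ε κ t 1]

theorem closes_flexionEdges (h : Θ.Admissible) (hs : Θ.SignPattern) {ε κ : ℝ}
    (hε : ε = 1 ∨ ε = -1) (hκ : κ = 1 ∨ κ = -1) (t : ℝ) :
    Closes Θ (flexionEdges (h.flexData hs) ε κ t) := by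
  choose x hx using fun i => exists_two_mul_coe (flexionEdges (h.flexData hs) ε κ t i)
  have hx' : flexionEdges (h.flexData hs) ε κ t = fun i => ((2 * x i : ℝ) : Real.Angle) := funext hx
  rw [hx', h.closes_iff_eqs hs]
  exact FlexData.OnFlexion.eqs (FlexData.curve _ t) (by rcases hε with rfl | rfl <;> norm_num)
    (by rcases hκ with rfl | rfl <;> norm_num) ((FlexData.onFlexion_iff
      (by rcases hε with rfl | rfl <;> norm_num) (by rcases hκ with rfl | rfl <;> norm_num)).2
      ⟨(hx 0).symm, (hx 3).symm, (hx 2).symm, (hx 1).symm⟩)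

theorem exists_eq_flexionEdges (h : Θ.Admissible) (hs : Θ.SignPattern) (hc : Closes Θ φ) :
    ∃ ε κ t : ℝ, (ε = 1 ∨ ε = -1) ∧ (κ = 1 ∨ κ = -1) ∧ 0 ≤ t ∧ t < 2 * π ∧
      φ = flexionEdges (h.flexData hs) ε κ t := by
  choose x hx using fun i => exists_two_mul_coe (φ i)
  obtain rfl : φ = fun i => ((2 * x i : ℝ) : Real.Angle) := funext hx
  rw [h.closes_iff_eqs hs] at hc
  obtain ⟨ε, κ, t, hε, hκ, h0, h1, hf⟩ := hc.exists_onFlexion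
  obtain ⟨e0, e1, e2, e3⟩ := (FlexData.onFlexion_iff (by rcases hε with rfl | rfl <;> norm_num)
    (by rcases hκ with rfl | rfl <;> norm_num)).1 hf
  refine ⟨ε, κ, t, hε, hκ, h0, h1, funext fun i => ?_⟩
  fin_cases i
  exacts [e0, e3, e2, e1]

theorem continuousFamily_flexion (D : FlexData) {ε κ : ℝ} (hε : ε = 1 ∨ ε = -1)
    (hκ : κ = 1 ∨ κ = -1) :
    Surface.ContinuousFamily fun t => foldedSurface Θ P R S (flexionEdges D ε κ t) := by
  have key := D.trigContinuous_angles (ε := ε) (κ := κ) (by rcases hε with rfl | rfl <;> norm_num)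
    (by rcases hκ with rfl | rfl <;> norm_num)
  refine continuousFamily_foldedSurface Θ P R S fun i => ?_
  fin_cases i
  exacts [key 0, key 3, key 2, key 1]

variable {K : Surface}

/-- The given surface lies on some branch at some `t₀`, and the branch shifted by `t₀` starts there.
If all its members were congruent, the cosine of the first dihedral angle would be constant. -/
theorem IsKokotsakis.flexible (h : Θ.Admissible) (hs : Θ.SignPattern) (hK : IsKokotsakis Θ P K) :
    K.Flexible := by
  have hP := hK.interior
  obtain ⟨R, S, φ, hR, hS, rfl⟩ := hK.exists_foldedSurface h
  have hφ := ((isKokotsakis_foldedSurface_iff h hP hR hS).1 hK).1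
  obtain ⟨ε, κ, t₀, hε, hκ, -, -, e⟩ := exists_eq_flexionEdges h hs hφ
  refine ⟨fun t => foldedSurface Θ P R S (flexionEdges (h.flexData hs) ε κ (t₀ + t)),
    fun m i => (continuousFamily_flexion _ hε hκ m i).comp (continuous_const.add continuous_id),
    by simp only [add_zero, e], fun t => faceIsometric_foldedSurface hP hφ
      (closes_flexionEdges h hs hε hκ _), ?_⟩
  by_contra! hc
  have key : ∀ t, (φ 0).cos = ((h.flexData hs).angles ε κ t 0).cos := fun t => by
    have := cos_eq_of_congruent h hP hR (hc (t - t₀))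
    rwa [add_sub_cancel] at this
  exact (h.flexData hs).cos_angles_zero_ne (by rcases hε with rfl | rfl <;> norm_num) κ
    ((key _).symm.trans (key _))

theorem dihedrals_flexion (h : Θ.Admissible) (hs : Θ.SignPattern) (hP : HasInteriorAngles P Θ.δ)
    (hR : ∀ i, 0 < R i) (ε κ t : ℝ) :
    dihedrals P (foldedSurface Θ P R S (flexionEdges (h.flexData hs) ε κ t)) =
      flexionAngles Θ ε κ t := by
  rw [dihedrals_foldedSurface h hP hR, h.flexionAngles_eq hs]
  funext j
  fin_cases j <;> rfl

theorem IsKokotsakis.exists_family (h : Θ.Admissible) (hs : Θ.SignPattern)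
    (hK : IsKokotsakis Θ P K) {ε κ : ℝ} (hε : ε = 1 ∨ ε = -1) (hκ : κ = 1 ∨ κ = -1) :
    ∃ L : ℝ → Surface, Surface.ContinuousFamily L ∧ ∀ t, IsKokotsakis Θ P (L t) ∧
      FaceIsometric K (L t) ∧ dihedrals P (L t) = flexionAngles Θ ε κ t := by
  have hP := hK.interior
  obtain ⟨R, S, φ, hR, hS, rfl⟩ := hK.exists_foldedSurface h
  obtain ⟨hφ, hd⟩ := (isKokotsakis_foldedSurface_iff h hP hR hS).1 hK
  have hc := closes_flexionEdges h hs hε hκ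
  exact ⟨_, continuousFamily_flexion (h.flexData hs) hε hκ, fun t =>
    ⟨(isKokotsakis_foldedSurface_iff h hP hR hS).2 ⟨hc t, hd⟩,
      faceIsometric_foldedSurface hP hφ (hc t), dihedrals_flexion h hs hP hR ε κ t⟩⟩

theorem IsKokotsakis.exists_of_faceIsometric (h : Θ.Admissible) (hs : Θ.SignPattern)
    (hK : IsKokotsakis Θ P K) {L : Surface} (hA : L.A = K.A) (hL : FaceIsometric K L) :
    ∃ ε κ t : ℝ, (ε = 1 ∨ ε = -1) ∧ (κ = 1 ∨ κ = -1) ∧ 0 ≤ t ∧ t < 2 * π ∧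
      dihedrals P L = flexionAngles Θ ε κ t := by
  have hP := hK.interior
  obtain ⟨R, S, φ, hR, hS, rfl⟩ := hK.exists_foldedSurface h
  obtain ⟨hφ, hd⟩ := (isKokotsakis_foldedSurface_iff h hP hR hS).1 hK
  obtain ⟨ψ, rfl, hψ⟩ := hL.exists_foldedSurface h hP hR hS hφ hA
  obtain ⟨ε, κ, t, hε, hκ, h0, h1, rfl⟩ := exists_eq_flexionEdges h hs hψ
  exact ⟨ε, κ, t, hε, hκ, h0, h1, dihedrals_flexion h hs hP hR ε κ t⟩

/-- Along the base edge, lateral sides of a third of its length reach at most to the first third and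
at least to the second third, so they cannot meet. -/
theorem lateralDisjoint_of_third (hP : HasInteriorAngles P Θ.δ) :
    LateralDisjoint Θ P (fun i => len P i / 3) (fun i => len P i / 3) := by
  intro i t ht s hs e
  exfalso
  have hl := hP.len_pos i
  have h1 : t * (len P i / 3 * cos (outAng Θ i)) ≤ len P i / 3 := by
    have : t * cos (outAng Θ i) ≤ 1 := by nlinarith [ht.1, ht.2, cos_le_one (outAng Θ i)]
    nlinarith
  have h2 : s * (len P i / 3 * cos (inAng Θ (i + 1))) ≤ len P i / 3 := by
    have : s * cos (inAng Θ (i + 1)) ≤ 1 := by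
      nlinarith [hs.1, hs.2, cos_le_one (inAng Θ (i + 1))]
    nlinarith
  have h3 : t * (len P i / 3 * cos (outAng Θ i)) =
    len P i - s * (len P i / 3 * cos (inAng Θ (i + 1))) := by rw [e]; ring
  linarith

theorem HasInteriorAngles.exists_isKokotsakis (h : Θ.Admissible) (hs : Θ.SignPattern)
    (hP : HasInteriorAngles P Θ.δ) : ∃ K, IsKokotsakis Θ P K := by
  have hpos : ∀ i, 0 < len P i / 3 := fun i => by have := hP.len_pos i; positivity
  exact ⟨_, (isKokotsakis_foldedSurface_iff h hP hpos hpos).2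
    ⟨closes_flexionEdges h hs (.inl rfl) (.inl rfl) 0, lateralDisjoint_of_third hP⟩⟩

end

/-! ### Existence of the base -/

/-- This holds because `cot a ± i = exp(± i a) / sin a`. -/
theorem cot_mul_exp {a : ℝ} (ha : sin a ≠ 0) : (((cos a / sin a : ℝ) : ℂ) + Complex.I) *
    Complex.exp (-(((2 * a : ℝ) : ℂ) * Complex.I)) = ((cos a / sin a : ℝ) : ℂ) - Complex.I := by
  have h := sin_sq_add_cos_sq a
  rw [← neg_mul, ← Complex.ofReal_neg]
  apply Complex.ext
  · simp only [Complex.mul_re, Complex.add_re, Complex.sub_re, Complex.add_im, Complex.ofReal_re,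
      Complex.ofReal_im, Complex.I_re, Complex.I_im, Complex.exp_ofReal_mul_I_re,
      Complex.exp_ofReal_mul_I_im, cos_neg, sin_neg, sin_two_mul, cos_two_mul]
    field_simp
    linear_combination (2 * cos a) * h
  · simp only [Complex.mul_im, Complex.add_re, Complex.sub_im, Complex.add_im, Complex.ofReal_re,
      Complex.ofReal_im, Complex.I_re, Complex.I_im, Complex.exp_ofReal_mul_I_re,
      Complex.exp_ofReal_mul_I_im, cos_neg, sin_neg, sin_two_mul, cos_two_mul]
    field_simp
    ring

theorem cot_add_cot_pos {a b : ℝ} (ha : 0 < a) (hb : 0 < b) (hab : a + b < π) :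
    0 < cos a / sin a + cos b / sin b := by
  have h1 := sin_pos_of_pos_of_lt_pi ha (by linarith)
  have h2 := sin_pos_of_pos_of_lt_pi hb (by linarith)
  have h3 := sin_pos_of_pos_of_lt_pi (add_pos ha hb) hab
  rw [sin_add] at h3
  rw [div_add_div _ _ h1.ne' h2.ne']
  exact div_pos (by linarith) (by positivity)

/-- A quadrilateral with given angles: the one with an inscribed unit circle about the origin. -/
theorem exists_hasInteriorAngles {δ : Fin 4 → ℝ} (hδ : ∀ i, 0 < δ i)
    (hsum : δ 0 + δ 1 + δ 2 + δ 3 = 2 * π) : ∃ P, HasInteriorAngles P δ := by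
  -- `E i` is the direction of the edge from `P i`; the angle sum `2π` makes the directions close up
  -- after four steps.
  obtain ⟨E, hE0, hE⟩ : ∃ E : Fin 4 → ℂ, (∀ i, E i ≠ 0) ∧
      ∀ i, E (i + 1) = -(E i * Complex.exp (-(δ (i + 1) * Complex.I))) := by
    refine ⟨![1, -Complex.exp (-(δ 1 * Complex.I)),
      Complex.exp (-(δ 1 * Complex.I)) * Complex.exp (-(δ 2 * Complex.I)),
      -(Complex.exp (-(δ 1 * Complex.I)) * Complex.exp (-(δ 2 * Complex.I)) *
        Complex.exp (-(δ 3 * Complex.I)))], fun i => ?_, fun i => ?_⟩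
    · fin_cases i <;> simp
    · fin_cases i
      · simp
      · simp
      · simp
      · have : Complex.exp (-(δ 1 * Complex.I)) * Complex.exp (-(δ 2 * Complex.I)) *
            Complex.exp (-(δ 3 * Complex.I)) * Complex.exp (-(δ 0 * Complex.I)) = 1 := by
          rw [← Complex.exp_add, ← Complex.exp_add, ← Complex.exp_add,
            show -(δ 1 * Complex.I) + -(δ 2 * Complex.I) + -(δ 3 * Complex.I) +
              -(δ 0 * Complex.I) = -(((δ 0 + δ 1 + δ 2 + δ 3 : ℝ) : ℂ) * Complex.I) by
              push_cast; ring, hsum, Complex.exp_neg]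
          push_cast
          rw [Complex.exp_two_pi_mul_I, inv_one]
        simp [this]
  let ct : Fin 4 → ℝ := fun i => cos (δ i / 2) / sin (δ i / 2)
  have hadd : ∀ i, δ i + δ (i + 1) < 2 * π := fun i => by
    have h0 := hδ 0
    have h1 := hδ 1
    have h2 := hδ 2
    have h3 := hδ 3
    fin_cases i <;> simp <;> linarith
  -- These sums are the edge lengths. At a reflex angle one cotangent is negative, but two adjacent
  -- angles sum to less than `2π`, which suffices.
  have hpos : ∀ i, 0 < ct i + ct (i + 1) := fun i =>
    cot_add_cot_pos (half_pos (hδ i)) (half_pos (hδ _)) (by linarith [hadd i])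
  have hsin : ∀ i, sin (δ i / 2) ≠ 0 := fun i =>
    (sin_pos_of_pos_of_lt_pi (half_pos (hδ i)) (by linarith [hadd i, hδ (i + 1)])).ne'
  let P : Fin 4 → ℂ := fun i => -(E i * (ct i + Complex.I))
  have hedge : ∀ i, P (i + 1) - P i = E i * ((ct i + ct (i + 1) : ℝ) : ℂ) := fun i => by
    have h1 := cot_mul_exp (hsin (i + 1))
    rw [mul_div_cancel₀ _ two_ne_zero] at h1
    change -(E (i + 1) * (ct (i + 1) + Complex.I)) - -(E i * (ct i + Complex.I)) = _
    rw [hE]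
    push_cast
    linear_combination E i * h1
  refine ⟨P, forall_succ fun i => ⟨?_, (ct i + ct (i + 1)) / (ct (i + 1) + ct (i + 1 + 1)),
    div_pos (hpos _) (hpos _), ?_⟩⟩
  · rw [← sub_ne_zero, hedge]
    exact mul_ne_zero (hE0 _) (Complex.ofReal_ne_zero.2 (hpos _).ne')
  · have h1 : ((ct (i + 1) + ct (i + 1 + 1) : ℝ) : ℂ) ≠ 0 :=
      Complex.ofReal_ne_zero.2 (hpos _).ne'
    have h2 : Complex.exp (δ (i + 1) * Complex.I) * Complex.exp (-(δ (i + 1) * Complex.I)) = 1 := by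
      rw [← Complex.exp_add, add_neg_cancel, Complex.exp_zero]
    rw [add_sub_cancel_right, hedge, ← neg_sub, hedge, hE, Complex.ofReal_div]
    field_simp
    linear_combination E i * ((ct i + ct (i + 1) : ℝ) : ℂ) * h2

/-! ### Cyclic re-enumeration -/

theorem nbrα_add_one (i : Fin 4) : nbrα i + 1 = nbrγ (i + 1) := by revert i; decide
theorem nbrγ_add_one (i : Fin 4) : nbrγ i + 1 = nbrα (i + 1) := by revert i; decide
theorem add_four (i : Fin 4) : i + 1 + 1 + 1 + 1 = i := by revert i; decide

theorem HasInteriorAngles.rot {Θ : PlanarAngles} {P : Fin 4 → ℂ} (h : HasInteriorAngles P Θ.δ) :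
    HasInteriorAngles (rotBase P) Θ.rot.δ := by
  intro i
  have := h (i + 1)
  rw [add_sub_cancel_right] at this
  unfold rotBase PlanarAngles.rot
  rwa [sub_add_cancel]

theorem IsKokotsakis.rot {Θ : PlanarAngles} {P : Fin 4 → ℂ} {K : Surface}
    (h : IsKokotsakis Θ P K) : IsKokotsakis Θ.rot (rotBase P) K.rot where
  interior := h.interior.rot
  base i := h.base (i + 1)
  angle_α i := by
    simp only [Surface.rot, PlanarAngles.rot, nbrα_add_one]; exact h.angle_γ (i + 1)
  angle_γ i := by
    simp only [Surface.rot, PlanarAngles.rot, nbrγ_add_one]; exact h.angle_α (i + 1)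
  angle_β i := by
    rw [EuclideanGeometry.angle_comm]; exact h.angle_β (i + 1)
  sameSide_B i := by
    simp only [Surface.rot, nbrα_add_one]; exact h.sameSide_C (i + 1)
  sameSide_C i := by
    simp only [Surface.rot, nbrγ_add_one]; exact h.sameSide_B (i + 1)
  disjoint_B i := by
    simp only [Surface.rot, nbrα_add_one]; exact h.disjoint_C (i + 1)
  disjoint_C i := by
    simp only [Surface.rot, nbrγ_add_one]; exact h.disjoint_B (i + 1)

theorem FaceIsometric.rot {K L : Surface} (h : FaceIsometric K L) :
    FaceIsometric K.rot L.rot := by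
  refine ⟨fun i j => h.1 (i + 1) (j + 1), fun i => ?_⟩
  obtain ⟨h1, h2, h3, h4, h5, h6, h7⟩ := h.2 (i + 1)
  simp only [Surface.rot, nbrα_add_one, nbrγ_add_one]
  exact ⟨h4, h5, h6, h1, h2, h3, by rw [dist_comm, h7, dist_comm]⟩

namespace Surface

/-- The permutation of the three kinds of vertices under re-enumeration. -/
def kind : Fin 3 → Fin 3 := ![0, 2, 1]

theorem vertex_rot (K : Surface) (m : Fin 3) (i : Fin 4) :
    K.rot.vertex m i = K.vertex (kind m) (i + 1) := by
  fin_cases m <;> rfl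

theorem Congruent.rot {K L : Surface} (h : Congruent K L) : Congruent K.rot L.rot := by
  intro m n i j
  simp only [vertex_rot]
  exact h _ _ _ _

theorem ContinuousFamily.rot {L : ℝ → Surface} (h : ContinuousFamily L) :
    ContinuousFamily fun t => (L t).rot := by
  intro m i
  simp only [vertex_rot]
  exact h _ _

theorem rot_four (K : Surface) : K.rot.rot.rot.rot = K := by
  obtain ⟨A, B, C⟩ := K
  simp only [Surface.rot, add_four]

theorem Flexible.rot {K : Surface} (h : K.Flexible) : K.rot.Flexible := by
  obtain ⟨L, hL, rfl, hf, t, ht⟩ := h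
  refine ⟨fun t => (L t).rot, hL.rot, rfl, fun t => (hf t).rot, t, fun hc => ht ?_⟩
  have := hc.rot.rot.rot
  rwa [rot_four, rot_four] at this

theorem Flexible.rot_iterate {K : Surface} (h : K.Flexible) (k : ℕ) :
    (Surface.rot^[k] K).Flexible := by
  induction k with
  | zero => exact h
  | succ k ih => rw [Function.iterate_succ_apply']; exact ih.rot

theorem ContinuousFamily.rot_iterate {L : ℝ → Surface} (h : ContinuousFamily L) (k : ℕ) :
    ContinuousFamily fun t => Surface.rot^[k] (L t) := by
  induction k with
  | zero => exact h
  | succ k ih => simp only [Function.iterate_succ_apply']; exact ih.rot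

end Surface

theorem IsKokotsakis.rot_iterate {Θ : PlanarAngles} {P : Fin 4 → ℂ} {K : Surface}
    (h : IsKokotsakis Θ P K) (k : ℕ) :
    IsKokotsakis (PlanarAngles.rot^[k] Θ) (rotBase^[k] P) (Surface.rot^[k] K) := by
  induction k with
  | zero => exact h
  | succ k ih => simp only [Function.iterate_succ_apply']; exact ih.rot

theorem FaceIsometric.rot_iterate {K L : Surface} (h : FaceIsometric K L) (k : ℕ) :
    FaceIsometric (Surface.rot^[k] K) (Surface.rot^[k] L) := by
  induction k with
  | zero => exact h
  | succ k ih => simp only [Function.iterate_succ_apply']; exact ih.rot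

theorem HasInteriorAngles.rot_iterate {Θ : PlanarAngles} {P : Fin 4 → ℂ}
    (h : HasInteriorAngles P Θ.δ) (k : ℕ) :
    HasInteriorAngles (rotBase^[k] P) (PlanarAngles.rot^[k] Θ).δ := by
  induction k with
  | zero => exact h
  | succ k ih => simp only [Function.iterate_succ_apply']; exact ih.rot

/-- A re-enumeration by `k` steps is undone by `3k` further ones, for every `k` and without
reduction modulo `4`. -/
theorem iterate_three_mul {X : Type*} {f : X → X} (hf : ∀ x, f (f (f (f x))) = x) (k : ℕ) (x : X) :
    f^[3 * k] (f^[k] x) = x := by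
  rw [← Function.iterate_add_apply, show 3 * k + k = 4 * k by ring, Function.iterate_mul,
    show f^[4] = id from funext hf, Function.iterate_id, id]

theorem iterate_three_mul' {X : Type*} {f : X → X} (hf : ∀ x, f (f (f (f x))) = x) (k : ℕ)
    (x : X) : f^[k] (f^[3 * k] x) = x := by
  rw [← Function.iterate_add_apply, add_comm, Function.iterate_add_apply, iterate_three_mul hf]

theorem PlanarAngles.rot_four (Θ : PlanarAngles) : Θ.rot.rot.rot.rot = Θ := by
  obtain ⟨α, β, γ, δ⟩ := Θ
  simp only [PlanarAngles.rot, add_four]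

theorem rotBase_four (P : Fin 4 → ℂ) : rotBase (rotBase (rotBase (rotBase P))) = P :=
  funext fun i => congrArg P (add_four i)

theorem IsKokotsakis.of_rot_iterate {Θ : PlanarAngles} {P : Fin 4 → ℂ} {K : Surface} {k : ℕ}
    (h : IsKokotsakis (PlanarAngles.rot^[k] Θ) (rotBase^[k] P) K) :
    IsKokotsakis Θ P (Surface.rot^[3 * k] K) := by
  have := h.rot_iterate (3 * k)
  rwa [iterate_three_mul PlanarAngles.rot_four, iterate_three_mul rotBase_four] at this

theorem FaceIsometric.of_rot_iterate {K L : Surface} {k : ℕ}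
    (h : FaceIsometric (Surface.rot^[k] K) L) : FaceIsometric K (Surface.rot^[3 * k] L) := by
  have := h.rot_iterate (3 * k)
  rwa [iterate_three_mul Surface.rot_four] at this

theorem rot_iterate_A {K L : Surface} (h : L.A = K.A) (k : ℕ) :
    (Surface.rot^[k] L).A = (Surface.rot^[k] K).A := by
  induction k with
  | zero => exact h
  | succ k ih =>
    simp only [Function.iterate_succ_apply', Surface.rot, ih]

end Kokotsakis

end

/-! ### The theorem for the original enumeration -/

theorem mainTheorem11 (τ : ℝ) (σα σγ : Fin 4 → ℝ) (Θ : Kokotsakis.PlanarAngles)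
    (h : Kokotsakis.ChecksPass τ σα σγ Θ) :
    -- the computed angles are of orthodiagonal anti-involutive type
    Θ.IsOAI ∧
    -- the vertices can be re-enumerated to get the required sign pattern
    (∃ k : ℕ, k < 4 ∧ (Kokotsakis.PlanarAngles.rot^[k] Θ).SignPattern) ∧
    -- base quadrilaterals exist, and each one is the base of a Kokotsakis polyhedron
    (∃ P : Fin 4 → ℂ, Kokotsakis.HasInteriorAngles P Θ.δ) ∧
    (∀ P : Fin 4 → ℂ, Kokotsakis.HasInteriorAngles P Θ.δ →
      ∃ K : Kokotsakis.Surface, Kokotsakis.IsKokotsakis Θ P K) ∧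
    -- every Kokotsakis polyhedron with these planar angles is flexible, with the given flexion
    (∀ (P : Fin 4 → ℂ) (K : Kokotsakis.Surface), Kokotsakis.IsKokotsakis Θ P K →
      K.Flexible ∧
      ∀ k : ℕ, (Kokotsakis.PlanarAngles.rot^[k] Θ).SignPattern →
        -- each branch of the formulas is realized by a non-trivial isometric deformation
        (∀ ε κ : ℝ, (ε = 1 ∨ ε = -1) → (κ = 1 ∨ κ = -1) →
          (∃ L : ℝ → Kokotsakis.Surface, Kokotsakis.Surface.ContinuousFamily L ∧
            ∀ t, Kokotsakis.IsKokotsakis Θ P (L t) ∧ Kokotsakis.FaceIsometric K (L t) ∧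
              Kokotsakis.dihedrals (Kokotsakis.rotBase^[k] P) (Kokotsakis.Surface.rot^[k] (L t)) =
                Kokotsakis.flexionAngles (Kokotsakis.PlanarAngles.rot^[k] Θ) ε κ t) ∧
          ∀ j : Fin 4, ∃ t t' : ℝ,
            Kokotsakis.flexionAngles (Kokotsakis.PlanarAngles.rot^[k] Θ) ε κ t j ≠
              Kokotsakis.flexionAngles (Kokotsakis.PlanarAngles.rot^[k] Θ) ε κ t' j) ∧
        -- and there are no other isometric positions of the polyhedron over the same base
        (∀ L : Kokotsakis.Surface, L.A = K.A → Kokotsakis.FaceIsometric K L →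
          ∃ ε κ t : ℝ, (ε = 1 ∨ ε = -1) ∧ (κ = 1 ∨ κ = -1) ∧ 0 ≤ t ∧ t < 2 * Real.pi ∧
            Kokotsakis.dihedrals (Kokotsakis.rotBase^[k] P) (Kokotsakis.Surface.rot^[k] L) =
              Kokotsakis.flexionAngles (Kokotsakis.PlanarAngles.rot^[k] Θ) ε κ t)) := by
  have hΘ := h.admissible
  obtain ⟨k, hk, hs⟩ := h.exists_signPattern
  refine ⟨h.isOAI, ⟨k, hk, hs⟩, Kokotsakis.exists_hasInteriorAngles h.δ_pos h.δ_sum, fun P hP => ?_,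
    fun P K hK => ⟨?_, fun k hs => ⟨fun ε κ hε hκ => ⟨?_, fun j => ?_⟩, fun L hA hL =>
      (hK.rot_iterate k).exists_of_faceIsometric (hΘ.rot_iterate k) hs
        (Kokotsakis.rot_iterate_A hA k) (hL.rot_iterate k)⟩⟩⟩
  -- The polyhedron is built over the re-enumerated base, where the sign pattern holds, and then
  -- shifted back.
  · obtain ⟨K, hK⟩ := (hP.rot_iterate k).exists_isKokotsakis (hΘ.rot_iterate k) hs
    exact ⟨_, hK.of_rot_iterate⟩
  · have := ((hK.rot_iterate k).flexible (hΘ.rot_iterate k) hs).rot_iterate (3 * k)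
    rwa [Kokotsakis.iterate_three_mul Kokotsakis.Surface.rot_four] at this
  · obtain ⟨L, hL, hL'⟩ := (hK.rot_iterate k).exists_family (hΘ.rot_iterate k) hs hε hκ
    refine ⟨_, hL.rot_iterate (3 * k), fun t => ⟨(hL' t).1.of_rot_iterate,
      (hL' t).2.1.of_rot_iterate, ?_⟩⟩
    rw [Kokotsakis.iterate_three_mul' Kokotsakis.Surface.rot_four]
    exact (hL' t).2.2
  · simp only [(hΘ.rot_iterate k).flexionAngles_eq hs]
    exact Kokotsakis.FlexData.angles_not_constant _ (by rcases hε with rfl | rfl <;> norm_num)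
      (by rcases hκ with rfl | rfl <;> norm_num) j
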